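/- Let $H$ be a finite-dimensional Hopf algebra over a field $k$ with bijective antipode $S$ (bijectivity is in fact automatic here); write $\Delta(h)=h_{(1)}\otimes h_{(2)}$ and $\epsilon$ for its coproduct and counit. **Notation.** Let $H_{par}$ be the quotient of the tensor algebra of $H$ (with $[h]$ the class of $h\in H$) by the relations $$[1_H]=1,\qquad [h][x_{(1)}][S(x_{(2)})]=[hx_{(1)}][S(x_{(2)})],\qquad [h_{(1)}][S(h_{(2)})][x]=[h_{(1)}][S(h_{(2)})x].$$ Let $A_{par}\subseteq H_{par}$ be the subalgebra generated by the elements $\varepsilon_h=[h_{(1)}][S(h_{(2)})]$, with the partial $H$-action $h\bullet a=[h_{(1)}]\,a\,[S(h_{(2)})]$. Let $\{A_{par},A_{par}\}$ be the space of $k$-linear maps $f:A_{par}\otimes H\to A_{par}$ with $f(h_{(1)}\bullet a\otimes h_{(2)}x)=h\bullet f(a\otimes x)$ for all $h,x\in H$ and $a\in A_{par}$. It is an $H$-module algebra with product $(fg)(a\otimes x)=g(f(a\otimes x_{(1)})\otimes x_{(2)})$, unit $a\otimes x\mapsto\epsilon(x)a$ and action $(h\rightharpoonup f)(a\otimes x)=f(a\otimes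 xh)$. Let $H_{glob}=\{A_{par},A_{par}\}\#H$ be the smash product: the space $\{A_{par},A_{par}\}\otimes H$ with product $(f\#h)(g\#l)=f(h_{(1)}\rightharpoonup g)\#h_{(2)}l$. **Theorem.** There is a linear map $\rho_A:A_{par}\to A_{par}\otimes H$, $a\mapsto a^{(0)}\otimes a^{(1)}$, with $$\rho_A(1)=1\otimes 1,\qquad \rho_A(\varepsilon_h)=\varepsilon_{h_{(2)}}\otimes h_{(3)}S^{-1}(h_{(1)}),\qquad \rho_A(ab)=a^{(0)}b^{(0)}\otimes b^{(1)}a^{(1)},$$ and a linear map $\rho:\{A_{par},A_{par}\}\to\{A_{par},A_{par}\}\otimes H$, $f\mapsto f^{(0)}\otimes f^{(1)}$, with, writing $f(x)=f(1\otimes x)$, $$f^{(0)}(x)\otimes f^{(1)}=f(x_{(2)})^{(0)}\otimes S^{-1}(x_{(3)})\,f(x_{(2)})^{(1)}\,x_{(1)}\qquad(x\in H),$$ such that the following hold. 1. With the action $\rightharpoonup$ and the coaction $\rho$, $\{A_{par},A_{par}\}$ is a braided commutative algebra in the category ${}_H\mathcal{YD}^H$ of left-right Yetter–Drinfeld modules: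 it is a left $H$-module algebra and a right $H$-comodule, and $$\rho(l\rightharpoonup f)=(l_{(2)}\rightharpoonup f^{(0)})\otimes l_{(3)}f^{(1)}S^{-1}(l_{(1)}),\qquad \rho(1)=1\otimes1,\qquad \rho(fg)=f^{(0)}g^{(0)}\otimes g^{(1)}f^{(1)},\qquad f^{(0)}(f^{(1)}\rightharpoonup g)=gf.$$ 2. Consequently $H_{glob}$ is a Hopf algebroid over $B=\{A_{par},A_{par}\}$. Namely, it is a left bialgebroid over $B$ with source, target, comultiplication and counit $$s(f)=f\#1,\quad t(f)=f^{(0)}\#f^{(1)},\quad \Delta(f\#h)=(f\#h_{(1)})\otimes_B(1\#h_{(2)}),\quad \varepsilon(f\#h)=\epsilon(h)f,$$ where $H_{glob}\otimes_B H_{glob}$ is formed with respect to the $B$-bimodule structure $b\cdot r\cdot b'=s(b)t(b')r$; and there is a bijective anti-multiplicative linear map $\tau:H_{glob}\to H_{glob}$ that is an antipode for it both in the sense of Böhm–Szlachányi, i.e. $\tau(t(b))=s(b)$ and, in $H_{glob}\otimes_B H_{glob}$, $$\tau(r_{(1)})_{(1)}r_{(2)}\otimes\tau(r_{(1)})_{(2)}=1\otimes\tau(r),\qquad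 \tau^{-1}(r_{(2)})_{(1)}\otimes\tau^{-1}(r_{(2)})_{(2)}r_{(1)}=\tau^{-1}(r)\otimes1,$$ and in the sense of Lu, i.e. $\tau(t(b))=s(b)$, $\tau(r_{(1)})r_{(2)}=t(\varepsilon(\tau(r)))$, and for some linear section $\gamma$ of the projection $H_{glob}\otimes_k H_{glob}\to H_{glob}\otimes_B H_{glob}$ one has $m(\mathrm{id}\otimes\tau)\gamma\Delta=s\,\varepsilon$, where $m$ is the multiplication. -/

import Mathlib

open scoped TensorProduct

namespace PartialHopf

open TensorProduct Coalgebra HopfAlgebra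

universe u v w

section PartialModules

variable {k : Type u} {H : Type v} [Field k] [Ring H] [HopfAlgebra k H]
variable {B : Type*} [Ring B] [Algebra k B]

/-- `h ↦ π(h₍₁₎) π(S(h₍₂₎))`. -/
noncomputable def epsOf (π : H →ₗ[k] B) : H →ₗ[k] B :=
  LinearMap.mul' k B ∘ₗ TensorProduct.map π (π ∘ₗ antipode k) ∘ₗ comul

/-- Partial representations of a Hopf algebra. -/
structure IsPartialRep (π : H →ₗ[k] B) : Prop where
  map_one : π 1 = 1
  /-- `π(h) π(x₍₁₎) π(S(x₍₂₎)) = π(h x₍₁₎) π(S(x₍₂₎))` -/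
  left : ∀ h x : H, π h * epsOf π x =
    LinearMap.mul' k B
      (TensorProduct.map (π ∘ₗ LinearMap.mulLeft k h) (π ∘ₗ antipode k) (comul x))
  /-- `π(h₍₁₎) π(S(h₍₂₎)) π(x) = π(h₍₁₎) π(S(h₍₂₎) x)` -/
  right : ∀ h x : H, epsOf π h * π x =
    LinearMap.mul' k B
      (TensorProduct.map π (π ∘ₗ LinearMap.mulRight k x ∘ₗ antipode k) (comul h))

variable (k H)

/-- The relations defining the partial Hopf algebra, imposed on the tensor algebra of `H`. -/
inductive HparRel : TensorAlgebra k H → TensorAlgebra k H → Prop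
  | one : HparRel (TensorAlgebra.ι k 1) 1
  | left (h x : H) : HparRel
      (TensorAlgebra.ι k h * epsOf (TensorAlgebra.ι k) x)
      (LinearMap.mul' k (TensorAlgebra k H)
        (TensorProduct.map (TensorAlgebra.ι k ∘ₗ LinearMap.mulLeft k h)
          (TensorAlgebra.ι k ∘ₗ antipode k) (comul x)))
  | right (h x : H) : HparRel
      (epsOf (TensorAlgebra.ι k) h * TensorAlgebra.ι k x)
      (LinearMap.mul' k (TensorAlgebra k H)
        (TensorProduct.map (TensorAlgebra.ι k)
          (TensorAlgebra.ι k ∘ₗ LinearMap.mulRight k x ∘ₗ antipode k) (comul h)))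

/-- The partial Hopf algebra `H_par`. -/
def Hpar : Type (max u v) := RingQuot (HparRel k H)

noncomputable instance : Ring (Hpar k H) := inferInstanceAs (Ring (RingQuot (HparRel k H)))

noncomputable instance : Algebra k (Hpar k H) :=
  inferInstanceAs (Algebra k (RingQuot (HparRel k H)))

/-- The quotient map from the tensor algebra. -/
noncomputable def Hpar.mk : TensorAlgebra k H →ₐ[k] Hpar k H := RingQuot.mkAlgHom k (HparRel k H)

variable {k H} in
theorem Hpar.mk_rel {x y : TensorAlgebra k H} (h : HparRel k H x y) :
    Hpar.mk k H x = Hpar.mk k H y := RingQuot.mkAlgHom_rel k h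

/-- The universal partial representation `h ↦ [h]`. -/
noncomputable def bracket : H →ₗ[k] Hpar k H :=
  (Hpar.mk k H).toLinearMap ∘ₗ TensorAlgebra.ι k

variable {k H} in
theorem algHom_mul'_map {A C : Type*} [Ring A] [Algebra k A] [Ring C] [Algebra k C]
    (φ : A →ₐ[k] C) {M N : Type*} [AddCommGroup M] [Module k M] [AddCommGroup N] [Module k N]
    (f : M →ₗ[k] A) (g : N →ₗ[k] A) (t : M ⊗[k] N) :
    φ (LinearMap.mul' k A (TensorProduct.map f g t)) =
      LinearMap.mul' k C (TensorProduct.map (φ.toLinearMap ∘ₗ f) (φ.toLinearMap ∘ₗ g) t) := by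
  induction t with
  | zero => simp
  | tmul x y => simp
  | add x y hx hy => simp only [map_add, hx, hy]

theorem bracket_isPartialRep : IsPartialRep (bracket k H) where
  map_one := by
    have := Hpar.mk_rel (HparRel.one (k := k) (H := H))
    simpa [bracket] using this
  left h x := by
    have := Hpar.mk_rel (HparRel.left (k := k) (H := H) h x)
    simpa [epsOf, algHom_mul'_map, bracket, LinearMap.comp_assoc] using this
  right h x := by
    have := Hpar.mk_rel (HparRel.right (k := k) (H := H) h x)
    simpa [epsOf, algHom_mul'_map, bracket, LinearMap.comp_assoc] using this

/-- The subalgebra `A_par` of `H_par` generated by the elements `ε_h = [h₍₁₎][S(h₍₂₎)]`. -/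
noncomputable def AparSub : Subalgebra k (Hpar k H) :=
  Algebra.adjoin k (Set.range (epsOf (bracket k H)))

/-- The algebra `A_par`. -/
def Apar : Type (max u v) := AparSub k H

noncomputable instance : Ring (Apar k H) := inferInstanceAs (Ring (AparSub k H))

noncomputable instance : Algebra k (Apar k H) := inferInstanceAs (Algebra k (AparSub k H))

/-- The inclusion of `A_par` into `H_par`. -/
noncomputable def Apar.incl : Apar k H →ₐ[k] Hpar k H := (AparSub k H).val

/-- The elements `ε_h`, as elements of `A_par`. -/
noncomputable def epsA : H →ₗ[k] Apar k H where
  toFun h := (⟨epsOf (bracket k H) h, Algebra.subset_adjoin ⟨h, rfl⟩⟩ : AparSub k H)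
  map_add' x y := Subtype.ext (map_add (epsOf (bracket k H)) x y)
  map_smul' r x := Subtype.ext (map_smul (epsOf (bracket k H)) r x)

/-- The map `h ↦ (x ↦ [h₍₁₎] x [S(h₍₂₎)])` on `H_par`. -/
noncomputable def conj : H →ₗ[k] Module.End k (Hpar k H) :=
  LinearMap.mul' k (Module.End k (Hpar k H)) ∘ₗ
    TensorProduct.map (LinearMap.mul k (Hpar k H) ∘ₗ bracket k H)
      ((LinearMap.mul k (Hpar k H)).flip ∘ₗ bracket k H ∘ₗ antipode k) ∘ₗ comul

variable {k H}

theorem bracket_mul_eps (h x : H) :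
    bracket k H h * epsOf (bracket k H) x =
      LinearMap.mul' k (Hpar k H)
        (TensorProduct.map (epsOf (bracket k H) ∘ₗ LinearMap.mulRight k x) (bracket k H)
          (comul h)) := by
  rw [(bracket_isPartialRep k H).left]
  -- the trilinear map `x ⊗ y ⊗ z ↦ ∑ [x p] [S(q) S(y) z]` where `Δ x = ∑ p ⊗ q`
  obtain ⟨ι, s, p, q, hpq⟩ : ∃ (ι : Type v) (s : Finset ι) (p q : ι → H),
      comul (R := k) x = ∑ i ∈ s, p i ⊗ₜ q i := by
    exact ⟨_, (ℛ k x).index, (ℛ k x).left, (ℛ k x).right, (ℛ k x).eq.symm⟩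
  let G : H ⊗[k] (H ⊗[k] H) →ₗ[k] Hpar k H := ∑ i ∈ s,
    LinearMap.mul' k (Hpar k H) ∘ₗ
      TensorProduct.map (bracket k H ∘ₗ LinearMap.mulRight k (p i))
        (bracket k H ∘ₗ LinearMap.mulLeft k (antipode k (q i)) ∘ₗ
          LinearMap.mul' k H ∘ₗ (antipode k).rTensor H)
  have h1 : G (TensorProduct.assoc k H H H (comul.rTensor H (comul h))) =
      LinearMap.mul' k (Hpar k H)
        (TensorProduct.map (epsOf (bracket k H) ∘ₗ LinearMap.mulRight k x) (bracket k H)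
          (comul h)) := by
    have key : G ∘ₗ (TensorProduct.assoc k H H H).toLinearMap ∘ₗ comul.rTensor H =
        LinearMap.mul' k (Hpar k H) ∘ₗ
        TensorProduct.map (epsOf (bracket k H) ∘ₗ LinearMap.mulRight k x) (bracket k H) := by
      ext a c
      simp only [G, AlgebraTensorModule.curry_apply, curry_apply, LinearMap.coe_restrictScalars,
        LinearMap.comp_apply, map_tmul, LinearMap.mul'_apply, LinearMap.mulRight_apply,
        LinearMap.rTensor_tmul, LinearEquiv.coe_coe]
      rw [(bracket_isPartialRep k H).right, Bialgebra.comul_mul, hpq]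
      generalize comul (R := k) a = t
      induction t with
      | zero => simp
      | tmul y z =>
        simp [Finset.mul_sum, mul_assoc, LinearMap.sum_apply, HopfAlgebra.antipode_mul_antidistrib]
      | add y z hy hz => simp only [add_tmul, map_add, hy, hz, add_mul]
    exact LinearMap.congr_fun key (comul h)
  rw [← h1, Coalgebra.coassoc_apply]
  have h2 : G ∘ₗ comul.lTensor H = (∑ i ∈ s, LinearMap.mul' k (Hpar k H) ∘ₗ
      TensorProduct.map (bracket k H ∘ₗ LinearMap.mulRight k (p i))
        (bracket k H ∘ₗ LinearMap.mulLeft k (antipode k (q i)) ∘ₗ Algebra.linearMap k H)) ∘ₗ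
        counit.lTensor H := by
    ext a c
    have := HopfAlgebra.mul_antipode_rTensor_comul_apply (R := k) c
    simp [G, this]
  have h3 := LinearMap.congr_fun h2 (comul h)
  rw [LinearMap.comp_apply, LinearMap.comp_apply, Coalgebra.lTensor_counit_comul] at h3
  rw [h3, hpq]
  simp [LinearMap.sum_apply]

theorem conj_apply_mem (h : H) {a : Hpar k H} (ha : a ∈ AparSub k H) :
    conj k H h a ∈ AparSub k H := by
  -- `δ h = [h₍₁₎] ⊗ h₍₂₎`
  let δ : H →ₗ[k] Hpar k H ⊗[k] H := (bracket k H).rTensor H ∘ₗ comul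
  let N : Submodule k (Hpar k H ⊗[k] H) :=
    Submodule.span k {z | ∃ b ∈ AparSub k H, ∃ x : H, z = (b ⊗ₜ 1) * δ x}
  have hN : ∀ c ∈ AparSub k H, ∀ n ∈ N, (c ⊗ₜ 1) * n ∈ N := by
    intro c hc n hn
    induction hn using Submodule.span_induction with
    | mem n hn =>
      obtain ⟨b, hb, x, rfl⟩ := hn
      refine Submodule.subset_span ⟨c * b, mul_mem hc hb, x, ?_⟩
      rw [← mul_assoc, Algebra.TensorProduct.tmul_mul_tmul, one_mul]
    | zero => simp
    | add x y _ _ hx hy => rw [mul_add]; exact add_mem hx hy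
    | smul r x _ hx => rw [mul_smul_comm]; exact N.smul_mem r hx
  have main : ∀ x : H, δ x * (a ⊗ₜ 1) ∈ N := by
    induction ha using Algebra.adjoin_induction with
    | mem a ha =>
      obtain ⟨y, rfl⟩ := ha
      intro x
      let F : H ⊗[k] (H ⊗[k] H) →ₗ[k] Hpar k H ⊗[k] H :=
        (LinearMap.mul' k (Hpar k H)).rTensor H ∘ₗ
          (TensorProduct.assoc k (Hpar k H) (Hpar k H) H).symm.toLinearMap ∘ₗ
          TensorProduct.map (epsOf (bracket k H) ∘ₗ LinearMap.mulRight k y)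
            ((bracket k H).rTensor H)
      have e1 : F (TensorProduct.assoc k H H H (comul.rTensor H (comul x))) =
          δ x * (epsOf (bracket k H) y ⊗ₜ 1) := by
        have key : F ∘ₗ (TensorProduct.assoc k H H H).toLinearMap ∘ₗ comul.rTensor H =
            LinearMap.mulRight k (epsOf (bracket k H) y ⊗ₜ[k] (1 : H)) ∘ₗ
              (bracket k H).rTensor H := by
          ext a c
          simp only [F, AlgebraTensorModule.curry_apply, curry_apply,
            LinearMap.coe_restrictScalars, LinearMap.comp_apply, LinearMap.mulRight_apply,
            LinearMap.rTensor_tmul, LinearEquiv.coe_coe, Algebra.TensorProduct.tmul_mul_tmul,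
            mul_one, bracket_mul_eps]
          generalize comul (R := k) a = t
          induction t with
          | zero => simp
          | tmul y z => simp
          | add y z hy hz => simp only [add_tmul, map_add, hy, hz]
        exact LinearMap.congr_fun key (comul x)
      rw [← e1, Coalgebra.coassoc_apply]
      generalize comul (R := k) x = t
      induction t with
      | zero => simp
      | tmul p q =>
        refine Submodule.subset_span ⟨epsOf (bracket k H) (p * y),
          Algebra.subset_adjoin ⟨_, rfl⟩, q, ?_⟩
        simp only [LinearMap.lTensor_tmul, F, δ, LinearMap.comp_apply]
        generalize comul (R := k) q = t
        induction t with
        | zero => simp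
        | tmul y z => simp
        | add y z hy hz => simp only [tmul_add, map_add, hy, hz, mul_add]
      | add p q hp hq => simp only [map_add]; exact add_mem hp hq
    | algebraMap r =>
      intro x
      have : (algebraMap k (Hpar k H) r) ⊗ₜ[k] (1 : H) = r • 1 := by
        rw [Algebra.algebraMap_eq_smul_one, Algebra.TensorProduct.one_def, TensorProduct.smul_tmul']
      rw [this, mul_smul_comm, mul_one]
      refine N.smul_mem r (Submodule.subset_span ⟨1, one_mem _, x, ?_⟩)
      rw [← Algebra.TensorProduct.one_def, one_mul]
    | add a b _ _ ha hb => intro x; rw [add_tmul, mul_add]; exact add_mem (ha x) (hb x)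
    | mul a b _ _ ha hb =>
      intro x
      have e : (a * b) ⊗ₜ[k] (1 : H) = (a ⊗ₜ 1) * (b ⊗ₜ 1) := by simp
      rw [e, ← mul_assoc]
      have hx := ha x
      generalize δ x * a ⊗ₜ[k] (1 : H) = n at hx
      induction hx using Submodule.span_induction with
      | mem n hn =>
        obtain ⟨c, hc, y, rfl⟩ := hn
        rw [mul_assoc]
        exact hN c hc _ (hb y)
      | zero => simp
      | add x y _ _ hx hy => rw [add_mul]; exact add_mem hx hy
      | smul r x _ hx => rw [smul_mul_assoc]; exact N.smul_mem r hx
  -- apply `u ⊗ v ↦ u [S(v)]`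
  let m : Hpar k H ⊗[k] H →ₗ[k] Hpar k H :=
    LinearMap.mul' k (Hpar k H) ∘ₗ (bracket k H ∘ₗ antipode k).lTensor (Hpar k H)
  have hm : ∀ n ∈ N, m n ∈ AparSub k H := by
    intro n hn
    induction hn using Submodule.span_induction with
    | mem n hn =>
      obtain ⟨c, hc, y, rfl⟩ := hn
      have : m ((c ⊗ₜ 1) * δ y) = c * epsOf (bracket k H) y := by
        simp only [m, δ, epsOf, LinearMap.comp_apply]
        generalize comul (R := k) y = t
        induction t with
        | zero => simp
        | tmul y z => simp [mul_assoc]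
        | add y z hy hz => simp only [map_add, hy, hz, mul_add]
      rw [this]
      exact mul_mem hc (Algebra.subset_adjoin ⟨y, rfl⟩)
    | zero => simp
    | add x y _ _ hx hy => rw [map_add]; exact add_mem hx hy
    | smul r x _ hx => rw [map_smul]; exact Subalgebra.smul_mem _ hx r
  have e : conj k H h a = m (δ h * (a ⊗ₜ 1)) := by
    simp only [m, δ, conj, LinearMap.comp_apply]
    generalize comul (R := k) h = t
    induction t with
    | zero => simp
    | tmul y z => simp [mul_assoc, Module.End.mul_apply]
    | add y z hy hz => simp only [map_add, hy, hz, add_mul, LinearMap.add_apply]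
  rw [e]
  exact hm _ (main h)

variable (k H) in
/-- The partial action `h • a = [h₍₁₎] a [S(h₍₂₎)]` of `H` on `A_par`. -/
noncomputable def bullet : H →ₗ[k] Module.End k (Apar k H) where
  toFun h :=
    { toFun := fun a => (⟨conj k H h (Apar.incl k H a), conj_apply_mem h a.2⟩ : AparSub k H)
      map_add' := fun _ _ => Subtype.ext (map_add (conj k H h) _ _)
      map_smul' := fun r _ => Subtype.ext (map_smul (conj k H h) r _) }
  map_add' x y := LinearMap.ext fun _ => Subtype.ext (LinearMap.map_add₂ (conj k H) x y _)
  map_smul' r x := LinearMap.ext fun _ => Subtype.ext (LinearMap.map_smul₂ (conj k H) r x _)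

/-- The diagonal action `h • (m ⊗ x) = h₍₁₎ • m ⊗ h₍₂₎ • x` on a tensor product. -/
noncomputable def diag {M X : Type*} [AddCommGroup M] [Module k M] [AddCommGroup X] [Module k X]
    (π : H →ₗ[k] Module.End k M) (σ : H →ₗ[k] Module.End k X) :
    H →ₗ[k] Module.End k (M ⊗[k] X) :=
  TensorProduct.map₂ π σ ∘ₗ comul

/-- The space of morphisms of partial modules. -/
def pHom {M N : Type*} [AddCommGroup M] [Module k M] [AddCommGroup N] [Module k N]
    (π : H →ₗ[k] Module.End k M) (π' : H →ₗ[k] Module.End k N) : Submodule k (M →ₗ[k] N) where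
  carrier := {f | ∀ h m, f (π h m) = π' h (f m)}
  zero_mem' := by simp
  add_mem' hf hg h m := by simp [hf h m, hg h m]
  smul_mem' r f hf h m := by simp [hf h m]

/-- The hom-object `{M, N}`: the space of morphisms of partial modules `M ⊗ H → N`, where `H`
acts on itself by left multiplication. -/
def Brace {M N : Type*} [AddCommGroup M] [Module k M] [AddCommGroup N] [Module k N]
    (π : H →ₗ[k] Module.End k M) (π' : H →ₗ[k] Module.End k N) : Type _ :=
  pHom (diag π (LinearMap.mul k H)) π'

section Brace

variable {M N P : Type*} [AddCommGroup M] [Module k M] [AddCommGroup N] [Module k N]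
  [AddCommGroup P] [Module k P]
variable {π : H →ₗ[k] Module.End k M} {π' : H →ₗ[k] Module.End k N}
  {π'' : H →ₗ[k] Module.End k P}

noncomputable instance : AddCommGroup (Brace π π') :=
  inferInstanceAs (AddCommGroup (pHom (diag π (LinearMap.mul k H)) π'))

noncomputable instance : Module k (Brace π π') :=
  inferInstanceAs (Module k (pHom (diag π (LinearMap.mul k H)) π'))

variable (π π') in
/-- The inclusion of `{M, N}` into `Hom_k(M ⊗ H, N)`. -/
noncomputable def Brace.incl : Brace π π' →ₗ[k] (M ⊗[k] H →ₗ[k] N) :=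
  (pHom (diag π (LinearMap.mul k H)) π').subtype

theorem Brace.incl_injective : Function.Injective (Brace.incl π π') := Subtype.val_injective

theorem Brace.ext {f g : Brace π π'} (h : Brace.incl π π' f = Brace.incl π π' g) : f = g :=
  Brace.incl_injective h

theorem Brace.equivariant (f : Brace π π') (h : H) (z : M ⊗[k] H) :
    Brace.incl π π' f (diag π (LinearMap.mul k H) h z) = π' h (Brace.incl π π' f z) := f.2 h z

/-- The `k`-linear map `m ⊗ h ↦ φ(m ⊗ h₍₁₎) ⊗ h₍₂₎`. -/
noncomputable def hat : (M ⊗[k] H →ₗ[k] N) →ₗ[k] (M ⊗[k] H →ₗ[k] N ⊗[k] H) :=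
  LinearMap.lcomp k (N ⊗[k] H)
      ((TensorProduct.assoc k M H H).symm.toLinearMap ∘ₗ comul.lTensor M) ∘ₗ
    LinearMap.rTensorHom H

theorem hat_tmul (f : M ⊗[k] H →ₗ[k] N) (m : M) (h : H) :
    hat f (m ⊗ₜ h) =
      TensorProduct.map (f ∘ₗ TensorProduct.mk k M H m) LinearMap.id (comul h) := by
  simp only [hat, LinearMap.comp_apply, LinearMap.lcomp_apply, LinearMap.lTensor_tmul,
    LinearEquiv.coe_coe, LinearMap.coe_rTensorHom]
  generalize comul (R := k) h = t
  induction t with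
  | zero => simp
  | tmul x y => simp
  | add x y hx hy => simp only [tmul_add, map_add, hx, hy]

theorem diag_lTensor {X Y : Type*} [AddCommGroup X] [Module k X] [AddCommGroup Y] [Module k Y]
    {σ : H →ₗ[k] Module.End k X} {τ : H →ₗ[k] Module.End k Y} (g : X →ₗ[k] Y)
    (hg : ∀ h x, g (σ h x) = τ h (g x)) (h : H) (z : M ⊗[k] X) :
    g.lTensor M (diag π σ h z) = diag π τ h (g.lTensor M z) := by
  simp only [diag, LinearMap.comp_apply]
  generalize comul (R := k) h = t
  induction t with
  | zero => simp
  | tmul a b =>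
    induction z with
    | zero => simp
    | tmul m x => simp [hg]
    | add x y hx hy => simp only [map_add, hx, hy]
  | add x y hx hy => simp only [map_add, LinearMap.add_apply, hx, hy]

theorem diag_rTensor {X : Type*} [AddCommGroup X] [Module k X]
    {σ : H →ₗ[k] Module.End k X} (g : M →ₗ[k] N)
    (hg : ∀ h x, g (π h x) = π' h (g x)) (h : H) (z : M ⊗[k] X) :
    g.rTensor X (diag π σ h z) = diag π' σ h (g.rTensor X z) := by
  simp only [diag, LinearMap.comp_apply]
  generalize comul (R := k) h = t
  induction t with
  | zero => simp
  | tmul a b =>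
    induction z with
    | zero => simp
    | tmul m x => simp [hg]
    | add x y hx hy => simp only [map_add, hx, hy]
  | add x y hx hy => simp only [map_add, LinearMap.add_apply, hx, hy]

theorem diag_assoc {X Y : Type*} [AddCommGroup X] [Module k X] [AddCommGroup Y] [Module k Y]
    (π : H →ₗ[k] Module.End k M)
    (σ : H →ₗ[k] Module.End k X) (τ : H →ₗ[k] Module.End k Y) (h : H) (z : M ⊗[k] (X ⊗[k] Y)) :
    (TensorProduct.assoc k M X Y).symm (diag π (diag σ τ) h z) =
      diag (diag π σ) τ h ((TensorProduct.assoc k M X Y).symm z) := by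
  have e1 : diag π (diag σ τ) h =
      TensorProduct.map₂ π (TensorProduct.map₂ σ τ) (comul.lTensor H (comul h)) := by
    simp only [diag, LinearMap.comp_apply]
    generalize comul (R := k) h = t
    induction t with
    | zero => simp
    | tmul a b => ext; simp
    | add x y hx hy => simp only [map_add, hx, hy]
  have e2 : diag (diag π σ) τ h =
      TensorProduct.map₂ (TensorProduct.map₂ π σ) τ (comul.rTensor H (comul h)) := by
    simp only [diag, LinearMap.comp_apply]
    generalize comul (R := k) h = t
    induction t with
    | zero => simp
    | tmul a b => ext; simp
    | add x y hx hy => simp only [map_add, hx, hy]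
  rw [e1, e2, ← Coalgebra.coassoc_apply]
  generalize comul.rTensor H (comul (R := k) h) = t
  induction t with
  | zero => simp
  | tmul t c =>
    induction t with
    | zero => simp
    | tmul a b =>
      induction z with
      | zero => simp
      | tmul m z =>
        induction z with
        | zero => simp
        | tmul x y => simp
        | add x y hx hy => simp only [tmul_add, map_add, hx, hy]
      | add x y hx hy => simp only [map_add, hx, hy]
    | add x y hx hy => simp only [add_tmul, map_add, LinearMap.add_apply, hx, hy]
  | add x y hx hy => simp only [map_add, LinearMap.add_apply, hx, hy]

theorem diag_mul_mul (h : H) (z : H ⊗[k] H) :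
    diag (LinearMap.mul k H) (LinearMap.mul k H) h z = comul h * z := by
  simp only [diag, LinearMap.comp_apply]
  generalize comul (R := k) h = t
  induction t with
  | zero => simp
  | tmul a b =>
    induction z with
    | zero => simp
    | tmul m x => simp
    | add x y hx hy => simp only [map_add, mul_add, hx, hy]
  | add x y hx hy => simp only [map_add, LinearMap.add_apply, add_mul, hx, hy]

theorem hat_diag (f : Brace π π') (h : H) (z : M ⊗[k] H) :
    hat (Brace.incl π π' f) (diag π (LinearMap.mul k H) h z) =
      diag π' (LinearMap.mul k H) h (hat (Brace.incl π π' f) z) := by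
  simp only [hat, LinearMap.comp_apply, LinearMap.lcomp_apply, LinearEquiv.coe_coe,
    LinearMap.coe_rTensorHom]
  rw [diag_lTensor (τ := diag (LinearMap.mul k H) (LinearMap.mul k H)) comul
    (fun h x => by rw [LinearMap.mul_apply', Bialgebra.comul_mul, diag_mul_mul]), diag_assoc, diag_rTensor _ f.equivariant]

theorem hat_hat (f : M ⊗[k] H →ₗ[k] N) (g : N ⊗[k] H →ₗ[k] P) :
    hat (g ∘ₗ hat f) = hat g ∘ₗ hat f := by
  ext m x
  simp only [AlgebraTensorModule.curry_apply, curry_apply, LinearMap.coe_restrictScalars,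
    LinearMap.comp_apply, hat_tmul]
  let K : H ⊗[k] (H ⊗[k] H) →ₗ[k] P ⊗[k] H :=
    g.rTensor H ∘ₗ (TensorProduct.assoc k N H H).symm.toLinearMap ∘ₗ
      (f ∘ₗ TensorProduct.mk k M H m).rTensor (H ⊗[k] H)
  have e1 : TensorProduct.map ((g ∘ₗ hat f) ∘ₗ TensorProduct.mk k M H m) LinearMap.id
      (comul (R := k) x) = K (TensorProduct.assoc k H H H (comul.rTensor H (comul x))) := by
    generalize comul (R := k) x = t
    induction t with
    | zero => simp
    | tmul a b =>
      simp only [map_tmul, LinearMap.comp_apply, mk_apply, hat_tmul, LinearMap.rTensor_tmul,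
        LinearMap.id_apply]
      generalize comul (R := k) a = t
      induction t with
      | zero => simp
      | tmul c d => simp [K]
      | add x y hx hy => simp only [map_add, add_tmul, hx, hy]
    | add x y hx hy => simp only [map_add, hx, hy]
  rw [e1, Coalgebra.coassoc_apply]
  generalize comul (R := k) x = t
  induction t with
  | zero => simp
  | tmul a b =>
    simp only [map_tmul, LinearMap.comp_apply, mk_apply, hat_tmul, LinearMap.lTensor_tmul,
      LinearMap.id_apply]
    generalize comul (R := k) b = t
    induction t with
    | zero => simp
    | tmul c d => simp [K]
    | add x y hx hy => simp only [map_add, tmul_add, hx, hy]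
  | add x y hx hy => simp only [map_add, hx, hy]

/-- The composition `(φ ∘ χ)(m ⊗ h) = χ(φ(m ⊗ h₍₁₎) ⊗ h₍₂₎)`, from `{M, N} × {N, P}` to
`{M, P}`. -/
noncomputable def Brace.comp (φ : Brace π π') (χ : Brace π' π'') : Brace π π'' :=
  ⟨Brace.incl π' π'' χ ∘ₗ hat (Brace.incl π π' φ), fun h z => by
    rw [LinearMap.comp_apply, hat_diag, Brace.equivariant, LinearMap.comp_apply]⟩

theorem Brace.incl_comp (φ : Brace π π') (χ : Brace π' π'') :
    Brace.incl π π'' (φ.comp χ) = Brace.incl π' π'' χ ∘ₗ hat (Brace.incl π π' φ) := rfl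

variable (π) in
/-- The unit `m ⊗ h ↦ ε(h) m` of `{M, M}`. -/
noncomputable def Brace.id : Brace π π :=
  ⟨(TensorProduct.rid k M).toLinearMap ∘ₗ counit.lTensor M, fun h z => by
    induction z with
    | zero => simp
    | tmul m x =>
      have e : (h : H) = TensorProduct.rid k H (counit.lTensor H (comul h)) := by simp
      conv_rhs => rw [e]
      simp only [diag, LinearMap.comp_apply]
      generalize comul (R := k) h = t
      induction t with
      | zero => simp
      | tmul a b => simp [mul_smul, smul_comm (counit (R := k) b)]
      | add x y hx hy => simp only [map_add, LinearMap.add_apply, hx, hy]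
    | add x y hx hy => simp only [map_add, hx, hy]⟩

theorem Brace.incl_id : Brace.incl π π (Brace.id π) =
    (TensorProduct.rid k M).toLinearMap ∘ₗ counit.lTensor M := rfl

theorem hat_id : hat ((TensorProduct.rid k M).toLinearMap ∘ₗ counit.lTensor M) =
    (LinearMap.id : M ⊗[k] H →ₗ[k] M ⊗[k] H) := by
  ext m x
  simp only [AlgebraTensorModule.curry_apply, curry_apply, LinearMap.coe_restrictScalars,
    hat_tmul, LinearMap.id_apply]
  have e : x = TensorProduct.lid k H (counit.rTensor H (comul x)) := by simp
  conv_rhs => rw [e]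
  generalize comul (R := k) x = t
  induction t with
  | zero => simp
  | tmul a b => simp [smul_tmul]
  | add x y hx hy => simp only [map_add, tmul_add, hx, hy]

theorem id_hat (f : M ⊗[k] H →ₗ[k] N) :
    ((TensorProduct.rid k N).toLinearMap ∘ₗ counit.lTensor N) ∘ₗ hat f = f := by
  ext m x
  simp only [AlgebraTensorModule.curry_apply, curry_apply, LinearMap.coe_restrictScalars,
    hat_tmul, LinearMap.comp_apply]
  have e : x = TensorProduct.rid k H (counit.lTensor H (comul x)) := by simp
  conv_rhs => rw [e]
  generalize comul (R := k) x = t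
  induction t with
  | zero => simp
  | tmul a b => simp
  | add x y hx hy => simp only [map_add, tmul_add, hx, hy]

noncomputable instance : Ring (Brace π π) :=
  { (inferInstance : AddCommGroup (Brace π π)) with
    mul := Brace.comp
    one := Brace.id π
    mul_assoc := fun a b c => Brace.ext <| by
      change Brace.incl π π ((a.comp b).comp c) = Brace.incl π π (a.comp (b.comp c))
      simp only [Brace.incl_comp, hat_hat, LinearMap.comp_assoc]
    one_mul := fun a => Brace.ext <| by
      change Brace.incl π π ((Brace.id π).comp a) = _
      rw [Brace.incl_comp, Brace.incl_id, hat_id, LinearMap.comp_id]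
    mul_one := fun a => Brace.ext <| by
      change Brace.incl π π (a.comp (Brace.id π)) = _
      rw [Brace.incl_comp, Brace.incl_id, id_hat]
    left_distrib := fun a b c => Brace.ext <| by
      change Brace.incl π π (a.comp (b + c)) = Brace.incl π π (a.comp b + a.comp c)
      simp only [Brace.incl_comp, map_add, LinearMap.add_comp]
    right_distrib := fun a b c => Brace.ext <| by
      change Brace.incl π π ((a + b).comp c) = Brace.incl π π (a.comp c + b.comp c)
      simp only [Brace.incl_comp, map_add, LinearMap.comp_add]
    zero_mul := fun a => Brace.ext <| by
      change Brace.incl π π ((0 : Brace π π).comp a) = Brace.incl π π 0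
      simp only [Brace.incl_comp, map_zero, LinearMap.comp_zero]
    mul_zero := fun a => Brace.ext <| by
      change Brace.incl π π (a.comp (0 : Brace π π)) = Brace.incl π π 0
      simp only [Brace.incl_comp, map_zero, LinearMap.zero_comp] }

theorem Brace.mul_def (a b : Brace π π) : a * b = a.comp b := rfl

theorem Brace.one_def : (1 : Brace π π) = Brace.id π := rfl

noncomputable instance : Algebra k (Brace π π) :=
  Algebra.ofModule
    (fun r a b => Brace.ext <| by
      simp only [Brace.mul_def, Brace.incl_comp, map_smul, LinearMap.comp_smul])
    (fun r a b => Brace.ext <| by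
      simp only [Brace.mul_def, Brace.incl_comp, map_smul, LinearMap.smul_comp])

variable (π π') in
/-- The action `(h ⇀ f)(m ⊗ x) = f(m ⊗ x h)` of `H` on `{M, N}`. -/
noncomputable def Brace.act : H →ₐ[k] Module.End k (Brace π π') :=
  AlgHom.ofLinearMap
    { toFun := fun h =>
        { toFun := fun f => ⟨Brace.incl π π' f ∘ₗ (LinearMap.mulRight k h).lTensor M,
            fun l z => by
              rw [LinearMap.comp_apply, LinearMap.comp_apply,
                diag_lTensor (τ := LinearMap.mul k H) _ (fun a b => by simp [mul_assoc]),
                f.equivariant]⟩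
          map_add' := fun _ _ => rfl
          map_smul' := fun _ _ => rfl }
      map_add' := fun h h' => LinearMap.ext fun f => Brace.ext <| TensorProduct.ext' fun m x => by
        change Brace.incl π π' f (m ⊗ₜ (x * (h + h'))) =
          Brace.incl π π' f (m ⊗ₜ (x * h)) + Brace.incl π π' f (m ⊗ₜ (x * h'))
        rw [mul_add, tmul_add, map_add]
      map_smul' := fun r h => LinearMap.ext fun f => Brace.ext <| TensorProduct.ext' fun m x => by
        change Brace.incl π π' f (m ⊗ₜ (x * (r • h))) = r • Brace.incl π π' f (m ⊗ₜ (x * h))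
        rw [mul_smul_comm, tmul_smul, map_smul] }
    (LinearMap.ext fun f => Brace.ext <| TensorProduct.ext' fun m x => by
      change Brace.incl π π' f (m ⊗ₜ (x * 1)) = Brace.incl π π' f (m ⊗ₜ x)
      rw [mul_one])
    (fun h h' => LinearMap.ext fun f => Brace.ext <| TensorProduct.ext' fun m x => by
      change Brace.incl π π' f (m ⊗ₜ (x * (h * h'))) = Brace.incl π π' f (m ⊗ₜ (x * h * h'))
      rw [mul_assoc])

@[simp]
theorem Brace.incl_act_tmul (h : H) (f : Brace π π') (m : M) (x : H) :
    Brace.incl π π' (Brace.act π π' h f) (m ⊗ₜ x) = Brace.incl π π' f (m ⊗ₜ (x * h)) := rfl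

end Brace

section Smash

/-- `B` is a left `H`-module algebra with respect to the action `act`: the unit and the
multiplication of `B` are `H`-linear. -/
structure IsModuleAlgebra (act : H →ₐ[k] Module.End k B) : Prop where
  act_one : ∀ h, act h 1 = algebraMap k B (counit h)
  act_mul : ∀ h a b, act h (a * b) =
    LinearMap.mul' k B (diag act.toLinearMap act.toLinearMap h (a ⊗ₜ b))

/-- `{M, M}` is an `H`-module algebra. -/
theorem Brace.isModuleAlgebra {M : Type*} [AddCommGroup M] [Module k M]
    (π : H →ₗ[k] Module.End k M) : IsModuleAlgebra (Brace.act π π) where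
  act_one h := Brace.ext <| TensorProduct.ext' fun m x => by
    rw [Brace.incl_act_tmul, Algebra.algebraMap_eq_smul_one, map_smul, Brace.one_def,
      Brace.incl_id]
    simp [smul_smul, mul_comm]
  act_mul h a b := Brace.ext <| TensorProduct.ext' fun m x => by
    rw [Brace.incl_act_tmul, Brace.mul_def, Brace.incl_comp, LinearMap.comp_apply, hat_tmul,
      Bialgebra.comul_mul]
    simp only [diag, LinearMap.comp_apply]
    generalize comul (R := k) h = t
    induction t with
    | zero => simp
    | tmul p q =>
      rw [map₂_apply_tmul, map_tmul, LinearMap.mul'_apply, Brace.mul_def, Brace.incl_comp,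
        LinearMap.comp_apply, hat_tmul]
      generalize comul (R := k) x = t
      induction t with
      | zero => simp
      | tmul c d =>
        simp only [Algebra.TensorProduct.tmul_mul_tmul, map_tmul, LinearMap.comp_apply, mk_apply,
          LinearMap.id_apply, AlgHom.toLinearMap_apply, Brace.incl_act_tmul]
      | add x y hx hy => simp only [map_add, add_mul, hx, hy]
    | add x y hx hy => simp only [map_add, LinearMap.add_apply, mul_add, hx, hy]

/-- The linear map `(a ⊗ h) ↦ (b ⊗ l ↦ a (h₍₁₎ • b) ⊗ h₍₂₎ l)`. -/
noncomputable def smashMul (act : H →ₐ[k] Module.End k B) :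
    B ⊗[k] H →ₗ[k] Module.End k (B ⊗[k] H) :=
  LinearMap.mul' k (Module.End k (B ⊗[k] H)) ∘ₗ
    TensorProduct.map (LinearMap.rTensorHom H ∘ₗ LinearMap.mul k B)
      (diag act.toLinearMap (LinearMap.mul k H))

theorem smashMul_tmul (act : H →ₐ[k] Module.End k B) (a : B) (h : H) (z : B ⊗[k] H) :
    smashMul act (a ⊗ₜ h) z =
      (LinearMap.mul k B a).rTensor H (diag act.toLinearMap (LinearMap.mul k H) h z) := rfl

theorem diag_mul_apply (act : H →ₐ[k] Module.End k B) (h l : H) (z : B ⊗[k] H) :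
    diag act.toLinearMap (LinearMap.mul k H) (h * l) z =
      diag act.toLinearMap (LinearMap.mul k H) h
        (diag act.toLinearMap (LinearMap.mul k H) l z) := by
  simp only [diag, LinearMap.comp_apply, Bialgebra.comul_mul]
  generalize comul (R := k) h = s
  generalize comul (R := k) l = t
  induction s with
  | zero => simp
  | tmul a b =>
    induction t with
    | zero => simp
    | tmul c d =>
      induction z with
      | zero => simp
      | tmul m x => simp [mul_assoc]
      | add x y hx hy => simp only [map_add, hx, hy]
    | add x y hx hy => simp only [map_add, mul_add, LinearMap.add_apply, hx, hy]
  | add x y hx hy => simp only [map_add, add_mul, LinearMap.add_apply, hx, hy]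

theorem diag_rTensor_mul {act : H →ₐ[k] Module.End k B} (hact : IsModuleAlgebra act)
    (h : H) (b : B) (z : B ⊗[k] H) :
    diag act.toLinearMap (LinearMap.mul k H) h ((LinearMap.mul k B b).rTensor H z) =
      smashMul act ((act.toLinearMap.flip b).rTensor H (comul h)) z := by
  induction z with
  | zero => simp
  | add x y hx hy => simp only [map_add, hx, hy]
  | tmul c x =>
    let K : H ⊗[k] (H ⊗[k] H) →ₗ[k] B ⊗[k] H :=
      (LinearMap.mul' k B).rTensor H ∘ₗ (TensorProduct.assoc k B B H).symm.toLinearMap ∘ₗ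
        TensorProduct.map (act.toLinearMap.flip b)
          (TensorProduct.map (act.toLinearMap.flip c) (LinearMap.mulRight k x))
    have e1 : diag act.toLinearMap (LinearMap.mul k H) h
        ((LinearMap.mul k B b).rTensor H (c ⊗ₜ x)) =
        K (TensorProduct.assoc k H H H (comul.rTensor H (comul h))) := by
      simp only [diag, LinearMap.comp_apply, LinearMap.rTensor_tmul, LinearMap.mul_apply']
      generalize comul (R := k) h = t
      induction t with
      | zero => simp
      | tmul p q =>
        simp only [map₂_apply_tmul, map_tmul, AlgHom.toLinearMap_apply, hact.act_mul, diag,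
          LinearMap.comp_apply, LinearMap.rTensor_tmul]
        generalize comul (R := k) p = t
        induction t with
        | zero => simp
        | tmul y z => simp [K]
        | add x y hx hy => simp only [map_add, add_tmul, LinearMap.add_apply, hx, hy]
      | add x y hx hy => simp only [map_add, LinearMap.add_apply, hx, hy]
    rw [e1, Coalgebra.coassoc_apply]
    generalize comul (R := k) h = t
    induction t with
    | zero => simp
    | tmul p q =>
      simp only [LinearMap.rTensor_tmul, smashMul_tmul, LinearMap.lTensor_tmul, diag,
        LinearMap.comp_apply]
      generalize comul (R := k) q = t
      induction t with
      | zero => simp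
      | tmul y z => simp [K]
      | add x y hx hy => simp only [map_add, tmul_add, LinearMap.add_apply, hx, hy]
    | add x y hx hy => simp only [map_add, LinearMap.add_apply, hx, hy]

theorem smashMul_assoc {act : H →ₐ[k] Module.End k B} (hact : IsModuleAlgebra act)
    (x y z : B ⊗[k] H) :
    smashMul act (smashMul act x y) z = smashMul act x (smashMul act y z) := by
  induction x with
  | zero => simp
  | add x y hx hy => simp only [map_add, LinearMap.add_apply, hx, hy]
  | tmul a h =>
    induction y with
    | zero => simp
    | add x y hx hy => simp only [map_add, LinearMap.add_apply, hx, hy]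
    | tmul b l =>
      rw [smashMul_tmul act a h (smashMul act (b ⊗ₜ l) z), smashMul_tmul act b l z,
        diag_rTensor_mul hact, smashMul_tmul]
      simp only [diag, LinearMap.comp_apply]
      generalize comul (R := k) h = t
      induction t with
      | zero => simp
      | add x y hx hy => simp only [map_add, LinearMap.add_apply, hx, hy]
      | tmul p q =>
        simp only [map₂_apply_tmul, map_tmul, LinearMap.rTensor_tmul, LinearMap.mul_apply',
          smashMul_tmul, diag_mul_apply, AlgHom.toLinearMap_apply, LinearMap.flip_apply]
        have e : LinearMap.mul k B (a * act p b) =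
            LinearMap.mul k B a ∘ₗ LinearMap.mul k B (act p b) := by
          ext; simp [mul_assoc]
        rw [e, LinearMap.rTensor_comp_apply]
        rfl

theorem one_smashMul (act : H →ₐ[k] Module.End k B) (z : B ⊗[k] H) :
    smashMul act (1 ⊗ₜ 1) z = z := by
  rw [smashMul_tmul]
  simp only [diag, LinearMap.comp_apply, Bialgebra.comul_one, Algebra.TensorProduct.one_def]
  induction z with
  | zero => simp
  | add x y hx hy => simp only [map_add, hx, hy]
  | tmul b h => simp

theorem smashMul_one {act : H →ₐ[k] Module.End k B} (hact : IsModuleAlgebra act)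
    (z : B ⊗[k] H) : smashMul act z (1 ⊗ₜ 1) = z := by
  induction z with
  | zero => simp
  | add x y hx hy => simp only [map_add, LinearMap.add_apply, hx, hy]
  | tmul b h =>
    rw [smashMul_tmul]
    have e : h = TensorProduct.lid k H (counit.rTensor H (comul h)) := by simp
    conv_rhs => rw [e]
    simp only [diag, LinearMap.comp_apply]
    generalize comul (R := k) h = t
    induction t with
    | zero => simp
    | tmul x y => simp [hact.act_one, smul_tmul, Algebra.algebraMap_eq_smul_one]
    | add x y hx hy => simp only [map_add, tmul_add, LinearMap.add_apply, hx, hy]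

/-- The smash product `B # H` of a Hopf algebra with a module algebra: the space `B ⊗ H` with
the multiplication `(a # h)(b # l) = a (h₍₁₎ • b) # h₍₂₎ l`. -/
def Smash {act : H →ₐ[k] Module.End k B} (_ : IsModuleAlgebra act) : Type _ := B ⊗[k] H

variable {act : H →ₐ[k] Module.End k B} (hact : IsModuleAlgebra act)

noncomputable instance : AddCommGroup (Smash hact) := inferInstanceAs (AddCommGroup (B ⊗[k] H))

noncomputable instance : Module k (Smash hact) := inferInstanceAs (Module k (B ⊗[k] H))

/-- The identification of the vector space `B ⊗ H` with `B # H`. -/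
noncomputable def toSmash : B ⊗[k] H ≃ₗ[k] Smash hact := LinearEquiv.refl k (B ⊗[k] H)

noncomputable instance : Ring (Smash hact) :=
  { (inferInstance : AddCommGroup (Smash hact)) with
    mul := fun x y => toSmash hact (smashMul act ((toSmash hact).symm x) ((toSmash hact).symm y))
    one := toSmash hact (1 ⊗ₜ 1)
    mul_assoc := smashMul_assoc hact
    one_mul := one_smashMul act
    mul_one := smashMul_one hact
    left_distrib := fun a b c => map_add (smashMul act a) b c
    right_distrib := fun a b c => LinearMap.map_add₂ (smashMul act) a b c
    zero_mul := fun a => LinearMap.map_zero₂ (smashMul act) a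
    mul_zero := fun a => map_zero (smashMul act a) }

noncomputable instance : Algebra k (Smash hact) :=
  Algebra.ofModule (fun r x y => LinearMap.map_smul₂ (smashMul act) r x y)
    (fun r x y => map_smul (smashMul act x) r y)

end Smash

section YetterDrinfeld

/-- The inverse of a bijective antipode. -/
noncomputable def sInv (hS : Function.Bijective (antipode k : H →ₗ[k] H)) : H →ₗ[k] H :=
  (LinearEquiv.ofBijective (antipode k : H →ₗ[k] H) hS).symm.toLinearMap

/-- `ρ` is a right `H`-coaction on `V`. -/
structure IsComodule {V : Type*} [AddCommGroup V] [Module k V] (ρ : V →ₗ[k] V ⊗[k] H) : Prop where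
  coassoc : ∀ v, TensorProduct.assoc k V H H (ρ.rTensor H (ρ v)) = comul.lTensor V (ρ v)
  counit : ∀ v, TensorProduct.rid k V (counit.lTensor V (ρ v)) = v

/-- Left-right Yetter–Drinfeld modules: left `H`-modules and right `H`-comodules with
`(l • v)⁽⁰⁾ ⊗ (l • v)⁽¹⁾ = l₍₂₎ • v⁽⁰⁾ ⊗ l₍₃₎ v⁽¹⁾ S⁻¹(l₍₁₎)`. -/
structure IsYetterDrinfeld (hS : Function.Bijective (antipode k : H →ₗ[k] H))
    {V : Type*} [AddCommGroup V] [Module k V]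
    (act : H →ₐ[k] Module.End k V) (ρ : V →ₗ[k] V ⊗[k] H) : Prop extends IsComodule ρ where
  compat : ∀ l v, ρ (act l v) = ∑ i ∈ (ℛ k l).index,
    (LinearMap.mulRight k (sInv hS ((ℛ k l).left i))).lTensor V
      (diag act.toLinearMap (LinearMap.mul k H) ((ℛ k l).right i) (ρ v))

/-- Algebras in the category of left-right Yetter–Drinfeld modules: Yetter–Drinfeld modules that
are `H`-module algebras and `H^op`-comodule algebras. -/
structure IsYetterDrinfeldAlgebra (hS : Function.Bijective (antipode k : H →ₗ[k] H))
    (act : H →ₐ[k] Module.End k B) (ρ : B →ₗ[k] B ⊗[k] H) : Prop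
    extends IsYetterDrinfeld hS act ρ, IsModuleAlgebra act where
  coact_one : ρ 1 = 1 ⊗ₜ 1
  /-- `ρ(ab) = a⁽⁰⁾b⁽⁰⁾ ⊗ b⁽¹⁾a⁽¹⁾` -/
  coact_mul : ∀ a b, ρ (a * b) =
    TensorProduct.map₂ (LinearMap.mul k B) (LinearMap.mul k H).flip (ρ a) (ρ b)

/-- Braided commutativity: `a⁽⁰⁾ (a⁽¹⁾ • b) = b a`. -/
def IsBraidedCommutative (act : H →ₐ[k] Module.End k B) (ρ : B →ₗ[k] B ⊗[k] H) : Prop :=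
  ∀ a b, LinearMap.mul' k B ((act.toLinearMap.flip b).lTensor B (ρ a)) = b * a

end YetterDrinfeld

end PartialModules

section HopfAlgebroids

variable {k : Type u} [Field k] {A R : Type*} [Ring A] [Algebra k A] [Ring R] [Algebra k R]

open MulOpposite

/-- The kernel of `R ⊗_k R → R ⊗_A R`, where `R` is an `A`-bimodule by
`a · r · b = s(a) t(b) r`. -/
def balRel (s : A →ₐ[k] R) (t : Aᵐᵒᵖ →ₐ[k] R) : Submodule k (R ⊗[k] R) :=
  Submodule.span k {z | ∃ a x y, z = (t (op a) * x) ⊗ₜ[k] y - x ⊗ₜ[k] (s a * y)}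

/-- The kernel of `R ⊗_k R ⊗_k R → R ⊗_A R ⊗_A R`. -/
def balRel₃ (s : A →ₐ[k] R) (t : Aᵐᵒᵖ →ₐ[k] R) : Submodule k (R ⊗[k] (R ⊗[k] R)) :=
  Submodule.span k
    ({z | ∃ a x y w, z = (t (op a) * x) ⊗ₜ[k] (y ⊗ₜ[k] w) - x ⊗ₜ[k] ((s a * y) ⊗ₜ[k] w)} ∪
     {z | ∃ a x y w, z = x ⊗ₜ[k] ((t (op a) * y) ⊗ₜ[k] w) - x ⊗ₜ[k] (y ⊗ₜ[k] (s a * w))})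

/-- The tensor product `R ⊗_A R`. -/
abbrev BalTensor (s : A →ₐ[k] R) (t : Aᵐᵒᵖ →ₐ[k] R) : Type _ := (R ⊗[k] R) ⧸ balRel s t

/-- The projection `R ⊗_k R → R ⊗_A R`. -/
def balMk (s : A →ₐ[k] R) (t : Aᵐᵒᵖ →ₐ[k] R) : R ⊗[k] R →ₗ[k] BalTensor s t :=
  (balRel s t).mkQ

/-- The projection `R ⊗_k R ⊗_k R → R ⊗_A R ⊗_A R`. -/
def balMk₃ (s : A →ₐ[k] R) (t : Aᵐᵒᵖ →ₐ[k] R) :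
    R ⊗[k] (R ⊗[k] R) →ₗ[k] (R ⊗[k] (R ⊗[k] R)) ⧸ balRel₃ s t :=
  (balRel₃ s t).mkQ

variable (k A R)

/-- Left bialgebroids with total algebra `R` over the (noncommutative) base algebra `A`.
Formulas in `R ⊗_A R` and `R ⊗_A R ⊗_A R` are evaluated on representatives in `R ⊗_k R` and
`R ⊗_k R ⊗_k R`; the maps `Δ ⊗_A id` and `id ⊗_A Δ` are evaluated by means of a `k`-linear lift
`D : R → R ⊗_k R` of `Δ`, which exists since `k` is a field. None of this depends on choices. -/
structure LeftBialgebroid where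
  /-- the source map -/
  s : A →ₐ[k] R
  /-- the target map -/
  t : Aᵐᵒᵖ →ₐ[k] R
  s_mul_t : ∀ a b, s a * t b = t b * s a
  /-- the comultiplication `Δ` -/
  Δ : R →ₗ[k] BalTensor s t
  /-- the counit -/
  ε : R →ₗ[k] A
  comul_bimodule : ∀ a b r x, balMk s t x = Δ r →
    Δ (s a * t (op b) * r) = balMk s t ((s a ⊗ₜ[k] t (op b)) * x)
  counit_bimodule : ∀ a b r, ε (s a * t (op b) * r) = a * ε r * b
  coassoc : ∀ D : R →ₗ[k] R ⊗[k] R, (∀ r, balMk s t (D r) = Δ r) →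
    ∀ r, balMk₃ s t (TensorProduct.assoc k R R R (D.rTensor R (D r))) =
      balMk₃ s t (D.lTensor R (D r))
  /-- `s(ε(r₍₁₎)) r₍₂₎ = r` -/
  counit_left : ∀ r x, balMk s t x = Δ r →
    LinearMap.mul' k R ((s.toLinearMap ∘ₗ ε).rTensor R x) = r
  /-- `t(ε(r₍₂₎)) r₍₁₎ = r` -/
  counit_right : ∀ r x, balMk s t x = Δ r →
    LinearMap.mul' k R
      ((t.toLinearMap ∘ₗ (opLinearEquiv k).toLinearMap ∘ₗ ε).rTensor R
        (TensorProduct.comm k R R x)) = r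
  /-- the image of `Δ` is in the Takeuchi product: `r₍₁₎ t(a) ⊗ r₍₂₎ = r₍₁₎ ⊗ r₍₂₎ s(a)` -/
  comul_takeuchi : ∀ a r x, balMk s t x = Δ r →
    balMk s t (x * (t (op a) ⊗ₜ[k] 1)) = balMk s t (x * (1 ⊗ₜ[k] s a))
  comul_one : Δ 1 = balMk s t (1 ⊗ₜ[k] 1)
  comul_mul : ∀ r r' x x', balMk s t x = Δ r → balMk s t x' = Δ r' →
    Δ (r * r') = balMk s t (x * x')
  counit_one : ε 1 = 1
  counit_mul_s : ∀ r r', ε (r * s (ε r')) = ε (r * r')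
  counit_mul_t : ∀ r r', ε (r * t (op (ε r'))) = ε (r * r')

/-- Hopf algebroids (with bijective antipode) in the sense of Böhm and Szlachányi: left
bialgebroids with an anti-automorphism `S` of the total algebra such that `S(t(a)) = s(a)`,
`S(r₍₁₎)₍₁₎ r₍₂₎ ⊗ S(r₍₁₎)₍₂₎ = 1 ⊗ S(r)` and
`S⁻¹(r₍₂₎)₍₁₎ ⊗ S⁻¹(r₍₂₎)₍₂₎ r₍₁₎ = S⁻¹(r) ⊗ 1` in `R ⊗_A R`. -/
structure HopfAlgebroid extends LeftBialgebroid k A R where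
  /-- the antipode -/
  S : R ≃ₗ[k] R
  antipode_mul : ∀ r r', S (r * r') = S r' * S r
  antipode_t : ∀ a, S (t (op a)) = s a
  antipode_left : ∀ D : R →ₗ[k] R ⊗[k] R, (∀ r, balMk s t (D r) = Δ r) →
    ∀ r x, balMk s t x = Δ r →
      balMk s t (LinearMap.mul' k (R ⊗[k] R)
        (TensorProduct.map (D ∘ₗ S.toLinearMap)
          (Algebra.TensorProduct.includeLeft (R := k) (S := k) (A := R) (B := R)).toLinearMap x)) =
      balMk s t (1 ⊗ₜ[k] S r)
  antipode_right : ∀ D : R →ₗ[k] R ⊗[k] R, (∀ r, balMk s t (D r) = Δ r) →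
    ∀ r x, balMk s t x = Δ r →
      balMk s t (LinearMap.mul' k (R ⊗[k] R)
        (TensorProduct.map (D ∘ₗ S.symm.toLinearMap)
          (Algebra.TensorProduct.includeRight (R := k) (A := R) (B := R)).toLinearMap
          (TensorProduct.comm k R R x))) =
      balMk s t (S.symm r ⊗ₜ[k] 1)

variable {k A R}

/-- The antipode of a Hopf algebroid is moreover an antipode in the sense of Lu:
`S(t(a)) = s(a)`, `S(r₍₁₎) r₍₂₎ = t(ε(S(r)))`, and for some section `γ` of the projection
`R ⊗_k R → R ⊗_A R` the composite `m ∘ (id ⊗ S) ∘ γ ∘ Δ` equals `s ∘ ε`. -/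
structure HopfAlgebroid.IsLu (𝓗 : HopfAlgebroid k A R) : Prop where
  antipode_t : ∀ a, 𝓗.S (𝓗.t (op a)) = 𝓗.s a
  mul_antipode_left : ∀ r x, balMk 𝓗.s 𝓗.t x = 𝓗.Δ r →
    LinearMap.mul' k R (𝓗.S.toLinearMap.rTensor R x) = 𝓗.t (op (𝓗.ε (𝓗.S r)))
  exists_section : ∃ γ : BalTensor 𝓗.s 𝓗.t →ₗ[k] R ⊗[k] R,
    (∀ z, balMk 𝓗.s 𝓗.t (γ z) = z) ∧
    ∀ r, LinearMap.mul' k R (𝓗.S.toLinearMap.lTensor R (γ (𝓗.Δ r))) = 𝓗.s (𝓗.ε r)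

end HopfAlgebroids

section Hglob

variable (k : Type u) (H : Type v) [Field k] [Ring H] [HopfAlgebra k H]

/-- The algebra `{A_par, A_par}`. -/
abbrev BraceA : Type (max u v) := Brace (bullet k H) (bullet k H)

/-- The action `(h ⇀ f)(a ⊗ x) = f(a ⊗ x h)` of `H` on `{A_par, A_par}`. -/
noncomputable abbrev actA : H →ₐ[k] Module.End k (BraceA k H) :=
  Brace.act (bullet k H) (bullet k H)

/-- The smash product `H_glob = {A_par, A_par} # H`. -/
abbrev Hglob : Type (max u v) := Smash (Brace.isModuleAlgebra (bullet k H))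

/-- The element `f # h` of `H_glob`, as a linear function of `f ⊗ h`. -/
noncomputable abbrev toHglob : BraceA k H ⊗[k] H ≃ₗ[k] Hglob k H :=
  toSmash (Brace.isModuleAlgebra (bullet k H))

variable {k H}

/-- The linear map `{A_par, A_par} → A_par`, `f ↦ f(1 ⊗ x)`. -/
noncomputable def evalA (x : H) : BraceA k H →ₗ[k] Apar k H :=
  LinearMap.applyₗ ((1 : Apar k H) ⊗ₜ[k] x) ∘ₗ Brace.incl (bullet k H) (bullet k H)

/-- The coaction `a ↦ a⁽⁰⁾ ⊗ a⁽¹⁾` of `H` on `A_par`, given on products of generators by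
`ε_{h¹} ⋯ ε_{hⁿ} ↦ ε_{h¹₍₂₎} ⋯ ε_{hⁿ₍₂₎} ⊗ hⁿ₍₃₎ S⁻¹(hⁿ₍₁₎) ⋯ h¹₍₃₎ S⁻¹(h¹₍₁₎)`. -/
structure IsAparCoaction (hS : Function.Bijective (antipode k : H →ₗ[k] H))
    (ρA : Apar k H →ₗ[k] Apar k H ⊗[k] H) : Prop where
  map_one : ρA 1 = 1 ⊗ₜ 1
  /-- `ρA(ε_h) = ε_{h₍₂₎} ⊗ h₍₃₎ S⁻¹(h₍₁₎)` -/
  map_eps : ∀ h, ρA (epsA k H h) = ∑ i ∈ (ℛ k h).index,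
    TensorProduct.map (epsA k H) (LinearMap.mulRight k (sInv hS ((ℛ k h).left i)))
      (comul ((ℛ k h).right i))
  /-- `ρA(ab) = a⁽⁰⁾b⁽⁰⁾ ⊗ b⁽¹⁾a⁽¹⁾` -/
  map_mul : ∀ a b, ρA (a * b) =
    TensorProduct.map₂ (LinearMap.mul k (Apar k H)) (LinearMap.mul k H).flip (ρA a) (ρA b)

/-- The coaction `f ↦ f⁽⁰⁾ ⊗ f⁽¹⁾` of `H` on `{A_par, A_par}`, determined by
`f⁽⁰⁾(x) ⊗ f⁽¹⁾ = f(x₍₂₎)⁽⁰⁾ ⊗ S⁻¹(x₍₃₎) f(x₍₂₎)⁽¹⁾ x₍₁₎`, where `f(x) = f(1 ⊗ x)`. -/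
def IsBraceCoaction (hS : Function.Bijective (antipode k : H →ₗ[k] H))
    (ρA : Apar k H →ₗ[k] Apar k H ⊗[k] H) (ρ : BraceA k H →ₗ[k] BraceA k H ⊗[k] H) : Prop :=
  ∀ f x, (evalA x).rTensor H (ρ f) =
    ∑ i ∈ (ℛ k x).index, ∑ j ∈ (ℛ k ((ℛ k x).right i)).index,
      (LinearMap.mulLeft k (sInv hS ((ℛ k ((ℛ k x).right i)).right j)) ∘ₗ
          LinearMap.mulRight k ((ℛ k x).left i)).lTensor (Apar k H)
        (ρA (evalA ((ℛ k ((ℛ k x).right i)).left j) f))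

end Hglob

end PartialHopf

/-! The theorem splits into two independent halves. The second half is general: for a Hopf algebra
with bijective antipode and any braided commutative algebra B in left-right Yetter–Drinfeld modules,
B # H is a Hopf algebroid over B (`smashHopfAlgebroid`, `smashHopfAlgebroid_isLu`). The first half
shows that {A_par, A_par} is such a B (`rhoB_isYetterDrinfeldAlgebra`, `rhoB_isBraidedCommutative`).

First half. The map h ↦ [h₍₂₎] ⊗ S⁻¹(h₍₁₎) is a partial representation in H_par ⊗ Hᵒᵖ
(`twistC_isPartialRep`), so it extends to an algebra map on H_par, which is a coaction. It sends ε_h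
to ε_{h₍₂₎} ⊗ h₍₃₎S⁻¹(h₍₁₎), hence restricts to A_par and gives ρ_A. Next, every f in {A_par, A_par}
is left A_par-linear, because h₍₁₎ • (S(h₍₂₎) • a) = ε_h a (`Brace.incl_mul`). So f is the same
thing as the function φ(x) = f(1 ⊗ x), subject to ε_{h₍₁₎}φ(h₍₂₎x) = [h₍₁₎]φ(x)[S(h₍₂₎)], and the
product of {A_par, A_par} becomes convolution. Put ι(h) = 1 ⊗ h in Hom(H, H_par ⊗ Hᵒᵖ); its
convolution inverse is h ↦ 1 ⊗ S⁻¹(h). The required coaction on functions is φ ↦ ι (ρ∘φ) ι⁻¹. Being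
a conjugation it is multiplicative; the Yetter–Drinfeld condition comes from ι(xl) = ι(l)ι(x); and
applying ρ to the equivariance of φ shows that the result is again equivariant. Finite dimension
lets its coefficients be assembled into an element of {A_par, A_par} ⊗ H. Braided commutativity
rests on [S(h₍₁₎)]φ(h₍₂₎x) = φ(x)[S(h)] (`brS_mul_evH`): by it, a ⊗ u ↦ a f(u) turns right
multiplication by ρ(c) into right multiplication by c.

Second half. Let s and η embed B and H in R = B # H, and let t(b) = s(b⁽⁰⁾)η(b⁽¹⁾). Braided
commutativity makes t commute with s, and the Yetter–Drinfeld condition gives η(h)t(b) =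
t(h₍₂₎•b)η(h₍₁₎). The comultiplication lifts to an algebra map R → R ⊗_k R that is coassociative on
the nose. The kernel of R ⊗_k R → R ⊗_B R is a right ideal, stable under left multiplication by
values of this lift (the Takeuchi condition), so the axioms reduce to s(b) and η(h). The antipode is
τ(η(h)) = η(S(h)), τ(s(b)) = η(S²(b⁽¹⁾))s(b⁽⁰⁾), with inverse s(b) ↦ t(b), η(h) ↦ η(S⁻¹(h)). The
decisive identity is τ(s(b)) = t(S²(b⁽¹⁾)•b⁽⁰⁾) (`smashTLinear_twistB`): it makes τ(s(b)) commute
with s and behave like a target element under Δ.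

Sweedler computations are carried out as algebra in convolution rings: functions of one variable in
Hom(H, R), of two variables in Hom(H ⊗ H, R). -/

set_option linter.unusedSectionVars false

namespace PartialHopf

open TensorProduct Coalgebra HopfAlgebra WithConv

universe u v w

/-! ### Convolution algebras in one and two variables -/

section Convolution

variable {k : Type u} [Field k]

variable (k) in
/-- Linear maps from a coalgebra to an algebra, with the convolution product. -/
abbrev Conv (C R : Type*) [AddCommGroup C] [Module k C] [Ring R] [Algebra k R] :=
  WithConv (C →ₗ[k] R)

variable {C D R R' : Type*} [AddCommGroup C] [Module k C] [Coalgebra k C]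
  [AddCommGroup D] [Module k D] [Coalgebra k D] [Ring R] [Algebra k R] [Ring R'] [Algebra k R']

/-- Both sides are linear in Δ(c), so agreement on pure tensors suffices. This transports a Sweedler
identity from one target algebra to another along maps that need not be multiplicative. -/
theorem Conv.apply_congr {R₁ X : Type*} [Ring R₁] [Algebra k R₁] [AddCommGroup X] [Module k X]
    (Λ : R →ₗ[k] X) (Λ' : R₁ →ₗ[k] X) {F G : Conv k C R} {F' G' : Conv k C R₁}
    (h : ∀ x y, Λ (F x * G y) = Λ' (F' x * G' y)) (c : C) : Λ ((F * G) c) = Λ' ((F' * G') c) := by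
  simp only [LinearMap.convMul_apply]
  generalize comul (R := k) c = t
  induction t with
  | zero => simp
  | tmul x y => simpa using h x y
  | add x y hx hy => simp only [map_add, hx, hy]

/-- The function `c ↦ ε(c) a`. -/
noncomputable def Conv.const : R →+* Conv k C R where
  toFun a := toConv (LinearMap.toSpanSingleton k R a ∘ₗ counit)
  map_one' := by ext; simp [Algebra.algebraMap_eq_smul_one]
  map_zero' := by ext; simp
  map_add' a b := by ext; simp
  map_mul' a b := by
    ext c
    -- Writing c = ε(c₍₁₎)c₍₂₎ makes both sides linear functions of Δ(c), so that Δ(c) can be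
    -- replaced by a pure tensor. The same device recurs below, with the counit on either side.
    have e : c = TensorProduct.lid k C (counit.rTensor C (comul c)) := by simp
    conv_lhs => rw [e]
    simp only [LinearMap.convMul_apply]
    generalize comul (R := k) c = t
    induction t with
    | zero => simp
    | tmul x y => simp [smul_smul, mul_comm]
    | add x y hx hy => simp only [map_add, hx, hy]

theorem Conv.const_apply (a : R) (c : C) :
    (Conv.const a : Conv k C R) c = counit (R := k) c • a := rfl

theorem Conv.const_mul_apply (a : R) (F : Conv k C R) (c : C) :
    (Conv.const a * F : Conv k C R) c = a * F c := by
  have e : c = TensorProduct.lid k C (counit.rTensor C (comul c)) := by simp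
  conv_rhs => rw [e]
  simp only [LinearMap.convMul_apply]
  generalize comul (R := k) c = t
  induction t with
  | zero => simp
  | tmul x y => simp [Conv.const]
  | add x y hx hy => simp only [map_add, mul_add, hx, hy]

theorem Conv.mul_const_apply (a : R) (F : Conv k C R) (c : C) :
    (F * Conv.const a : Conv k C R) c = F c * a := by
  have e : c = TensorProduct.rid k C (counit.lTensor C (comul c)) := by simp
  conv_rhs => rw [e]
  simp only [LinearMap.convMul_apply]
  generalize comul (R := k) c = t
  induction t with
  | zero => simp
  | tmul x y => simp [Conv.const]
  | add x y hx hy => simp only [map_add, add_mul, hx, hy]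

/-- Precomposition with a coalgebra map. -/
noncomputable def Conv.pull (φ : D →ₗc[k] C) : Conv k C R →+* Conv k D R where
  toFun F := toConv (F.ofConv ∘ₗ φ.toLinearMap)
  map_one' := by ext; simp [LinearMap.convOne_def]
  map_zero' := by ext; simp
  map_add' a b := by ext; simp
  map_mul' a b := by
    rw [LinearMap.convMul_comp_coalgHom_distrib]

theorem Conv.pull_apply (φ : D →ₗc[k] C) (F : Conv k C R) (d : D) :
    Conv.pull φ F d = F (φ d) := rfl

/-- Postcomposition with an algebra map. -/
noncomputable def Conv.push (ψ : R →ₐ[k] R') : Conv k C R →+* Conv k C R' where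
  toFun F := toConv (ψ.toLinearMap ∘ₗ F.ofConv)
  map_one' := by ext; simp [LinearMap.convOne_def]
  map_zero' := by ext; simp
  map_add' a b := by ext; simp
  map_mul' a b := by
    rw [LinearMap.algHom_comp_convMul_distrib]

theorem Conv.push_apply (ψ : R →ₐ[k] R') (F : Conv k C R) (c : C) :
    Conv.push ψ F c = ψ (F c) := rfl

theorem Conv.push_const (ψ : R →ₐ[k] R') (a : R) :
    Conv.push ψ (Conv.const a : Conv k C R) = Conv.const (ψ a) := by
  ext; simp [Conv.push_apply, Conv.const_apply]

theorem Conv.pull_const (φ : D →ₗc[k] C) (a : R) :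
    Conv.pull φ (Conv.const a : Conv k C R) = Conv.const a := by
  ext; simp [Conv.pull_apply, Conv.const_apply]

theorem Conv.push_pull (ψ : R →ₐ[k] R') (φ : D →ₗc[k] C) (F : Conv k C R) :
    Conv.push ψ (Conv.pull φ F) = Conv.pull φ (Conv.push ψ F) := rfl

/-- The projection of `C ⊗ D` to the first factor. -/
noncomputable def prFst : C ⊗[k] D →ₗc[k] C where
  toLinearMap := (TensorProduct.rid k C).toLinearMap ∘ₗ counit.lTensor C
  counit_comp := by ext; simp
  map_comp_comul := by
    ext c d
    have e : counit (R := k) d = (counit (R := k)) (TensorProduct.rid k D (counit.lTensor D (comul d))) := by simp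
    simp only [AlgebraTensorModule.curry_apply, curry_apply, LinearMap.coe_restrictScalars,
      LinearMap.comp_apply, comul_tmul, LinearMap.lTensor_tmul, LinearEquiv.coe_coe, rid_tmul,
      map_smul]
    rw [e]
    generalize comul (R := k) d = t
    generalize comul (R := k) c = s
    induction t with
    | zero => simp
    | tmul x y =>
      induction s with
      | zero => simp
      | tmul p q => simp [smul_tmul', tmul_smul, smul_smul]
      | add x y hx hy => simp only [map_add, add_tmul, hx, hy, smul_add]
    | add x y hx hy => simp only [map_add, add_smul, tmul_add, hx, hy]

/-- The projection of `C ⊗ D` to the second factor. -/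
noncomputable def prSnd : C ⊗[k] D →ₗc[k] D where
  toLinearMap := (TensorProduct.lid k D).toLinearMap ∘ₗ counit.rTensor D
  counit_comp := by ext; simp [mul_comm]
  map_comp_comul := by
    ext c d
    have e : counit (R := k) c = (counit (R := k)) (TensorProduct.rid k C (counit.lTensor C (comul c))) := by simp
    simp only [AlgebraTensorModule.curry_apply, curry_apply, LinearMap.coe_restrictScalars,
      LinearMap.comp_apply, comul_tmul, LinearMap.rTensor_tmul, LinearEquiv.coe_coe, lid_tmul,
      map_smul]
    rw [e]
    generalize comul (R := k) d = t
    generalize comul (R := k) c = s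
    induction t with
    | zero => simp
    | tmul x y =>
      induction s with
      | zero => simp
      | tmul p q => simp [smul_tmul', tmul_smul, smul_smul, mul_comm]
      | add x y hx hy => simp only [map_add, add_tmul, hx, hy, add_smul]
    | add x y hx hy => simp only [map_add, tmul_add, hx, hy, smul_add]

/-- The convolution map `c ⊗ d ↦ ε(d) F(c)`. -/
noncomputable abbrev leg₁ (F : Conv k C R) : Conv k (C ⊗[k] D) R := Conv.pull prFst F

/-- The convolution map `c ⊗ d ↦ ε(c) F(d)`. -/
noncomputable abbrev leg₂ (F : Conv k D R) : Conv k (C ⊗[k] D) R := Conv.pull prSnd F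

theorem prFst_tmul (c : C) (d : D) : prFst (c ⊗ₜ[k] d) = counit (R := k) d • c := by
  change TensorProduct.rid k C (counit.lTensor C (c ⊗ₜ[k] d)) = _
  simp

theorem prSnd_tmul (c : C) (d : D) : prSnd (c ⊗ₜ[k] d) = counit (R := k) c • d := by
  change TensorProduct.lid k D (counit.rTensor D (c ⊗ₜ[k] d)) = _
  simp

theorem leg₁_tmul (F : Conv k C R) (c : C) (d : D) :
    leg₁ F (c ⊗ₜ[k] d) = counit (R := k) d • F c := by
  rw [Conv.pull_apply, prFst_tmul, map_smul]

theorem leg₂_tmul (F : Conv k D R) (c : C) (d : D) :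
    leg₂ F (c ⊗ₜ[k] d) = counit (R := k) c • F d := by
  rw [Conv.pull_apply, prSnd_tmul, map_smul]

/-- Fixing the second argument. -/
noncomputable def Conv.at₂ (G : Conv k (C ⊗[k] D) R) (d : D) : Conv k C R :=
  toConv (G.ofConv ∘ₗ (TensorProduct.mk k C D).flip d)

/-- Fixing the first argument. -/
noncomputable def Conv.at₁ (G : Conv k (C ⊗[k] D) R) (c : C) : Conv k D R :=
  toConv (G.ofConv ∘ₗ TensorProduct.mk k C D c)

theorem Conv.at₂_apply (G : Conv k (C ⊗[k] D) R) (d : D) (c : C) :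
    Conv.at₂ G d c = G (c ⊗ₜ d) := rfl

theorem Conv.at₁_apply (G : Conv k (C ⊗[k] D) R) (c : C) (d : D) :
    Conv.at₁ G c d = G (c ⊗ₜ d) := rfl

/-- A factor depending only on the first variable carries a counit in the second, which absorbs one
leg of Δ(d). This lemma and the next three turn two-variable identities into one-variable ones with
a parameter, and back. -/
theorem leg₁_mul_at₂ (F : Conv k C R) (G : Conv k (C ⊗[k] D) R) (d : D) :
    Conv.at₂ (leg₁ F * G) d = F * Conv.at₂ G d := by
  ext c
  have e : d = TensorProduct.lid k D (counit.rTensor D (comul d)) := by simp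
  rw [Conv.at₂_apply]
  conv_rhs => rw [e]
  simp only [LinearMap.convMul_apply, comul_tmul]
  generalize comul (R := k) d = t
  generalize comul (R := k) c = s
  induction t with
  | zero => simp [Conv.at₂]
  | tmul x y =>
    induction s with
    | zero => simp
    | tmul p q => simp [leg₁_tmul, Conv.at₂_apply]
    | add x y hx hy => simp only [map_add, add_tmul, hx, hy]
  | add x y hx hy =>
    simp only [map_add, tmul_add, hx, hy]
    simp [Conv.at₂, LinearMap.comp_add, map_add_right]

theorem mul_leg₁_at₂ (F : Conv k C R) (G : Conv k (C ⊗[k] D) R) (d : D) :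
    Conv.at₂ (G * leg₁ F) d = Conv.at₂ G d * F := by
  ext c
  have e : d = TensorProduct.rid k D (counit.lTensor D (comul d)) := by simp
  rw [Conv.at₂_apply]
  conv_rhs => rw [e]
  simp only [LinearMap.convMul_apply, comul_tmul]
  generalize comul (R := k) d = t
  generalize comul (R := k) c = s
  induction t with
  | zero => simp [Conv.at₂]
  | tmul x y =>
    induction s with
    | zero => simp
    | tmul p q => simp [leg₁_tmul, Conv.at₂_apply]
    | add x y hx hy => simp only [map_add, add_tmul, hx, hy]
  | add x y hx hy =>
    simp only [map_add, tmul_add, hx, hy]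
    simp [Conv.at₂, LinearMap.comp_add, map_add_left]

theorem leg₂_mul_at₁ (F : Conv k D R) (G : Conv k (C ⊗[k] D) R) (c : C) :
    Conv.at₁ (leg₂ F * G) c = F * Conv.at₁ G c := by
  ext d
  have e : c = TensorProduct.lid k C (counit.rTensor C (comul c)) := by simp
  rw [Conv.at₁_apply]
  conv_rhs => rw [e]
  simp only [LinearMap.convMul_apply, comul_tmul]
  generalize comul (R := k) d = t
  generalize comul (R := k) c = s
  induction s with
  | zero => simp [Conv.at₁]
  | tmul x y =>
    induction t with
    | zero => simp
    | tmul p q => simp [leg₂_tmul, Conv.at₁_apply, ← smul_tmul']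
    | add x y hx hy => simp only [map_add, tmul_add, hx, hy]
  | add x y hx hy =>
    simp only [map_add, add_tmul, hx, hy]
    simp [Conv.at₁, LinearMap.comp_add, map_add_right]

theorem mul_leg₂_at₁ (F : Conv k D R) (G : Conv k (C ⊗[k] D) R) (c : C) :
    Conv.at₁ (G * leg₂ F) c = Conv.at₁ G c * F := by
  ext d
  have e : c = TensorProduct.rid k C (counit.lTensor C (comul c)) := by simp
  rw [Conv.at₁_apply]
  conv_rhs => rw [e]
  simp only [LinearMap.convMul_apply, comul_tmul]
  generalize comul (R := k) d = t
  generalize comul (R := k) c = s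
  induction s with
  | zero => simp [Conv.at₁]
  | tmul x y =>
    induction t with
    | zero => simp
    | tmul p q => simp [leg₂_tmul, Conv.at₁_apply, ← smul_tmul']
    | add x y hx hy => simp only [map_add, tmul_add, hx, hy]
  | add x y hx hy =>
    simp only [map_add, add_tmul, hx, hy]
    simp [Conv.at₁, LinearMap.comp_add, map_add_left]

theorem leg₂_at₂ (F : Conv k D R) (d : D) :
    Conv.at₂ (leg₂ F : Conv k (C ⊗[k] D) R) d = Conv.const (F d) := by
  ext c; simp [Conv.at₂_apply, leg₂_tmul, Conv.const_apply]

theorem leg₁_mul_leg₂_apply (F : Conv k C R) (G : Conv k D R) (c : C) (d : D) :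
    (leg₁ F * leg₂ G : Conv k (C ⊗[k] D) R) (c ⊗ₜ d) = F c * G d := by
  rw [← Conv.at₂_apply, leg₁_mul_at₂, leg₂_at₂, Conv.mul_const_apply]

theorem leg₂_mul_leg₁_apply (F : Conv k C R) (G : Conv k D R) (c : C) (d : D) :
    (leg₂ G * leg₁ F : Conv k (C ⊗[k] D) R) (c ⊗ₜ d) = G d * F c := by
  rw [← Conv.at₂_apply, mul_leg₁_at₂, leg₂_at₂, Conv.const_mul_apply]

theorem Conv.ext₂ {F G : Conv k (C ⊗[k] D) R} (h : ∀ c d, F (c ⊗ₜ d) = G (c ⊗ₜ d)) : F = G :=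
  WithConv.ext (TensorProduct.ext' h)

theorem Conv.ext_at₂ {F G : Conv k (C ⊗[k] D) R} (h : ∀ d, Conv.at₂ F d = Conv.at₂ G d) : F = G :=
  Conv.ext₂ fun c d => by rw [← Conv.at₂_apply, h, Conv.at₂_apply]

/-- Functions of different variables involve no common coproduct, so commuting values are enough. -/
theorem leg_commute (F : Conv k C R) (G : Conv k D R) (h : ∀ c d, Commute (F c) (G d)) :
    Commute (leg₁ F) (leg₂ G) :=
  Conv.ext₂ fun c d => by
    rw [leg₁_mul_leg₂_apply, leg₂_mul_leg₁_apply, (h c d).eq]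

end Convolution

/-! ### The antipode, its inverse, and the opposite algebra -/

section HopfConvolution

variable {k : Type u} {H : Type v} [Field k] [Ring H] [HopfAlgebra k H]

open MulOpposite

/-- Both sides are convolution inverses of Δ in Hom(H, H ⊗ H), and a left inverse equals a right
inverse. -/
theorem comul_antipode (h : H) :
    comul (antipode k h) =
      TensorProduct.map (antipode k) (antipode k) (TensorProduct.comm k H H (comul h)) := by
  have e : toConv (TensorProduct.map (antipode k) (antipode k) ∘ₗ
      (TensorProduct.comm k H H).toLinearMap ∘ₗ comul) =
      toConv (comul ∘ₗ (antipode k : H →ₗ[k] H)) := by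
    refine left_inv_eq_right_inv (a := toConv (comul : H →ₗ[k] H ⊗[k] H)) ?_
      LinearMap.comul_right_inv
    -- write everything in terms of the two inclusions of `H` in `H ⊗ H`
    let i₁ : Conv k H (H ⊗[k] H) :=
      Conv.push Algebra.TensorProduct.includeLeft (toConv LinearMap.id)
    let i₂ : Conv k H (H ⊗[k] H) :=
      Conv.push Algebra.TensorProduct.includeRight (toConv LinearMap.id)
    let j₁ : Conv k H (H ⊗[k] H) :=
      Conv.push Algebra.TensorProduct.includeLeft (toConv (antipode k))
    let j₂ : Conv k H (H ⊗[k] H) :=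
      Conv.push Algebra.TensorProduct.includeRight (toConv (antipode k))
    have h1 : toConv (comul : H →ₗ[k] H ⊗[k] H) = i₁ * i₂ := by
      ext h
      rw [LinearMap.convMul_apply]
      change comul h = _
      generalize comul (R := k) h = t
      induction t with
      | zero => simp
      | tmul x y => simp [i₁, i₂, Conv.push]
      | add x y hx hy => simp only [map_add, ← hx, ← hy]
    have h2 : toConv (TensorProduct.map (antipode k) (antipode k) ∘ₗ
      (TensorProduct.comm k H H).toLinearMap ∘ₗ comul) = j₂ * j₁ := by
      ext h
      rw [LinearMap.convMul_apply]
      change TensorProduct.map (antipode k) (antipode k)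
        (TensorProduct.comm k H H (comul h)) = _
      generalize comul (R := k) h = t
      induction t with
      | zero => simp
      | tmul x y => simp [j₁, j₂, Conv.push]
      | add x y hx hy => simp only [map_add, ← hx, ← hy]
    have h3 : j₁ * i₁ = 1 := by
      rw [← map_mul, LinearMap.antipode_mul_id, map_one]
    have h4 : j₂ * i₂ = 1 := by
      rw [← map_mul, LinearMap.antipode_mul_id, map_one]
    rw [h1, h2, mul_assoc, ← mul_assoc j₁, h3, one_mul, h4]
  exact (LinearMap.congr_fun (congrArg WithConv.ofConv e) h).symm

theorem comul_antipode_antipode (h : H) :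
    comul (antipode k (antipode k h)) =
      TensorProduct.map (antipode k ∘ₗ antipode k) (antipode k ∘ₗ antipode k) (comul h) := by
  rw [comul_antipode, comul_antipode]
  generalize comul (R := k) h = t
  induction t with
  | zero => simp
  | tmul x y => simp
  | add x y hx hy => simp only [map_add, hx, hy]

variable (k H) in
/-- The square of the antipode, as a coalgebra map. -/
noncomputable def antipodeSq : H →ₗc[k] H where
  toLinearMap := antipode k ∘ₗ antipode k
  counit_comp := by ext; simp
  map_comp_comul := by ext; simp [comul_antipode_antipode]

theorem antipodeSq_apply (h : H) : antipodeSq k H h = antipode k (antipode k h) := rfl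

variable (hS : Function.Bijective (antipode k : H →ₗ[k] H))

theorem antipode_sInv (h : H) : antipode k (sInv hS h) = h :=
  (LinearEquiv.ofBijective (antipode k : H →ₗ[k] H) hS).apply_symm_apply h

theorem sInv_antipode (h : H) : sInv hS (antipode k h) = h :=
  (LinearEquiv.ofBijective (antipode k : H →ₗ[k] H) hS).symm_apply_apply h

theorem sInv_mul (x y : H) : sInv hS (x * y) = sInv hS y * sInv hS x := by
  apply hS.injective
  simp only [antipode_mul_antidistrib, antipode_sInv]

theorem sInv_one : sInv hS (1 : H) = 1 := by
  apply hS.injective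
  simp only [antipode_sInv, antipode_one]

variable (k H) in
/-- The tautological map from `H` to the opposite algebra. -/
noncomputable def opConv : Conv k H Hᵐᵒᵖ := toConv (opLinearEquiv k).toLinearMap

/-- The inverse of the antipode, as a map to the opposite algebra. -/
noncomputable def sInvConv : Conv k H Hᵐᵒᵖ := toConv ((opLinearEquiv k).toLinearMap ∘ₗ sInv hS)

variable (k H) in
/-- The antipode, as a homomorphism from the opposite algebra. -/
noncomputable def antipodeOp : Hᵐᵒᵖ →ₐ[k] H :=
  AlgHom.ofLinearMap (antipode k ∘ₗ (opLinearEquiv k).symm.toLinearMap) (by simp)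
    (fun x y => by simp [antipode_mul_antidistrib])

theorem antipodeOp_injective (hS : Function.Bijective (antipode k : H →ₗ[k] H)) :
    Function.Injective (antipodeOp k H) := fun _ _ h =>
  unop_injective (hS.injective h)

/-- The map S : Hᵒᵖ → H is an injective algebra map carrying S⁻¹ to id and the tautological map to
S, so the claim becomes id * S = 1. In other words, S⁻¹ is the antipode of Hᵒᵖ. -/
theorem sInvConv_mul_opConv : sInvConv hS * opConv k H = 1 := by
  have e : Conv.push (antipodeOp k H) (sInvConv hS * opConv k H) = 1 := by
    rw [map_mul, ← LinearMap.id_mul_antipode]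
    congr 1
    ext h
    exact antipode_sInv hS h
  rw [← map_one (Conv.push (antipodeOp k H))] at e
  ext h
  exact antipodeOp_injective hS (LinearMap.congr_fun (congrArg WithConv.ofConv e) h)

theorem opConv_mul_sInvConv : opConv k H * sInvConv hS = 1 := by
  have e : Conv.push (antipodeOp k H) (opConv k H * sInvConv hS) = 1 := by
    rw [map_mul, ← LinearMap.antipode_mul_id]
    congr 1
    ext h
    exact antipode_sInv hS h
  rw [← map_one (Conv.push (antipodeOp k H))] at e
  ext h
  exact antipodeOp_injective hS (LinearMap.congr_fun (congrArg WithConv.ofConv e) h)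

variable (k H) in
/-- The map `h ↦ 1 ⊗ h` to `R ⊗ Hᵒᵖ`. -/
noncomputable def opR (R : Type*) [Ring R] [Algebra k R] : Conv k H (R ⊗[k] Hᵐᵒᵖ) :=
  Conv.push Algebra.TensorProduct.includeRight (opConv k H)

/-- The map `h ↦ 1 ⊗ S⁻¹(h)` to `R ⊗ Hᵒᵖ`. -/
noncomputable def sInvR (R : Type*) [Ring R] [Algebra k R] : Conv k H (R ⊗[k] Hᵐᵒᵖ) :=
  Conv.push Algebra.TensorProduct.includeRight (sInvConv hS)

variable {R : Type*} [Ring R] [Algebra k R]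

theorem opR_apply (h : H) : opR k H R h = 1 ⊗ₜ op h := rfl

theorem sInvR_apply (h : H) : sInvR hS R h = 1 ⊗ₜ op (sInv hS h) := rfl

theorem sInvR_mul_opR : sInvR hS R * opR k H R = 1 := by
  rw [sInvR, opR, ← map_mul, sInvConv_mul_opConv, map_one]

theorem opR_mul_sInvR : opR k H R * sInvR hS R = 1 := by
  rw [sInvR, opR, ← map_mul, opConv_mul_sInvConv, map_one]

variable (k H R) in
/-- The identification of `R ⊗ H` and `R ⊗ Hᵒᵖ`. -/
noncomputable def opEquiv (V : Type*) [AddCommGroup V] [Module k V] :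
    V ⊗[k] H ≃ₗ[k] V ⊗[k] Hᵐᵒᵖ :=
  LinearEquiv.lTensor V (opLinearEquiv k)

theorem opEquiv_tmul {V : Type*} [AddCommGroup V] [Module k V] (v : V) (h : H) :
    opEquiv k H V (v ⊗ₜ h) = v ⊗ₜ op h := rfl

/-- The rule a⁽⁰⁾b⁽⁰⁾ ⊗ b⁽¹⁾a⁽¹⁾ is multiplication in R ⊗ Hᵒᵖ; from here on such coactions are
treated as algebra maps. -/
theorem opEquiv_map₂ (x y : R ⊗[k] H) :
    opEquiv k H R (TensorProduct.map₂ (LinearMap.mul k R) (LinearMap.mul k H).flip x y) =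
      opEquiv k H R x * opEquiv k H R y := by
  induction x with
  | zero => simp
  | add a b ha hb => simp only [map_add, LinearMap.add_apply, ha, hb, add_mul]
  | tmul a h =>
    induction y with
    | zero => simp
    | add a b ha hb => simp only [map_add, ha, hb, mul_add]
    | tmul b l => simp [opEquiv_tmul]

end HopfConvolution

/-! ### Identities in the partial Hopf algebra -/

section Bracket

variable {k : Type u} {H : Type v} [Field k] [Ring H] [HopfAlgebra k H]

open MulOpposite

variable (k H) in
/-- `h ↦ [h]` -/
noncomputable def brC : Conv k H (Hpar k H) := toConv (bracket k H)

variable (k H) in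
/-- `h ↦ [S(h)]` -/
noncomputable def brS : Conv k H (Hpar k H) := toConv (bracket k H ∘ₗ antipode k)

variable (k H) in
/-- `h ↦ ε_h` -/
noncomputable def epC : Conv k H (Hpar k H) := toConv (epsOf (bracket k H))

theorem brC_apply (h : H) : brC k H h = bracket k H h := rfl
theorem brS_apply (h : H) : brS k H h = bracket k H (antipode k h) := rfl
theorem epC_apply (h : H) : epC k H h = epsOf (bracket k H) h := rfl

theorem brC_mul_brS : brC k H * brS k H = epC k H := rfl

/-- `[S(h₍₁₎)][h₍₂₎][S(h₍₃₎)] = [S(h)]` -/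
theorem brS_mul_epC : brS k H * epC k H = brS k H := by
  ext h
  -- G is x ⊗ y ⊗ z ↦ [S(x)y][S(z)]: the left relation moves S(h₍₁₎) inside the bracket, where it
  -- cancels against h₍₂₎.
  let G : H ⊗[k] (H ⊗[k] H) →ₗ[k] Hpar k H := LinearMap.mul' k (Hpar k H) ∘ₗ
    TensorProduct.map (bracket k H ∘ₗ LinearMap.mul' k H ∘ₗ (antipode k).rTensor H)
      (bracket k H ∘ₗ antipode k) ∘ₗ (TensorProduct.assoc k H H H).symm.toLinearMap
  have e1 : (brS k H * epC k H).ofConv h = G (comul.lTensor H (comul h)) := by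
    rw [LinearMap.convMul_apply]
    generalize comul (R := k) h = t
    induction t with
    | zero => simp
    | tmul x y =>
      simp only [map_tmul, LinearMap.mul'_apply, brS_apply, epC_apply, LinearMap.lTensor_tmul]
      rw [(bracket_isPartialRep k H).left]
      generalize comul (R := k) y = t
      induction t with
      | zero => simp
      | tmul y z => simp [G]
      | add x y hx hy => simp only [map_add, tmul_add, hx, hy]
    | add x y hx hy => simp only [map_add, hx, hy]
  rw [e1, ← Coalgebra.coassoc_apply]
  have e2 : h = TensorProduct.lid k H (counit.rTensor H (comul h)) := by simp
  conv_rhs => rw [e2]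
  generalize comul (R := k) h = t
  induction t with
  | zero => simp
  | tmul x y =>
    have := mul_antipode_rTensor_comul_apply (R := k) x
    simp [G, this, brS_apply, Algebra.algebraMap_eq_smul_one, (bracket_isPartialRep k H).map_one]
  | add x y hx hy => simp only [map_add, hx, hy]

/-- `[h₍₁₎][S(h₍₂₎)][h₍₃₎] = [h]` -/
theorem epC_mul_brC : epC k H * brC k H = brC k H := by
  ext h
  -- G is x ⊗ y ⊗ z ↦ [x][S(y)z], the form produced by the right relation; S(h₍₂₎)h₍₃₎ then cancels.
  let G : H ⊗[k] (H ⊗[k] H) →ₗ[k] Hpar k H := LinearMap.mul' k (Hpar k H) ∘ₗ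
    TensorProduct.map (bracket k H)
      (bracket k H ∘ₗ LinearMap.mul' k H ∘ₗ (antipode k).rTensor H)
  have e1 : (epC k H * brC k H).ofConv h =
      G (TensorProduct.assoc k H H H (comul.rTensor H (comul h))) := by
    rw [LinearMap.convMul_apply]
    generalize comul (R := k) h = t
    induction t with
    | zero => simp
    | tmul x y =>
      simp only [map_tmul, LinearMap.mul'_apply, brC_apply, epC_apply, LinearMap.rTensor_tmul]
      rw [(bracket_isPartialRep k H).right]
      generalize comul (R := k) x = t
      induction t with
      | zero => simp
      | tmul y z => simp [G]
      | add x y hx hy => simp only [map_add, add_tmul, hx, hy]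
    | add x y hx hy => simp only [map_add, hx, hy]
  rw [e1, Coalgebra.coassoc_apply]
  have e2 : h = TensorProduct.rid k H (counit.lTensor H (comul h)) := by simp
  conv_rhs => rw [e2]
  generalize comul (R := k) h = t
  induction t with
  | zero => simp
  | tmul x y =>
    have := mul_antipode_rTensor_comul_apply (R := k) y
    simp [G, this, brC_apply, Algebra.algebraMap_eq_smul_one, (bracket_isPartialRep k H).map_one]
  | add x y hx hy => simp only [map_add, hx, hy]

theorem brS_mul_brC_mul_brS : brS k H * brC k H * brS k H = brS k H := by
  rw [mul_assoc, brC_mul_brS, brS_mul_epC]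

theorem brC_mul_brS_mul_brC : brC k H * brS k H * brC k H = brC k H := by
  rw [brC_mul_brS, epC_mul_brC]

/-- `[h] ε_x = ε_{h₍₁₎ x} [h₍₂₎]` -/
theorem brC_mul_epC_legs :
    leg₁ (brC k H) * leg₂ (epC k H) =
      Conv.pull (Bialgebra.mulCoalgHom k H) (epC k H) * leg₁ (brC k H) := by
  refine Conv.ext_at₂ fun x => ?_
  rw [leg₁_mul_at₂, leg₂_at₂, mul_leg₁_at₂]
  ext h
  rw [Conv.mul_const_apply, LinearMap.convMul_apply]
  exact bracket_mul_eps h x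

/-- `[S(h₍₁₎)] ε_{h₍₂₎ x} = ε_x [S(h)]` -/
theorem brS_mul_epC_legs :
    leg₁ (brS k H) * Conv.pull (Bialgebra.mulCoalgHom k H) (epC k H) =
      leg₂ (epC k H) * leg₁ (brS k H) := by
  refine Conv.ext_at₂ fun x => ?_
  rw [leg₁_mul_at₂, mul_leg₁_at₂, leg₂_at₂]
  ext h
  -- Since S reverses the coproduct, moving [S(h₍₁₎)] past ε_{h₍₂₎x} gives
  -- ε_{S(h₍₂₎)h₍₃₎x}[S(h₍₁₎)], and S(h₍₂₎)h₍₃₎ cancels.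
  let G : H ⊗[k] (H ⊗[k] H) →ₗ[k] Hpar k H := LinearMap.mul' k (Hpar k H) ∘ₗ
    (TensorProduct.comm k _ _).toLinearMap ∘ₗ
    TensorProduct.map (bracket k H ∘ₗ antipode k)
      (epsOf (bracket k H) ∘ₗ LinearMap.mulRight k x ∘ₗ LinearMap.mul' k H ∘ₗ
        (antipode k).rTensor H)
  have e1 : (brS k H * Conv.at₂ (Conv.pull (Bialgebra.mulCoalgHom k H) (epC k H)) x).ofConv h =
      G (TensorProduct.assoc k H H H (comul.rTensor H (comul h))) := by
    rw [LinearMap.convMul_apply]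
    generalize comul (R := k) h = t
    induction t with
    | zero => simp
    | tmul y z =>
      have : (Conv.at₂ (Conv.pull (Bialgebra.mulCoalgHom k H) (epC k H)) x).ofConv z =
        epsOf (bracket k H) (z * x) := rfl
      simp only [map_tmul, LinearMap.mul'_apply, brS_apply, LinearMap.rTensor_tmul, this]
      rw [bracket_mul_eps, comul_antipode]
      generalize comul (R := k) y = t
      induction t with
      | zero => simp
      | tmul y z => simp [G, mul_assoc]
      | add x y hx hy => simp only [map_add, add_tmul, hx, hy]
    | add x y hx hy => simp only [map_add, hx, hy]
  rw [e1, Coalgebra.coassoc_apply, Conv.const_mul_apply]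
  have e2 : h = TensorProduct.rid k H (counit.lTensor H (comul h)) := by simp
  conv_rhs => rw [e2]
  generalize comul (R := k) h = t
  induction t with
  | zero => simp
  | tmul y z =>
    have := mul_antipode_rTensor_comul_apply (R := k) z
    simp [G, this, brS_apply, epC_apply, Algebra.algebraMap_eq_smul_one]
  | add x y hx hy => simp only [map_add, mul_add, hx, hy]

/-- `[h] a = [h₍₁₎] a [S(h₍₂₎)] [h₍₃₎]` and `a [S(h)] = [S(h₍₁₎)] [h₍₂₎] a [S(h₍₃₎)]` for
`a ∈ A_par`. -/
theorem const_brC_brS {a : Hpar k H} (ha : a ∈ AparSub k H) :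
    brC k H * Conv.const a * brS k H * brC k H = brC k H * Conv.const a ∧
    brS k H * brC k H * Conv.const a * brS k H = Conv.const a * brS k H := by
  induction ha using Algebra.adjoin_induction with
  | mem a ha =>
    obtain ⟨x, rfl⟩ := ha
    have c1 : Conv.at₂ (leg₂ (epC k H) : Conv k (H ⊗[k] H) (Hpar k H)) x = Conv.const (epsOf (bracket k H) x) := leg₂_at₂ _ _
    constructor
    -- For a generator, moving ε_x to the left of [h] brings [h₍₁₎][S(h₍₂₎)][h₍₃₎] together, which
    -- is [h].
    · have := congrArg (Conv.at₂ · x) (show leg₁ (brC k H) * leg₂ (epC k H) * leg₁ (brS k H) *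
        leg₁ (brC k H) = leg₁ (brC k H) * leg₂ (epC k H) by
          rw [brC_mul_epC_legs, mul_assoc _ (leg₁ _) (leg₁ _), mul_assoc, ← map_mul, ← map_mul,
            ← mul_assoc, brC_mul_brS_mul_brC])
      simpa only [mul_leg₁_at₂, leg₁_mul_at₂, c1] using this
    · have := congrArg (Conv.at₂ · x) (show leg₁ (brS k H) * (leg₁ (brC k H) * (leg₂ (epC k H) *
        leg₁ (brS k H))) = leg₂ (epC k H) * leg₁ (brS k H) by
          rw [← mul_assoc (leg₁ (brC k H)), brC_mul_epC_legs, mul_assoc, ← mul_assoc,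
            brS_mul_epC_legs, mul_assoc, ← map_mul, ← map_mul, ← mul_assoc,
            brS_mul_brC_mul_brS])
      simpa only [mul_leg₁_at₂, leg₁_mul_at₂, c1, mul_assoc] using this
  | algebraMap r =>
    have e : (Conv.const (algebraMap k (Hpar k H) r) : Conv k H (Hpar k H)) =
        algebraMap k (Conv k H (Hpar k H)) r := by
      ext h
      rw [Conv.const_apply, LinearMap.convAlgebraMap_apply, Algebra.algebraMap_eq_smul_one,
        Algebra.algebraMap_eq_smul_one, smul_comm]
    constructor
    · rw [e, ← Algebra.commutes, mul_assoc, mul_assoc, ← mul_assoc (brC k H), brC_mul_brS_mul_brC]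
    · rw [e, ← Algebra.commutes, mul_assoc, brS_mul_brC_mul_brS]
  | add a b _ _ ha hb =>
    simp only [map_add, mul_add, add_mul, ha.1, ha.2, hb.1, hb.2, and_self]
  | mul a b _ _ ha hb =>
    constructor
    -- Reinserting [S(·)][·] after a puts a bracket directly in front of b, so that the hypothesis
    -- on b applies.
    · rw [map_mul, ← mul_assoc, ← ha.1]
      simp only [mul_assoc] at hb ⊢
      rw [hb.1]
    · calc _ = brS k H * brC k H * Conv.const a * (Conv.const b * brS k H) := by
            simp only [map_mul, mul_assoc]
        _ = (brS k H * brC k H * Conv.const a * brS k H) * brC k H * Conv.const b * brS k H := by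
            rw [← hb.2]; simp only [mul_assoc]
        _ = _ := by 
            have := hb.2
            rw [ha.2, map_mul]
            simp only [mul_assoc] at this ⊢
            rw [this]

/-- Expresses the partial action as a convolution product with constant middle factor, the form in
which `const_brC_brS` can be used. -/
theorem conj_apply (h : H) (a : Hpar k H) :
    conj k H h a = (brC k H * Conv.const a * brS k H).ofConv h := by
  have : brC k H * Conv.const a = toConv (LinearMap.mulRight k a ∘ₗ bracket k H) := by
    ext h; exact Conv.mul_const_apply _ _ _
  rw [this, LinearMap.convMul_apply, conj, LinearMap.comp_apply, LinearMap.comp_apply]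
  generalize comul (R := k) h = t
  induction t with
  | zero => simp
  | tmul x y => simp [brS, mul_assoc, Module.End.mul_apply]
  | add x y hx hy => simp only [map_add, LinearMap.add_apply, hx, hy]

theorem incl_bullet (h : H) (a : Apar k H) :
    Apar.incl k H (bullet k H h a) = (brC k H * Conv.const (Apar.incl k H a) * brS k H).ofConv h :=
  conj_apply h _

theorem Apar.incl_injective : Function.Injective (Apar.incl k H) := Subtype.val_injective

theorem Apar.incl_mem (a : Apar k H) : Apar.incl k H a ∈ AparSub k H := a.2

theorem incl_epsA (h : H) : Apar.incl k H (epsA k H h) = epC k H h := rfl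

end Bracket

/-! ### The coaction on the partial Hopf algebra -/

section Twist

variable {k : Type u} {H : Type v} [Field k] [Ring H] [HopfAlgebra k H]

open MulOpposite

/-- The extension of a partial representation to `H_par`. -/
noncomputable def Hpar.lift {B : Type*} [Ring B] [Algebra k B] {π : H →ₗ[k] B}
    (hπ : IsPartialRep π) : Hpar k H →ₐ[k] B :=
  RingQuot.liftAlgHom k ⟨TensorAlgebra.lift k π, fun x y h => by
    have e : (TensorAlgebra.lift k π).toLinearMap ∘ₗ TensorAlgebra.ι k = π := by ext; simp
    cases h with
    | one => simpa using hπ.map_one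
    | left h x =>
      rw [map_mul, epsOf, LinearMap.comp_apply, LinearMap.comp_apply, algHom_mul'_map,
        algHom_mul'_map, ← LinearMap.comp_assoc, ← LinearMap.comp_assoc, e,
        TensorAlgebra.lift_ι_apply]
      exact hπ.left h x
    | right h x =>
      rw [map_mul, epsOf, LinearMap.comp_apply, LinearMap.comp_apply, algHom_mul'_map,
        algHom_mul'_map, ← LinearMap.comp_assoc, ← LinearMap.comp_assoc, e,
        TensorAlgebra.lift_ι_apply]
      exact hπ.right h x⟩

theorem Hpar.lift_bracket {B : Type*} [Ring B] [Algebra k B] {π : H →ₗ[k] B}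
    (hπ : IsPartialRep π) (h : H) : Hpar.lift hπ (bracket k H h) = π h := by
  change RingQuot.liftAlgHom k _ (RingQuot.mkAlgHom k (HparRel k H) (TensorAlgebra.ι k h)) = _
  rw [RingQuot.liftAlgHom_mkAlgHom_apply, TensorAlgebra.lift_ι_apply]

/-- The brackets generate the partial Hopf algebra, so identities between algebra maps are checked
on them. -/
theorem Hpar.hom_ext {B : Type*} [Ring B] [Algebra k B] {f g : Hpar k H →ₐ[k] B}
    (h : ∀ x, f (bracket k H x) = g (bracket k H x)) : f = g :=
  RingQuot.ringQuot_ext' k _ _ (TensorAlgebra.hom_ext (LinearMap.ext h))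

variable (H) in
/-- Postcomposition with `R → R ⊗ Hᵒᵖ`. -/
noncomputable abbrev inL {C R : Type*} [AddCommGroup C] [Module k C] [Coalgebra k C]
    [Ring R] [Algebra k R] : Conv k C R →+* Conv k C (R ⊗[k] Hᵐᵒᵖ) :=
  Conv.push Algebra.TensorProduct.includeLeft

theorem inL_apply {C R : Type*} [AddCommGroup C] [Module k C] [Coalgebra k C]
    [Ring R] [Algebra k R] (F : Conv k C R) (c : C) :
    (inL H F : Conv k C (R ⊗[k] Hᵐᵒᵖ)) c = F c ⊗ₜ 1 := rfl

variable (hS : Function.Bijective (antipode k : H →ₗ[k] H))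

/-- `h ↦ [h₍₂₎] ⊗ S⁻¹(h₍₁₎)` -/
noncomputable def twistC : Conv k H (Hpar k H ⊗[k] Hᵐᵒᵖ) := sInvR hS _ * inL H (brC k H)

/-- S reverses the coproduct and S⁻¹S = id, so the twist of S(h) is [S(h₍₁₎)] ⊗ h₍₂₎, without any
S⁻¹. -/
theorem twistC_antipode (h : H) :
    twistC hS (antipode k h) = (inL H (brS k H) * opR k H _ : Conv k H _).ofConv h := by
  rw [twistC, LinearMap.convMul_apply, LinearMap.convMul_apply, comul_antipode]
  generalize comul (R := k) h = t
  induction t with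
  | zero => simp
  | tmul x y =>
    simp [sInvR_apply, opR_apply, inL_apply, sInv_antipode, brS_apply, brC_apply]
  | add x y hx hy => simp only [map_add, hx, hy]

theorem epsOf_twistC (h : H) : epsOf (twistC hS).ofConv h =
    (sInvR hS _ * inL H (epC k H) * opR k H _ : Conv k H _).ofConv h := by
  have e : toConv ((twistC hS).ofConv ∘ₗ antipode k) = inL H (brS k H) * opR k H _ := by
    ext h; exact twistC_antipode hS h
  have : epsOf (twistC hS).ofConv h =
      (twistC hS * toConv ((twistC hS).ofConv ∘ₗ antipode k) : Conv k H _).ofConv h := rfl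
  rw [this, e, twistC, ← brC_mul_brS, map_mul]
  simp only [mul_assoc]

/-- S⁻¹ is an algebra map into Hᵒᵖ and keeps the order of factors; the tautological map in the next
lemma reverses it. -/
theorem pull_mul_sInvR (R : Type*) [Ring R] [Algebra k R] :
    Conv.pull (Bialgebra.mulCoalgHom k H) (sInvR hS R) = leg₁ (sInvR hS R) * leg₂ (sInvR hS R) :=
  Conv.ext₂ fun x y => by
    rw [leg₁_mul_leg₂_apply, Conv.pull_apply, sInvR_apply, sInvR_apply, sInvR_apply]
    simp [sInv_mul]

theorem pull_mul_opR (R : Type*) [Ring R] [Algebra k R] :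
    Conv.pull (Bialgebra.mulCoalgHom k H) (opR k H R) = leg₂ (opR k H R) * leg₁ (opR k H R) :=
  Conv.ext₂ fun x y => by
    rw [leg₂_mul_leg₁_apply, Conv.pull_apply, opR_apply, opR_apply, opR_apply]
    simp

theorem pull_mul_brC_mul_brS :
    Conv.pull (Bialgebra.mulCoalgHom k H) (brC k H) * leg₂ (brS k H) =
      leg₁ (brC k H) * leg₂ (epC k H) :=
  Conv.ext₂ fun h x => by
    rw [leg₁_mul_leg₂_apply, ← Conv.at₁_apply, mul_leg₂_at₁, LinearMap.convMul_apply]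
    exact ((bracket_isPartialRep k H).left h x).symm

theorem epC_mul_const (x : H) :
    epC k H * Conv.const (bracket k H x) =
      brC k H * toConv (bracket k H ∘ₗ LinearMap.mulRight k x ∘ₗ antipode k) := by
  ext h
  rw [Conv.mul_const_apply, LinearMap.convMul_apply]
  exact (bracket_isPartialRep k H).right h x

theorem inL_commute_sInvR {C R : Type*} [AddCommGroup C] [Module k C] [Coalgebra k C]
    [Ring R] [Algebra k R] (F : Conv k C R) (x : C) (h : H) :
    Commute ((inL H F : Conv k C (R ⊗[k] Hᵐᵒᵖ)) x) (sInvR hS R h) := by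
  rw [inL_apply, sInvR_apply]; simp [Commute, SemiconjBy]

theorem inL_commute_opR {C R : Type*} [AddCommGroup C] [Module k C] [Coalgebra k C]
    [Ring R] [Algebra k R] (F : Conv k C R) (x : C) (h : H) :
    Commute ((inL H F : Conv k C (R ⊗[k] Hᵐᵒᵖ)) x) (opR k H R h) := by
  rw [inL_apply, opR_apply]; simp [Commute, SemiconjBy]

/-- The Hᵒᵖ-valued factors commute with the bracket-valued ones. In each relation they can be moved
aside, leaving the corresponding relation of H_par in the first tensor factor. -/
theorem twistC_isPartialRep : IsPartialRep (twistC hS).ofConv where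
  map_one := by
    rw [twistC, LinearMap.convMul_apply, Bialgebra.comul_one, Algebra.TensorProduct.one_def]
    simp [sInvR_apply, inL_apply, sInv_one, brC_apply, (bracket_isPartialRep k H).map_one,
      Algebra.TensorProduct.one_def]
  left h x := by
    have e : toConv ((twistC hS).ofConv ∘ₗ antipode k) = inL H (brS k H) * opR k H _ := by
      ext h; exact twistC_antipode hS h
    have e2 : toConv (epsOf (twistC hS).ofConv) = sInvR hS _ * inL H (epC k H) * opR k H _ := by
      ext h; exact epsOf_twistC hS h
    have key : leg₁ (twistC hS) * leg₂ (toConv (epsOf (twistC hS).ofConv)) =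
        Conv.pull (Bialgebra.mulCoalgHom k H) (twistC hS) *
          leg₂ (toConv ((twistC hS).ofConv ∘ₗ antipode k)) := by
      have c := (leg_commute (inL H (brC k H)) (sInvR hS _) (inL_commute_sInvR hS _)).eq
      have l := congrArg (inL H) (pull_mul_brC_mul_brS (k := k) (H := H))
      simp only [map_mul, Conv.push_pull] at l
      rw [e, e2, twistC]
      simp only [map_mul]
      rw [pull_mul_sInvR]
      simp only [mul_assoc]
      rw [← mul_assoc (leg₁ (inL H (brC k H))) (leg₂ (sInvR hS _)), c]
      simp only [mul_assoc]
      rw [← mul_assoc (leg₁ (inL H (brC k H))) (leg₂ (inL H (epC k H))), ← l]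
      simp only [mul_assoc]
    have key' := congrArg (fun F => F.ofConv (h ⊗ₜ x)) key
    simp only [leg₁_mul_leg₂_apply] at key'
    rw [← Conv.at₁_apply, mul_leg₂_at₁, LinearMap.convMul_apply] at key'
    exact key'
  right h x := by
    obtain ⟨ι, s, p, q, hpq⟩ : ∃ (ι : Type v) (s : Finset ι) (p q : ι → H),
        comul (R := k) x = ∑ i ∈ s, p i ⊗ₜ q i :=
      ⟨_, (ℛ k x).index, (ℛ k x).left, (ℛ k x).right, (ℛ k x).eq.symm⟩
    let N (y : H) : Conv k H (Hpar k H) :=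
      toConv (bracket k H ∘ₗ LinearMap.mulRight k y ∘ₗ antipode k)
    -- One term of the right relation, after expanding Δ(x) = ∑ p ⊗ q, with u = S⁻¹(p) and y = q.
    -- The element u stays rightmost because it need not commute with the factor h₍₃₎.
    have e (u y : H) : sInvR hS _ * inL H (epC k H) * opR k H _ *
        Conv.const (((1 : Hpar k H) ⊗ₜ[k] op u) * (bracket k H y ⊗ₜ[k] (1 : Hᵐᵒᵖ))) =
          twistC hS * (inL H (N y) * opR k H _ * Conv.const ((1 : Hpar k H) ⊗ₜ[k] op u)) := by
      have c1 : opR k H (Hpar k H) * Conv.const (bracket k H y ⊗ₜ[k] (1 : Hᵐᵒᵖ)) =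
          Conv.const (bracket k H y ⊗ₜ[k] (1 : Hᵐᵒᵖ)) * opR k H (Hpar k H) := by
        ext1; ext h
        rw [Conv.mul_const_apply, Conv.const_mul_apply]; simp [opR_apply]
      have c2 : ((1 : Hpar k H) ⊗ₜ[k] op u) * (bracket k H y ⊗ₜ[k] (1 : Hᵐᵒᵖ)) =
        (bracket k H y ⊗ₜ[k] (1 : Hᵐᵒᵖ)) * ((1 : Hpar k H) ⊗ₜ[k] op u) := by simp
      have c3 : inL H (epC k H) * Conv.const (bracket k H y ⊗ₜ[k] (1 : Hᵐᵒᵖ)) =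
          inL H (brC k H) * inL H (N y) := by
        rw [← map_mul, ← epC_mul_const, map_mul, Conv.push_const]; rfl
      rw [c2, map_mul, mul_assoc _ (opR k H _), ← mul_assoc (opR k H _), c1, twistC]
      simp only [← mul_assoc]
      rw [mul_assoc _ (inL H (epC k H)), c3]
      simp only [mul_assoc]
    -- Here Δ(S(z)x) = S(z₍₂₎)p ⊗ S(z₍₁₎)q and S⁻¹(S(z₍₂₎)p) = S⁻¹(p)z₍₂₎, which in Hᵒᵖ is z₍₂₎
    -- followed by S⁻¹(p).
    have e1 : toConv ((twistC hS).ofConv ∘ₗ LinearMap.mulRight k x ∘ₗ antipode k) =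
        ∑ i ∈ s, inL H (N (q i)) * opR k H _ *
          Conv.const ((1 : Hpar k H) ⊗ₜ[k] op (sInv hS (p i))) := by
      ext1; ext z
      rw [ofConv_sum, LinearMap.sum_apply]
      simp only [Conv.mul_const_apply]
      simp only [LinearMap.comp_apply, twistC, LinearMap.convMul_apply, LinearMap.mulRight_apply,
        Bialgebra.comul_mul, comul_antipode, hpq]
      generalize comul (R := k) z = t
      induction t with
      | zero => simp
      | tmul a b =>
        simp [Finset.mul_sum, sInvR_apply, opR_apply, inL_apply, brC_apply, N, sInv_mul,
          sInv_antipode]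
      | add x y hx hy => simp only [map_add, add_mul, hx, hy, Finset.sum_add_distrib]
    have e2 : twistC hS x = ∑ i ∈ s,
        ((1 : Hpar k H) ⊗ₜ[k] op (sInv hS (p i))) * (bracket k H (q i) ⊗ₜ[k] (1 : Hᵐᵒᵖ)) := by
      rw [twistC, LinearMap.convMul_apply, hpq]
      simp [sInvR_apply, inL_apply, brC_apply]
    change _ = (twistC hS * toConv ((twistC hS).ofConv ∘ₗ LinearMap.mulRight k x ∘ₗ
      antipode k) : Conv k H _).ofConv h
    rw [epsOf_twistC, ← Conv.mul_const_apply, e1, e2, map_sum, Finset.mul_sum, Finset.mul_sum]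
    simp only [e]

/-- The coaction `[h] ↦ [h₍₂₎] ⊗ S⁻¹(h₍₁₎)` of `H` on `H_par`. -/
noncomputable def Hpar.coact : Hpar k H →ₐ[k] Hpar k H ⊗[k] Hᵐᵒᵖ :=
  Hpar.lift (twistC_isPartialRep hS)

theorem coact_brC : Conv.push (Hpar.coact hS) (brC k H) = sInvR hS _ * inL H (brC k H) := by
  ext1; ext h; exact Hpar.lift_bracket _ h

theorem coact_brS : Conv.push (Hpar.coact hS) (brS k H) = inL H (brS k H) * opR k H _ := by
  ext1; ext h
  rw [← twistC_antipode hS]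
  exact Hpar.lift_bracket _ _

theorem coact_epC : Conv.push (Hpar.coact hS) (epC k H) =
    sInvR hS _ * inL H (epC k H) * opR k H _ := by
  rw [← brC_mul_brS, map_mul, coact_brC, coact_brS, map_mul]
  simp only [mul_assoc]

variable (k H) in
/-- The comultiplication of the opposite algebra. -/
noncomputable def comulOp : Hᵐᵒᵖ →ₐ[k] Hᵐᵒᵖ ⊗[k] Hᵐᵒᵖ :=
  AlgHom.ofLinearMap (TensorProduct.map (opLinearEquiv k).toLinearMap
      (opLinearEquiv k).toLinearMap ∘ₗ comul ∘ₗ (opLinearEquiv k).symm.toLinearMap)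
    (by simp [Algebra.TensorProduct.one_def])
    (fun x y => by
      simp only [LinearMap.comp_apply, LinearEquiv.coe_coe, coe_opLinearEquiv_symm, unop_mul,
        Bialgebra.comul_mul]
      generalize comul (R := k) (unop x) = s
      generalize comul (R := k) (unop y) = t
      induction s with
      | zero => simp
      | add a b ha hb => simp only [map_add, add_mul, mul_add, ha, hb]
      | tmul a b =>
        induction t with
        | zero => simp
        | add a b ha hb => simp only [map_add, add_mul, mul_add, ha, hb]
        | tmul c d => simp)

theorem comulOp_op (h : H) : comulOp k H (op h) = TensorProduct.map (opLinearEquiv k).toLinearMap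
      (opLinearEquiv k).toLinearMap (comul h) := rfl

/-- `1 ⊗ Δ` -/
noncomputable def comulR (R : Type*) [Ring R] [Algebra k R] :
    R ⊗[k] Hᵐᵒᵖ →ₐ[k] (R ⊗[k] Hᵐᵒᵖ) ⊗[k] Hᵐᵒᵖ :=
  (Algebra.TensorProduct.assoc k k k R Hᵐᵒᵖ Hᵐᵒᵖ).symm.toAlgHom.comp
    (Algebra.TensorProduct.map (AlgHom.id k R) (comulOp k H))

theorem comulR_opR (R : Type*) [Ring R] [Algebra k R] :
    Conv.push (comulR (H := H) R) (opR k H R) =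
      inL H (opR k H R) * opR k H (R ⊗[k] Hᵐᵒᵖ) := by
  ext1; ext h
  rw [LinearMap.convMul_apply]
  change comulR R (1 ⊗ₜ op h) = _
  rw [comulR, AlgHom.comp_apply, Algebra.TensorProduct.map_tmul, comulOp_op]
  generalize comul (R := k) h = t
  induction t with
  | zero => simp
  | add x y hx hy => simp only [map_add, tmul_add, ← hx, ← hy]
  | tmul x y => simp [inL_apply, opR_apply]

/-- Deduced from the formula for ι(h) = 1 ⊗ h by inverting both sides, which avoids a separate
computation of Δ∘S⁻¹. -/
theorem comulR_sInvR (R : Type*) [Ring R] [Algebra k R] :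
    Conv.push (comulR R) (sInvR hS R) = sInvR hS (R ⊗[k] Hᵐᵒᵖ) * inL H (sInvR hS R) := by
  refine left_inv_eq_right_inv (a := Conv.push (comulR R) (opR k H R)) ?_ ?_
  · rw [← map_mul, sInvR_mul_opR, map_one]
  · rw [comulR_opR, mul_assoc, ← mul_assoc (opR k H _), opR_mul_sInvR, one_mul, ← map_mul,
      opR_mul_sInvR, map_one]

theorem comulR_inL {R : Type*} [Ring R] [Algebra k R] (F : Conv k H R) :
    Conv.push (comulR (H := H) R) (inL H F) = inL H (inL H F) := by
  ext1; ext h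
  change comulR R (F h ⊗ₜ 1) = (F h ⊗ₜ 1) ⊗ₜ 1
  simp [comulR, Algebra.TensorProduct.one_def]

/-- `ρ ⊗ 1` -/
noncomputable def coactR : Hpar k H ⊗[k] Hᵐᵒᵖ →ₐ[k] (Hpar k H ⊗[k] Hᵐᵒᵖ) ⊗[k] Hᵐᵒᵖ :=
  Algebra.TensorProduct.map (Hpar.coact hS) (AlgHom.id k Hᵐᵒᵖ)

theorem coactR_sInvR : Conv.push (coactR hS) (sInvR hS (Hpar k H)) = sInvR hS _ := by
  ext1; ext h
  change coactR hS (1 ⊗ₜ op _) = 1 ⊗ₜ op _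
  simp [coactR]

theorem coactR_opR : Conv.push (coactR hS) (opR k H (Hpar k H)) = opR k H _ := by
  ext1; ext h
  change coactR hS (1 ⊗ₜ op _) = 1 ⊗ₜ op _
  simp [coactR]

theorem coactR_inL (F : Conv k H (Hpar k H)) :
    Conv.push (coactR hS) (inL H F) = inL H (Conv.push (Hpar.coact hS) F) := by
  ext1; ext h
  change coactR hS (F h ⊗ₜ 1) = _ ⊗ₜ 1
  simp [coactR, Conv.push_apply]

/-- Both composites are algebra maps, so it is enough to compare them on brackets, where this is the
coassociativity of S⁻¹(h₍₁₎) against [h₍₂₎]. -/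
theorem coact_coassoc (a : Hpar k H) :
    coactR hS (Hpar.coact hS a) = comulR (Hpar k H) (Hpar.coact hS a) := by
  have : (coactR hS).comp (Hpar.coact hS) = (comulR (Hpar k H)).comp (Hpar.coact hS) := by
    refine Hpar.hom_ext (k := k) (H := H) (B := (Hpar k H ⊗[k] Hᵐᵒᵖ) ⊗[k] Hᵐᵒᵖ) fun x => ?_
    have : Conv.push (coactR hS) (Conv.push (Hpar.coact hS) (brC k H)) =
        Conv.push (R' := (Hpar k H ⊗[k] Hᵐᵒᵖ) ⊗[k] Hᵐᵒᵖ) (comulR (Hpar k H)) (Conv.push (Hpar.coact hS) (brC k H)) := by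
      rw [coact_brC, map_mul, map_mul, coactR_sInvR, coactR_inL, coact_brC, comulR_sInvR,
        comulR_inL, map_mul, mul_assoc]
    exact LinearMap.congr_fun (congrArg WithConv.ofConv this) x
  exact DFunLike.congr_fun this a

variable (k H) in
/-- The counit of the opposite algebra. -/
noncomputable def counitOp : Hᵐᵒᵖ →ₐ[k] k :=
  AlgHom.ofLinearMap (counit ∘ₗ (opLinearEquiv k).symm.toLinearMap) (by simp)
    (fun x y => by simp [mul_comm])

/-- `1 ⊗ ε` -/
noncomputable def counitR (R : Type*) [Ring R] [Algebra k R] : R ⊗[k] Hᵐᵒᵖ →ₐ[k] R :=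
  (Algebra.TensorProduct.rid k k R).toAlgHom.comp
    (Algebra.TensorProduct.map (AlgHom.id k R) (counitOp k H))

theorem counitR_tmul {R : Type*} [Ring R] [Algebra k R] (a : R) (h : H) :
    counitR R (a ⊗ₜ[k] op h) = counit (R := k) h • a := by
  exact (Algebra.TensorProduct.rid_tmul k (counit (R := k) h) a :)

theorem counitR_opR (R : Type*) [Ring R] [Algebra k R] :
    Conv.push (counitR (k := k) (H := H) R) (opR k H R) = 1 := by
  ext1; ext h
  change counitR R (1 ⊗ₜ[k] op h) = _
  rw [counitR_tmul]; exact (Algebra.algebraMap_eq_smul_one _).symm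

theorem counitR_sInvR (R : Type*) [Ring R] [Algebra k R] :
    Conv.push (counitR (k := k) (H := H) R) (sInvR hS R) = 1 := by
  have := congrArg (Conv.push (counitR (k := k) (H := H) R)) (sInvR_mul_opR hS (R := R))
  rwa [map_mul, counitR_opR, mul_one, map_one] at this

theorem counitR_inL {R : Type*} [Ring R] [Algebra k R] (F : Conv k H R) :
    Conv.push (counitR (k := k) (H := H) R) (inL H F) = F := by
  ext1; ext h
  change counitR R (F h ⊗ₜ[k] op 1) = _
  rw [counitR_tmul]; simp

theorem coact_counit (a : Hpar k H) :
    counitR (Hpar k H) (Hpar.coact hS a) = a := by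
  have : (counitR (Hpar k H)).comp (Hpar.coact hS) = AlgHom.id k (Hpar k H) := by
    refine Hpar.hom_ext (k := k) (H := H) (B := Hpar k H) fun x => ?_
    have : Conv.push (counitR (k := k) (H := H) (Hpar k H))
        (Conv.push (Hpar.coact hS) (brC k H)) = brC k H := by
      rw [coact_brC, map_mul, counitR_sInvR, counitR_inL, one_mul]
    exact LinearMap.congr_fun (congrArg WithConv.ofConv this) x
  exact DFunLike.congr_fun this a

end Twist

/-! ### Restriction of the coaction to the base algebra -/

section Apar

variable {k : Type u} {H : Type v} [Field k] [Ring H] [HopfAlgebra k H]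

open MulOpposite

variable (k H) in
/-- The inclusion of `A_par ⊗ Hᵒᵖ` into `H_par ⊗ Hᵒᵖ`. -/
noncomputable def inclT : Apar k H ⊗[k] Hᵐᵒᵖ →ₐ[k] Hpar k H ⊗[k] Hᵐᵒᵖ :=
  Algebra.TensorProduct.map (Apar.incl k H) (AlgHom.id k _)

theorem inclT_tmul (a : Apar k H) (u : Hᵐᵒᵖ) : inclT k H (a ⊗ₜ u) = Apar.incl k H a ⊗ₜ u := rfl

theorem rTensor_incl_injective (W : Type*) [AddCommGroup W] [Module k W] :
    Function.Injective ((Apar.incl k H).toLinearMap.rTensor W) :=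
  Module.Flat.rTensor_preserves_injective_linearMap _ Apar.incl_injective

/-- Flatness over a field. Identities in A_par ⊗ Hᵒᵖ may therefore be checked in H_par ⊗ Hᵒᵖ. -/
theorem inclT_injective : Function.Injective (inclT k H) := rTensor_incl_injective _

theorem inclT_opR : Conv.push (inclT k H) (opR k H _) = opR k H _ := by
  ext1; ext h
  change inclT k H (1 ⊗ₜ op h) = 1 ⊗ₜ op h
  rw [inclT_tmul, map_one]

theorem inclT_inL {C : Type*} [AddCommGroup C] [Module k C] [Coalgebra k C]
    (F : Conv k C (Apar k H)) :
    Conv.push (inclT k H) (inL H F) = inL H (Conv.push (Apar.incl k H) F) := by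
  ext1; ext h
  change inclT k H (F h ⊗ₜ 1) = _ ⊗ₜ 1
  rw [inclT_tmul, Conv.push_apply]

variable (hS : Function.Bijective (antipode k : H →ₗ[k] H))

theorem inclT_sInvR : Conv.push (inclT k H) (sInvR hS _) = sInvR hS _ := by
  ext1; ext h
  change inclT k H (1 ⊗ₜ op _) = 1 ⊗ₜ op _
  rw [inclT_tmul, map_one]

variable (k H) in
/-- `h ↦ ε_h`, with values in `A_par` -/
noncomputable def epAC : Conv k H (Apar k H) := toConv (epsA k H)

theorem incl_epAC : Conv.push (Apar.incl k H) (epAC k H) = epC k H := rfl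

theorem inclT_eps : Conv.push (inclT k H) (sInvR hS _ * inL H (epAC k H) * opR k H _) =
    Conv.push (Hpar.coact hS) (epC k H) := by
  rw [map_mul, map_mul, inclT_opR, inclT_inL, inclT_sInvR, incl_epAC, coact_epC]

/-- The preimage of a subalgebra under an algebra map is a subalgebra, so only the generators ε_h
have to be tested; `coact_epC` gives their image. -/
theorem coact_mem_range (a : Apar k H) :
    Hpar.coact hS (Apar.incl k H a) ∈ (inclT k H).range := by
  have h : AparSub k H ≤ (inclT k H).range.comap (Hpar.coact hS) := by
    refine Algebra.adjoin_le ?_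
    rintro _ ⟨x, rfl⟩
    exact ⟨_, LinearMap.congr_fun (congrArg WithConv.ofConv (inclT_eps hS)) x⟩
  exact h a.2

/-- The coaction of `H` on `A_par`, as a homomorphism to `A_par ⊗ Hᵒᵖ`. -/
noncomputable def coactA : Apar k H →ₐ[k] Apar k H ⊗[k] Hᵐᵒᵖ :=
  (AlgEquiv.ofInjective (inclT k H) inclT_injective).symm.toAlgHom.comp
    (((Hpar.coact hS).comp (Apar.incl k H)).codRestrict (inclT k H).range (coact_mem_range hS))

theorem inclT_coactA (a : Apar k H) :
    inclT k H (coactA hS a) = Hpar.coact hS (Apar.incl k H a) :=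
  congrArg Subtype.val ((AlgEquiv.ofInjective (inclT k H) inclT_injective).apply_symm_apply
    ⟨_, coact_mem_range hS a⟩)

theorem coactA_epAC : Conv.push (coactA hS) (epAC k H) =
    sInvR hS _ * inL H (epAC k H) * opR k H _ := by
  ext1; ext h
  refine inclT_injective ?_
  have := LinearMap.congr_fun (congrArg WithConv.ofConv (inclT_eps hS)) h
  exact (inclT_coactA hS _).trans this.symm

/-- The coaction of `H` on `A_par`. -/
noncomputable def rhoA : Apar k H →ₗ[k] Apar k H ⊗[k] H :=
  (opEquiv k H _).symm.toLinearMap ∘ₗ (coactA hS).toLinearMap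

theorem opEquiv_rhoA (a : Apar k H) : opEquiv k H _ (rhoA hS a) = coactA hS a :=
  (opEquiv k H _).apply_symm_apply _

theorem rhoA_isAparCoaction : IsAparCoaction hS (rhoA hS) where
  map_one := by
    apply (opEquiv k H _).injective
    rw [opEquiv_rhoA, map_one]; rfl
  map_eps h := by
    apply (opEquiv k H _).injective
    rw [opEquiv_rhoA]
    have := LinearMap.congr_fun (congrArg WithConv.ofConv (coactA_epAC hS)) h
    refine this.trans ?_
    rw [mul_assoc, (ℛ k h).convMul_apply, map_sum]
    refine Finset.sum_congr rfl fun i _ => ?_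
    rw [LinearMap.convMul_apply]
    generalize comul (R := k) ((ℛ k h).right i) = t
    induction t with
    | zero => simp
    | tmul x y => simp [sInvR_apply, inL_apply, opR_apply, opEquiv_tmul, epAC]
    | add x y hx hy => simp only [map_add, mul_add, hx, hy]
  map_mul a b := by
    apply (opEquiv k H _).injective
    rw [opEquiv_map₂, opEquiv_rhoA, opEquiv_rhoA, opEquiv_rhoA, map_mul]

end Apar

/-! ### Elements of the hom-object are left linear over the base algebra -/

section Linearity

variable {k : Type u} {H : Type v} [Field k] [Ring H] [HopfAlgebra k H]

/-- `h₍₁₎ • (S(h₍₂₎) • a) = ε_h a` -/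
theorem bullet_bullet_antipode (h : H) (a : Apar k H) :
    (toConv (bullet k H) * toConv (bullet k H ∘ₗ antipode k) :
      Conv k H (Module.End k (Apar k H))).ofConv h a = epsA k H h * a := by
  let L : Conv k H (Module.End k (Hpar k H)) := toConv (LinearMap.mul k _ ∘ₗ bracket k H)
  let L' : Conv k H (Module.End k (Hpar k H)) :=
    toConv (LinearMap.mul k _ ∘ₗ bracket k H ∘ₗ antipode k)
  let R' : Conv k H (Module.End k (Hpar k H)) :=
    toConv ((LinearMap.mul k _).flip ∘ₗ bracket k H ∘ₗ antipode k)
  let R'' : Conv k H (Module.End k (Hpar k H)) :=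
    toConv ((LinearMap.mul k _).flip ∘ₗ bracket k H ∘ₗ antipode k ∘ₗ antipode k)
  have e1 : toConv (conj k H) = L * R' := rfl
  have e2 : toConv (conj k H ∘ₗ antipode k) = R'' * L' := by
    ext1; ext1 h
    change conj k H (antipode k h) = _
    rw [LinearMap.convMul_apply, conj, LinearMap.comp_apply, LinearMap.comp_apply, comul_antipode]
    generalize comul (R := k) h = t
    induction t with
    | zero => simp
    | tmul x y =>
      ext z
      simp [L', R'', Module.End.mul_apply, mul_assoc]
    | add x y hx hy => simp only [map_add, hx, hy]
  -- This is [h₍₁₎]a[S(h₍₂₎)][h₍₃₎] = [h]a evaluated at S(h), that is, [S(h₍₃₎)]a[S²(h₍₂₎)][S(h₍₁₎)]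
  -- = [S(h)]a.
  have e3 (h : H) : (R' * (R'' * L')).ofConv h (Apar.incl k H a) =
      L'.ofConv h (Apar.incl k H a) := by
    have := (const_brC_brS (Apar.incl_mem a)).1
    have := LinearMap.congr_fun (congrArg WithConv.ofConv this) (antipode k h)
    rw [Conv.mul_const_apply] at this
    refine Eq.trans ?_ this
    rw [← e2, LinearMap.convMul_apply, LinearMap.convMul_apply, comul_antipode]
    generalize comul (R := k) h = t
    induction t with
    | zero => simp
    | tmul x y =>
      simp only [map_tmul, LinearMap.mul'_apply, comm_tmul]
      rw [← conj_apply]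
      rfl
    | add x y hx hy => simp only [map_add, LinearMap.add_apply, hx, hy]
  have e4 : (L * L').ofConv h (Apar.incl k H a) = epsOf (bracket k H) h * Apar.incl k H a := by
    rw [epsOf, LinearMap.comp_apply, LinearMap.comp_apply, LinearMap.convMul_apply]
    generalize comul (R := k) h = t
    induction t with
    | zero => simp
    | tmul x y => simp [L, L', mul_assoc, Module.End.mul_apply]
    | add x y hx hy => simp only [map_add, add_mul, LinearMap.add_apply, hx, hy]
  apply Apar.incl_injective
  rw [map_mul]
  refine Eq.trans ?_ e4
  have e5 : (toConv (conj k H) * toConv (conj k H ∘ₗ antipode k) :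
      Conv k H (Module.End k (Hpar k H))).ofConv h (Apar.incl k H a) =
      (L * L').ofConv h (Apar.incl k H a) := by
    rw [e1, e2, mul_assoc, LinearMap.convMul_apply, LinearMap.convMul_apply]
    generalize comul (R := k) h = t
    induction t with
    | zero => simp
    | tmul x y =>
      have := e3 y
      simp only [map_tmul, LinearMap.mul'_apply, Module.End.mul_apply] at this ⊢
      rw [this]
    | add x y hx hy => simp only [map_add, LinearMap.add_apply, hx, hy]
  rw [← e5, LinearMap.convMul_apply, LinearMap.convMul_apply]
  generalize comul (R := k) h = t
  induction t with
  | zero => simp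
  | tmul x y => rfl
  | add x y hx hy => simp only [map_add, LinearMap.add_apply, hx, hy]

/-- `h₍₁₎ • (S(h₍₂₎) • (a ⊗ x)) = ε_h a ⊗ x` -/
theorem diag_diag_antipode (h : H) :
    (toConv (diag (bullet k H) (LinearMap.mul k H)) *
      toConv (diag (bullet k H) (LinearMap.mul k H) ∘ₗ antipode k) :
      Conv k H (Module.End k (Apar k H ⊗[k] H))).ofConv h =
      (LinearMap.mulLeft k (epsA k H h)).rTensor H := by
  let B : Conv k H (Module.End k (Apar k H)) := toConv (bullet k H)
  let B' : Conv k H (Module.End k (Apar k H)) := toConv (bullet k H ∘ₗ antipode k)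
  let φ := Module.End.rTensorAlgHom k (Apar k H) H
  let ψ := (Module.End.lTensorAlgHom k H (Apar k H)).comp (Algebra.lmul k H)
  have e1 : toConv (diag (bullet k H) (LinearMap.mul k H)) =
      Conv.push φ B * Conv.push ψ (toConv LinearMap.id) := by
    ext1; ext1 h
    change diag (bullet k H) (LinearMap.mul k H) h = _
    rw [LinearMap.convMul_apply, diag, LinearMap.comp_apply]
    generalize comul (R := k) h = t
    induction t with
    | zero => simp
    | tmul x y => exact TensorProduct.ext' fun a z => rfl
    | add x y hx hy => simp only [map_add, hx, hy]
  have e2 : toConv (diag (bullet k H) (LinearMap.mul k H) ∘ₗ antipode k) =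
      Conv.push ψ (toConv (antipode k)) * Conv.push φ B' := by
    ext1; ext1 h
    change diag (bullet k H) (LinearMap.mul k H) (antipode k h) = _
    rw [LinearMap.convMul_apply, diag, LinearMap.comp_apply, comul_antipode]
    generalize comul (R := k) h = t
    induction t with
    | zero => simp
    | tmul x y => exact TensorProduct.ext' fun a z => rfl
    | add x y hx hy => simp only [map_add, hx, hy]
  -- On the factor H the actions of h₍₂₎ and S(h₍₃₎) are adjacent and cancel, which leaves the
  -- previous statement on A_par.
  rw [e1, e2, mul_assoc, ← mul_assoc (Conv.push ψ _), ← map_mul, LinearMap.id_mul_antipode,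
    map_one, one_mul, ← map_mul]
  change φ ((B * B').ofConv h) = _
  have : (B * B').ofConv h = LinearMap.mulLeft k (epsA k H h) :=
    LinearMap.ext fun a => bullet_bullet_antipode h a
  rw [this]
  rfl

/-- Multiplication by ε_h on A_par ⊗ H and on A_par is the same combination of two partial actions,
with each of which f commutes. -/
theorem Brace.incl_eps_mul (f : BraceA k H) (h : H) (a : Apar k H) (x : H) :
    Brace.incl _ _ f ((epsA k H h * a) ⊗ₜ x) = epsA k H h * Brace.incl _ _ f (a ⊗ₜ x) := by
  have := LinearMap.congr_fun (diag_diag_antipode h) (a ⊗ₜ x)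
  rw [LinearMap.rTensor_tmul, LinearMap.mulLeft_apply] at this
  rw [← this, ← bullet_bullet_antipode, LinearMap.convMul_apply, LinearMap.convMul_apply]
  generalize comul (R := k) h = t
  induction t with
  | zero => simp
  | tmul x y =>
    simp only [map_tmul, LinearMap.mul'_apply, Module.End.mul_apply, LinearMap.comp_apply]
    rw [Brace.equivariant, Brace.equivariant]
  | add x y hx hy => simp only [map_add, LinearMap.add_apply, hx, hy]

theorem Apar.induction {p : Apar k H → Prop} (eps : ∀ h, p (epsA k H h))
    (algebraMap : ∀ r, p (algebraMap k (Apar k H) r)) (add : ∀ a b, p a → p b → p (a + b))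
    (mul : ∀ a b, p a → p b → p (a * b)) (a : Apar k H) : p a := by
  suffices h : ∀ (a : Hpar k H) (ha : a ∈ AparSub k H), p (⟨a, ha⟩ : AparSub k H) from h a.1 a.2
  intro a ha
  induction ha using Algebra.adjoin_induction with
  | mem a ha =>
    obtain ⟨h, rfl⟩ := ha
    exact eps h
  | algebraMap r => exact algebraMap r
  | add a c ha hc iha ihc => exact add _ _ iha ihc
  | mul a c ha hc iha ihc => exact mul _ _ iha ihc

theorem Brace.incl_mul (f : BraceA k H) (a b : Apar k H) (x : H) :
    Brace.incl _ _ f ((a * b) ⊗ₜ x) = a * Brace.incl _ _ f (b ⊗ₜ x) := by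
  induction a using Apar.induction generalizing b with
  | eps h => exact Brace.incl_eps_mul f h b x
  | algebraMap r => simp [Algebra.algebraMap_eq_smul_one, ← smul_tmul']
  | add a c iha ihc => rw [add_mul, add_tmul, map_add, iha, ihc, add_mul]
  | mul a c iha ihc => rw [mul_assoc, iha, ihc, mul_assoc]

theorem Brace.incl_eq_mul_evalA (f : BraceA k H) (a : Apar k H) (x : H) :
    Brace.incl _ _ f (a ⊗ₜ x) = a * evalA x f := by
  have := Brace.incl_mul f a 1 x
  rwa [mul_one] at this

/-- By left linearity f(a ⊗ x) = a f(1 ⊗ x), so the values on 1 ⊗ H determine f. -/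
theorem evalA_injective {f g : BraceA k H} (h : ∀ x, evalA x f = evalA x g) : f = g :=
  Brace.ext <| TensorProduct.ext' fun a x => by
    rw [Brace.incl_eq_mul_evalA, Brace.incl_eq_mul_evalA, h]

end Linearity

/-! ### The hom-object as equivariant functions under convolution -/

section BraceEval

variable {k : Type u} {H : Type v} [Field k] [Ring H] [HopfAlgebra k H]

open MulOpposite

/-- The pullback along the multiplication of `H`. -/
noncomputable abbrev pullMul {R : Type*} [Ring R] [Algebra k R] :
    Conv k H R →+* Conv k (H ⊗[k] H) R :=
  Conv.pull (Bialgebra.mulCoalgHom k H)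

theorem pullMul_tmul {R : Type*} [Ring R] [Algebra k R] (F : Conv k H R) (x y : H) :
    pullMul F (x ⊗ₜ y) = F (x * y) := rfl

/-- Functions `φ : H → H_par` with `ε_{h₍₁₎} φ(h₍₂₎ x) = [h₍₁₎] φ(x) [S(h₍₂₎)]`. -/
def IsEquivariant (φ : Conv k H (Hpar k H)) : Prop :=
  leg₁ (epC k H) * pullMul φ = leg₁ (brC k H) * leg₂ φ * leg₁ (brS k H)

/-- The function `x ↦ f(1 ⊗ x)` -/
noncomputable def evH (f : BraceA k H) : Conv k H (Hpar k H) :=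
  toConv ((Apar.incl k H).toLinearMap ∘ₗ Brace.incl _ _ f ∘ₗ TensorProduct.mk k _ H 1)

theorem evH_apply (f : BraceA k H) (x : H) : evH f x = Apar.incl k H (evalA x f) := rfl

theorem evH_injective : Function.Injective (evH (k := k) (H := H)) := fun _ _ h =>
  evalA_injective fun x =>
    Apar.incl_injective (LinearMap.congr_fun (congrArg WithConv.ofConv h) x)

theorem evH_mem (f : BraceA k H) (x : H) : evH f x ∈ AparSub k H := Apar.incl_mem _

theorem bullet_one (h : H) : bullet k H h 1 = epsA k H h := by
  apply Apar.incl_injective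
  rw [incl_bullet, map_one, map_one, mul_one]
  rfl

/-- The defining property of f at 1 ⊗ x, using h • 1 = ε_h and left linearity. -/
theorem evH_isEquivariant (f : BraceA k H) : IsEquivariant (evH f) := by
  refine Conv.ext₂ fun h x => ?_
  have e := congrArg (Apar.incl k H) (f.equivariant h (1 ⊗ₜ x))
  rw [incl_bullet] at e
  rw [← Conv.at₂_apply, ← Conv.at₂_apply, mul_leg₁_at₂, leg₁_mul_at₂, leg₁_mul_at₂, leg₂_at₂]
  refine Eq.trans ?_ e
  rw [LinearMap.convMul_apply, diag, LinearMap.comp_apply]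
  generalize comul (R := k) h = t
  induction t with
  | zero => simp
  | tmul y z =>
    simp only [map_tmul, LinearMap.mul'_apply, map₂_apply_tmul, LinearMap.mul_apply', bullet_one]
    rw [Brace.incl_eq_mul_evalA, map_mul]
    rfl
  | add x y hx hy => simp only [map_add, LinearMap.add_apply, hx, hy]

/-- The element of `{A_par, A_par}` with given restriction to `1 ⊗ H`. -/
noncomputable def Brace.ofEquivariant (φ : Conv k H (Apar k H))
    (hφ : IsEquivariant (Conv.push (Apar.incl k H) φ)) : BraceA k H :=
  ⟨LinearMap.mul' k (Apar k H) ∘ₗ φ.ofConv.lTensor (Apar k H), fun h z => by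
    induction z with
    | zero => simp
    | add x y hx hy => simp only [map_add, hx, hy]
    | tmul a x =>
      apply Apar.incl_injective
      rw [incl_bullet]
      let c : Conv k (H ⊗[k] H) (Hpar k H) := Conv.const (Apar.incl k H a)
      let φ' := Conv.push (Apar.incl k H) φ
      have hc : c = leg₁ (Conv.const (Apar.incl k H a)) := (Conv.pull_const _ _).symm
      -- Insert ε through [S(h)] = [S(h₍₁₎)]ε_{h₍₂₎}, apply the equivariance of φ, and collapse
      -- [h₍₁₎]a[S(h₍₂₎)][h₍₃₎] to [h]a. The last step needs a in A_par.
      have key : leg₁ (brC k H) * c * leg₁ (brS k H) * pullMul φ' =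
          leg₁ (brC k H) * c * leg₂ φ' * leg₁ (brS k H) := by
        have e1 : leg₁ (D := H) (brS k H) = leg₁ (brS k H) * leg₁ (epC k H) := by
          rw [← map_mul, brS_mul_epC]
        have e2 : leg₁ (D := H) (brC k H) * c * leg₁ (brS k H) * leg₁ (brC k H) =
            leg₁ (brC k H) * c := by
          rw [hc, ← map_mul, ← map_mul, ← map_mul, (const_brC_brS (Apar.incl_mem a)).1]
        calc _ = leg₁ (brC k H) * c * leg₁ (brS k H) * (leg₁ (epC k H) * pullMul φ') := by
              conv_lhs => rw [e1]
              simp only [mul_assoc]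
          _ = leg₁ (brC k H) * c * leg₁ (brS k H) * leg₁ (brC k H) * leg₂ φ' *
              leg₁ (brS k H) := by rw [hφ]; simp only [mul_assoc]; rfl
          _ = _ := by rw [e2]
      have key' := congrArg (fun F => (Conv.at₂ F x).ofConv h) key
      simp only [mul_assoc, mul_leg₁_at₂, leg₁_mul_at₂, hc] at key'
      rw [leg₂_at₂] at key'
      have e3 : Apar.incl k H ((LinearMap.mul' k (Apar k H) ∘ₗ φ.ofConv.lTensor (Apar k H))
          (a ⊗ₜ[k] x)) = Apar.incl k H a * φ' x := by simp [φ', Conv.push_apply]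
      rw [e3, map_mul]
      simp only [mul_assoc]
      refine Eq.trans ?_ key'
      rw [← mul_assoc (Conv.const _), ← mul_assoc (brC k H), ← mul_assoc (brC k H),
        LinearMap.convMul_apply]
      simp only [diag, LinearMap.comp_apply]
      generalize comul (R := k) h = t
      induction t with
      | zero => simp
      | tmul y z =>
        simp only [map_tmul, LinearMap.mul'_apply, map₂_apply_tmul, LinearMap.mul_apply',
          LinearMap.lTensor_tmul, map_mul, incl_bullet]
        rfl
      | add x y hx hy => simp only [map_add, LinearMap.add_apply, hx, hy]⟩

theorem Brace.evalA_ofEquivariant (φ : Conv k H (Apar k H))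
    (hφ : IsEquivariant (Conv.push (Apar.incl k H) φ)) (x : H) :
    evalA x (Brace.ofEquivariant φ hφ) = φ x := by
  change (1 : Apar k H) * φ x = _
  rw [one_mul]

/-- g(f(1 ⊗ x₍₁₎) ⊗ x₍₂₎) = f(x₍₁₎)g(x₍₂₎) by left linearity of g. -/
theorem evH_mul (f g : BraceA k H) : evH (f * g) = evH f * evH g := by
  ext1; ext x
  rw [LinearMap.convMul_apply, evH_apply]
  change Apar.incl k H (Brace.incl _ _ (f * g) (1 ⊗ₜ x)) = _
  rw [Brace.mul_def, Brace.incl_comp, LinearMap.comp_apply, hat_tmul]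
  generalize comul (R := k) x = t
  induction t with
  | zero => simp
  | tmul y z =>
    simp only [map_tmul, LinearMap.mul'_apply, LinearMap.comp_apply, LinearMap.id_apply]
    rw [Brace.incl_eq_mul_evalA, map_mul]
    rfl
  | add x y hx hy => simp only [map_add, hx, hy]

theorem evH_one : evH (1 : BraceA k H) = 1 := by
  ext1; ext x
  change Apar.incl k H (Brace.incl _ _ (1 : BraceA k H) (1 ⊗ₜ x)) = _
  rw [Brace.one_def, Brace.incl_id]
  simp [Algebra.algebraMap_eq_smul_one]

theorem evH_act (l : H) (f : BraceA k H) : evH (actA k H l f) = Conv.at₂ (pullMul (evH f)) l := rfl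

/-- `[S(h₍₁₎)] φ(h₍₂₎ x) = φ(x) [S(h)]` -/
theorem brS_mul_evH (f : BraceA k H) :
    leg₁ (brS k H) * pullMul (evH f) = leg₂ (evH f) * leg₁ (brS k H) := by
  have e1 : leg₁ (D := H) (brS k H) = leg₁ (brS k H) * leg₁ (epC k H) := by
    rw [← map_mul, brS_mul_epC]
  -- As in `Brace.ofEquivariant`, insert ε and use equivariance; then [S(h₍₁₎)][h₍₂₎]a[S(h₍₃₎)] =
  -- a[S(h)] with a = f(1 ⊗ x), which lies in A_par.
  calc _ = leg₁ (brS k H) * (leg₁ (epC k H) * pullMul (evH f)) := by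
        conv_lhs => rw [e1]
        simp only [mul_assoc]
    _ = leg₁ (brS k H) * (leg₁ (brC k H) * (leg₂ (evH f) * leg₁ (brS k H))) := by
        rw [evH_isEquivariant f, mul_assoc]
    _ = _ := by
        refine Conv.ext_at₂ fun x => ?_
        simp only [mul_leg₁_at₂, leg₁_mul_at₂]
        rw [leg₂_at₂]
        have := (const_brC_brS (evH_mem f x)).2
        simpa only [mul_assoc] using this

end BraceEval

/-! ### The coaction on the hom-object -/

section BraceCoaction

variable {k : Type u} {H : Type v} [Field k] [Ring H] [HopfAlgebra k H]

open MulOpposite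

variable (hS : Function.Bijective (antipode k : H →ₗ[k] H))

/-- The function `x ↦ f(x₍₂₎)⁽⁰⁾ ⊗ S⁻¹(x₍₃₎) f(x₍₂₎)⁽¹⁾ x₍₁₎`, with values in `H_par ⊗ Hᵒᵖ`. -/
noncomputable def coactH (φ : Conv k H (Hpar k H)) : Conv k H (Hpar k H ⊗[k] Hᵐᵒᵖ) :=
  opR k H _ * Conv.push (Hpar.coact hS) φ * sInvR hS _

/-- The operation is conjugation by the invertible element ι(h) = 1 ⊗ h, applied after an algebra
map. -/
theorem coactH_mul (φ ψ : Conv k H (Hpar k H)) : coactH hS (φ * ψ) = coactH hS φ * coactH hS ψ := by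
  rw [coactH, coactH, coactH, map_mul]
  simp only [mul_assoc]
  rw [← mul_assoc (sInvR hS _), sInvR_mul_opR, one_mul]

theorem coactH_one : coactH hS (1 : Conv k H (Hpar k H)) = 1 := by
  rw [coactH, map_one, mul_one, opR_mul_sInvR]

theorem pullMul_coactH (φ : Conv k H (Hpar k H)) :
    pullMul (coactH hS φ) = leg₂ (opR k H _) * (leg₁ (opR k H _) *
      pullMul (Conv.push (Hpar.coact hS) φ) * leg₁ (sInvR hS _)) * leg₂ (sInvR hS _) := by
  rw [coactH, map_mul, map_mul, pull_mul_opR, pull_mul_sInvR]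
  simp only [mul_assoc]

/-- Apply the coaction to the equivariance of φ. The factors S⁻¹(h) and h appearing at the outer
ends are removed by conjugating in the first variable; this conjugation is the first-variable part
of ι(hx)(·)ι(hx)⁻¹. The remaining part, in x alone, commutes with everything bracket-valued in h. -/
theorem coactH_equivariant {φ : Conv k H (Hpar k H)} (hφ : IsEquivariant φ) :
    leg₁ (inL H (epC k H)) * pullMul (coactH hS φ) =
      leg₁ (inL H (brC k H)) * leg₂ (coactH hS φ) * leg₁ (inL H (brS k H)) := by
  have h1 := congrArg (Conv.push (Hpar.coact hS)) hφ
  simp only [map_mul, Conv.push_pull, coact_epC, coact_brC, coact_brS] at h1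
  have ce := (leg_commute (inL H (epC k H)) (opR k H _) (inL_commute_opR _)).eq
  have cb := (leg_commute (inL H (brC k H)) (opR k H _) (inL_commute_opR _)).eq
  have cs := (leg_commute (inL H (brS k H)) (sInvR hS _) (inL_commute_sInvR hS _)).eq
  have u1 : leg₁ (D := H) (sInvR hS (Hpar k H)) * leg₁ (opR k H (Hpar k H)) = 1 := by
    rw [← map_mul, sInvR_mul_opR, map_one]
  have u2 : leg₁ (D := H) (opR k H (Hpar k H)) * leg₁ (sInvR hS (Hpar k H)) = 1 := by
    rw [← map_mul, opR_mul_sInvR, map_one]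
  have h2 : leg₁ (inL H (epC k H)) * (leg₁ (opR k H _) *
      pullMul (Conv.push (Hpar.coact hS) φ) * leg₁ (sInvR hS _)) =
      leg₁ (inL H (brC k H)) * leg₂ (Conv.push (Hpar.coact hS) φ) * leg₁ (inL H (brS k H)) := by
    have := congrArg (fun F => leg₁ (opR k H _) * F * leg₁ (sInvR hS _)) h1
    simp only [mul_assoc] at this ⊢
    rw [u2, mul_one, ← mul_assoc (leg₁ (opR k H _)) (leg₁ (sInvR hS _)), u2, one_mul,
      ← mul_assoc (leg₁ (opR k H _)) (leg₁ (sInvR hS _)), u2, one_mul] at this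
    exact this
  rw [pullMul_coactH, ← mul_assoc, ← mul_assoc, ce, mul_assoc (leg₂ _), h2, coactH]
  simp only [map_mul, ← mul_assoc]
  rw [← cb]
  simp only [mul_assoc]
  rw [cs]

/-- Applying a linear form to the second factor. -/
noncomputable def slice (R : Type*) [Ring R] [Algebra k R] (lam : Module.Dual k Hᵐᵒᵖ) :
    R ⊗[k] Hᵐᵒᵖ →ₗ[k] R :=
  (TensorProduct.rid k R).toLinearMap ∘ₗ lam.lTensor R

theorem slice_tmul {R : Type*} [Ring R] [Algebra k R] (lam : Module.Dual k Hᵐᵒᵖ) (a : R)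
    (u : Hᵐᵒᵖ) : slice R lam (a ⊗ₜ u) = lam u • a := by simp [slice]

theorem slice_mul_left {R : Type*} [Ring R] [Algebra k R] (lam : Module.Dual k Hᵐᵒᵖ) (a : R)
    (z : R ⊗[k] Hᵐᵒᵖ) : slice R lam ((a ⊗ₜ 1) * z) = a * slice R lam z := by
  induction z with
  | zero => simp
  | tmul b u => simp [slice_tmul]
  | add x y hx hy => simp only [map_add, mul_add, hx, hy]

theorem slice_mul_right {R : Type*} [Ring R] [Algebra k R] (lam : Module.Dual k Hᵐᵒᵖ) (a : R)
    (z : R ⊗[k] Hᵐᵒᵖ) : slice R lam (z * (a ⊗ₜ 1)) = slice R lam z * a := by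
  induction z with
  | zero => simp
  | tmul b u => simp [slice_tmul]
  | add x y hx hy => simp only [map_add, add_mul, hx, hy]

theorem slice_conv_left {C R : Type*} [AddCommGroup C] [Module k C] [Coalgebra k C] [Ring R]
    [Algebra k R] (lam : Module.Dual k Hᵐᵒᵖ) (F : Conv k C R) (G : Conv k C (R ⊗[k] Hᵐᵒᵖ)) :
    toConv (slice R lam ∘ₗ (inL H F * G).ofConv) = F * toConv (slice R lam ∘ₗ G.ofConv) := by
  ext1; ext1 c
  exact Conv.apply_congr (slice R lam) LinearMap.id
    (fun x y => by simp [inL_apply, slice_mul_left]) c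

theorem slice_conv_right {C R : Type*} [AddCommGroup C] [Module k C] [Coalgebra k C] [Ring R]
    [Algebra k R] (lam : Module.Dual k Hᵐᵒᵖ) (F : Conv k C R) (G : Conv k C (R ⊗[k] Hᵐᵒᵖ)) :
    toConv (slice R lam ∘ₗ (G * inL H F).ofConv) = toConv (slice R lam ∘ₗ G.ofConv) * F := by
  ext1; ext1 c
  exact Conv.apply_congr (slice R lam) LinearMap.id
    (fun x y => by simp [inL_apply, slice_mul_right]) c

/-- A linear form on the Hᵒᵖ factor commutes with multiplication by elements of H_par ⊗ 1, so every
coefficient of the twisted function is again equivariant and defines an element of {A_par, A_par}.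
-/
theorem isEquivariant_slice {φ : Conv k H (Hpar k H)} (hφ : IsEquivariant φ)
    (lam : Module.Dual k Hᵐᵒᵖ) :
    IsEquivariant (toConv (slice (Hpar k H) lam ∘ₗ (coactH hS φ).ofConv)) := by
  have := congrArg (fun F => toConv (slice (Hpar k H) lam ∘ₗ F.ofConv)) (coactH_equivariant hS hφ)
  simp only [← Conv.push_pull] at this
  rw [slice_conv_left, slice_conv_right, slice_conv_left] at this
  exact this

/-- The function `x ↦ f(1 ⊗ x)` -/
noncomputable def evC (f : BraceA k H) : Conv k H (Apar k H) :=
  toConv (Brace.incl _ _ f ∘ₗ TensorProduct.mk k _ H 1)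

/-- The function `x ↦ f(x₍₂₎)⁽⁰⁾ ⊗ S⁻¹(x₍₃₎) f(x₍₂₎)⁽¹⁾ x₍₁₎`, with values in `A_par ⊗ Hᵒᵖ`. -/
noncomputable def coactC (f : BraceA k H) : Conv k H (Apar k H ⊗[k] Hᵐᵒᵖ) :=
  opR k H _ * Conv.push (coactA hS) (evC f) * sInvR hS _

theorem inclT_coactC (f : BraceA k H) : Conv.push (inclT k H) (coactC hS f) = coactH hS (evH f) := by
  rw [coactC, map_mul, map_mul, inclT_opR, inclT_sInvR, coactH]
  congr 2
  ext1; ext x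
  exact inclT_coactA hS _

theorem slice_inclT (lam : Module.Dual k Hᵐᵒᵖ) (z : Apar k H ⊗[k] Hᵐᵒᵖ) :
    slice _ lam (inclT k H z) = Apar.incl k H (slice _ lam z) := by
  induction z with
  | zero => simp
  | tmul b u => simp [slice_tmul, inclT_tmul]
  | add x y hx hy => simp only [map_add, hx, hy]

theorem isEquivariant_slice_coactC (f : BraceA k H) (lam : Module.Dual k Hᵐᵒᵖ) :
    IsEquivariant (Conv.push (Apar.incl k H)
      (toConv (slice (Apar k H) lam ∘ₗ (coactC hS f).ofConv))) := by
  convert isEquivariant_slice hS (evH_isEquivariant f) lam using 1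
  rw [← inclT_coactC]
  ext1; ext x
  exact (slice_inclT lam _).symm

theorem coactC_add (f g : BraceA k H) : coactC hS (f + g) = coactC hS f + coactC hS g := by
  have : evC (f + g) = evC f + evC g := by
    ext1; ext x; simp [evC]
  simp only [coactC, this, map_add, mul_add, add_mul]

theorem coactC_smul (r : k) (f : BraceA k H) : coactC hS (r • f) = r • coactC hS f := by
  have : Conv.push (coactA hS) (evC (r • f)) = r • Conv.push (coactA hS) (evC f) := by
    ext1; ext x; simp [evC, Conv.push]
  simp only [coactC, this, mul_smul_comm, smul_mul_assoc]

/-- The component of the coaction on `{A_par, A_par}` given by a linear form on `H`. -/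
noncomputable def coactSlice (lam : Module.Dual k Hᵐᵒᵖ) : BraceA k H →ₗ[k] BraceA k H where
  toFun f := Brace.ofEquivariant _ (isEquivariant_slice_coactC hS f lam)
  map_add' f g := evalA_injective fun x => by
    simp only [map_add, Brace.evalA_ofEquivariant, coactC_add, ofConv_add, LinearMap.add_apply,
      LinearMap.comp_apply]
  map_smul' r f := evalA_injective fun x => by
    simp only [map_smul, Brace.evalA_ofEquivariant, coactC_smul, ofConv_smul, LinearMap.smul_apply,
      LinearMap.comp_apply, RingHom.id_apply]

theorem evalA_coactSlice (lam : Module.Dual k Hᵐᵒᵖ) (f : BraceA k H) (x : H) :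
    evalA x (coactSlice hS lam f) = slice _ lam ((coactC hS f).ofConv x) :=
  Brace.evalA_ofEquivariant _ (isEquivariant_slice_coactC hS f lam) x

variable [FiniteDimensional k H]

/-- The coaction of `H` on `{A_par, A_par}`. -/
noncomputable def rhoB : BraceA k H →ₗ[k] BraceA k H ⊗[k] H :=
  ∑ i, (TensorProduct.mk k _ H).flip (Module.finBasis k H i) ∘ₗ
    coactSlice hS ((Module.finBasis k H).coord i ∘ₗ (opLinearEquiv k).symm.toLinearMap)

/-- Summing the coordinate slices against a finite basis of H reconstructs the function from its
coefficients. -/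
theorem opEquiv_evalA_rhoB (f : BraceA k H) (x : H) :
    opEquiv k H _ ((evalA x).rTensor H (rhoB hS f)) = coactC hS f x := by
  simp only [rhoB, LinearMap.sum_apply, map_sum, LinearMap.comp_apply, LinearMap.flip_apply,
    mk_apply, LinearMap.rTensor_tmul, evalA_coactSlice]
  generalize (coactC hS f).ofConv x = z
  induction z with
  | zero => simp
  | add x y hx hy =>
    simp only [map_add, add_tmul, Finset.sum_add_distrib]
    rw [hx, hy]
  | tmul a u =>
    simp only [slice_tmul, opEquiv_tmul, LinearMap.comp_apply, smul_tmul, ← tmul_sum]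
    congr 1
    conv_rhs => rw [← op_unop u, ← (Module.finBasis k H).sum_repr (unop u)]
    simp

end BraceCoaction

/-! ### Yetter–Drinfeld structure and braided commutativity -/

section BraceYetterDrinfeld

variable {k : Type u} {H : Type v} [Field k] [Ring H] [HopfAlgebra k H]

open MulOpposite

/-- Evaluations separate the points of `{A_par, A_par} ⊗ W`. -/
theorem evalA_rTensor_injective {W : Type*} [AddCommGroup W] [Module k W] {z w : BraceA k H ⊗[k] W}
    (h : ∀ x, (evalA x).rTensor W z = (evalA x).rTensor W w) : z = w := by
  classical
  -- Coordinates with respect to a basis of W commute with evaluation, reducing the claim to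
  -- injectivity on each coefficient.
  let b := Module.Basis.ofVectorSpace k W
  apply (TensorProduct.equivFinsuppOfBasisRight b).injective
  ext i
  refine evalA_injective fun x => ?_
  have key (z : BraceA k H ⊗[k] W) : evalA x (TensorProduct.equivFinsuppOfBasisRight b z i) =
      TensorProduct.equivFinsuppOfBasisRight b ((evalA x).rTensor W z) i := by
    induction z with
    | zero => simp
    | tmul f w => simp
    | add x y hx hy => simp only [map_add, Finsupp.add_apply, hx, hy]
  rw [key, key, h]

/-- The function `x ↦ f(x) ⊗ u` for `f ⊗ u` in `{A_par, A_par} ⊗ H`. -/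
noncomputable def evZ (z : BraceA k H ⊗[k] H) : Conv k H (Hpar k H ⊗[k] Hᵐᵒᵖ) :=
  toConv ((TensorProduct.lift (LinearMap.mk₂ k
    (fun f u => (TensorProduct.mk k (Hpar k H) Hᵐᵒᵖ).flip (op u) ∘ₗ (evH f).ofConv)
    (fun f g u => by ext x; simp [evH]) (fun r f u => by ext x; simp [evH, smul_tmul'])
    (fun f u v => by ext x; simp) (fun r f u => by ext x; simp))) z)

theorem evZ_tmul (f : BraceA k H) (u x : H) : evZ (f ⊗ₜ u) x = evH f x ⊗ₜ op u := rfl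

theorem evZ_add (z w : BraceA k H ⊗[k] H) : evZ (z + w) = evZ z + evZ w := by simp [evZ]

theorem evZ_zero : evZ (0 : BraceA k H ⊗[k] H) = 0 := by simp [evZ]

theorem evZ_sum_apply {ι : Type*} (s : Finset ι) (g : ι → BraceA k H ⊗[k] H) (x : H) :
    evZ (∑ i ∈ s, g i) x = ∑ i ∈ s, evZ (g i) x := by
  classical
  induction s using Finset.induction_on with
  | empty => simp [evZ_zero]
  | insert a s ha ih =>
    rw [Finset.sum_insert ha, Finset.sum_insert ha, evZ_add, ofConv_add, LinearMap.add_apply, ih]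

theorem evZ_apply (z : BraceA k H ⊗[k] H) (x : H) :
    evZ z x = inclT k H (opEquiv k H _ ((evalA x).rTensor H z)) := by
  induction z with
  | zero => simp [evZ_zero]
  | tmul f u => rfl
  | add x y hx hy => simp only [map_add, evZ_add, ofConv_add, LinearMap.add_apply, hx, hy]

theorem evZ_injective : Function.Injective (evZ (k := k) (H := H)) := fun z w h =>
  evalA_rTensor_injective fun x => by
    have := LinearMap.congr_fun (congrArg WithConv.ofConv h) x
    rw [evZ_apply, evZ_apply] at this
    exact (opEquiv k H _).injective (inclT_injective this)

theorem evZ_mul (z w : BraceA k H ⊗[k] H) :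
    evZ (TensorProduct.map₂ (LinearMap.mul k (BraceA k H)) (LinearMap.mul k H).flip z w) =
      evZ z * evZ w := by
  induction z with
  | zero => simp [evZ_zero]
  | add x y hx hy => simp only [map_add, LinearMap.add_apply, evZ_add, hx, hy, add_mul]
  | tmul f u =>
    induction w with
    | zero => simp [evZ_zero]
    | add x y hx hy => simp only [map_add, evZ_add, hx, hy, mul_add]
    | tmul g v =>
      ext1; ext1 x
      rw [map₂_apply_tmul, map_tmul, LinearMap.mul_apply', LinearMap.flip_apply, LinearMap.mul_apply',
        evZ_tmul, evH_mul, LinearMap.convMul_apply, LinearMap.convMul_apply]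
      generalize comul (R := k) x = t
      induction t with
      | zero => simp
      | tmul y z => simp [evZ_tmul]
      | add x y hx hy => simp only [map_add, add_tmul, hx, hy]

theorem evZ_one : evZ ((1 : BraceA k H) ⊗ₜ (1 : H)) = 1 := by
  ext1; ext1 x
  rw [evZ_tmul, evH_one, LinearMap.convOne_apply, LinearMap.convOne_apply]
  simp [Algebra.algebraMap_eq_smul_one, Algebra.TensorProduct.one_def, smul_tmul']

theorem evH_counit (z : BraceA k H ⊗[k] H) :
    evH (TensorProduct.rid k _ (counit.lTensor _ z)) = Conv.push (counitR _) (evZ z) := by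
  ext1; ext1 x
  rw [Conv.push_apply, evH_apply]
  induction z with
  | zero => simp [evZ_zero]
  | tmul f u => rw [evZ_tmul, counitR_tmul]; simp [evH_apply]
  | add x y hx hy => simp only [map_add, evZ_add, ofConv_add, LinearMap.add_apply, hx, hy]

variable (hS : Function.Bijective (antipode k : H →ₗ[k] H))

theorem evZ_lTensor_mulRight (c : H) (z : BraceA k H ⊗[k] H) (x : H) :
    evZ ((LinearMap.mulRight k c).lTensor _ z) x = (1 ⊗ₜ op c) * evZ z x := by
  induction z with
  | zero => simp [evZ_zero]
  | tmul f u => simp [evZ_tmul]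
  | add x y hx hy => simp only [map_add, evZ_add, ofConv_add, LinearMap.add_apply, hx, hy, mul_add]

theorem evZ_diag (l : H) (z : BraceA k H ⊗[k] H) (x : H) :
    evZ (diag (actA k H).toLinearMap (LinearMap.mul k H) l z) x =
      (pullMul (evZ z) * leg₂ (opR k H _) : Conv k (H ⊗[k] H) _).ofConv (x ⊗ₜ l) := by
  rw [← Conv.at₁_apply, mul_leg₂_at₁, LinearMap.convMul_apply, diag, LinearMap.comp_apply]
  generalize comul (R := k) l = t
  induction t with
  | zero => simp [evZ_zero]
  | add x y hx hy => simp only [map_add, evZ_add, ofConv_add, LinearMap.add_apply, hx, hy]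
  | tmul p q =>
    simp only [map₂_apply_tmul, map_tmul, LinearMap.mul'_apply, Conv.at₁_apply, pullMul_tmul]
    induction z with
    | zero => simp [evZ_zero]
    | tmul f u =>
      simp only [map_tmul, evZ_tmul, opR_apply, LinearMap.mul_apply', op_mul,
        Algebra.TensorProduct.tmul_mul_tmul, mul_one]
      rfl
    | add x y hx hy => simp only [map_add, evZ_add, ofConv_add, LinearMap.add_apply, hx, hy, add_mul]

/-- Evaluation of elements of `{A_par, A_par} ⊗ H ⊗ H`. -/
noncomputable def incl₃ : Apar k H ⊗[k] (H ⊗[k] H) →ₗ[k] (Hpar k H ⊗[k] Hᵐᵒᵖ) ⊗[k] Hᵐᵒᵖ :=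
  TensorProduct.map ((inclT k H).toLinearMap ∘ₗ (opEquiv k H _).toLinearMap)
    (opLinearEquiv k).toLinearMap ∘ₗ (TensorProduct.assoc k _ _ _).symm.toLinearMap

theorem incl₃_injective : Function.Injective (incl₃ (k := k) (H := H)) := by
  -- Up to reassociation this is the inclusion of A_par tensored with H ⊗ H, hence injective by
  -- flatness.
  have e : incl₃ (k := k) (H := H) =
      (TensorProduct.assoc k (Hpar k H) Hᵐᵒᵖ Hᵐᵒᵖ).symm.toLinearMap ∘ₗ
        (TensorProduct.map (opLinearEquiv k (M := H)).toLinearMap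
          (opLinearEquiv k (M := H)).toLinearMap).lTensor (Hpar k H) ∘ₗ
        (Apar.incl k H).toLinearMap.rTensor (H ⊗[k] H) := by
    ext a x y
    rfl
  rw [e]
  have h1 : Function.Injective ((TensorProduct.map (opLinearEquiv k (M := H)).toLinearMap
      (opLinearEquiv k (M := H)).toLinearMap).lTensor (Hpar k H)) :=
    ((TensorProduct.congr (opLinearEquiv k (M := H)) (opLinearEquiv k (M := H))).lTensor
      (Hpar k H)).injective
  exact (TensorProduct.assoc k _ _ _).symm.injective.comp (h1.comp (rTensor_incl_injective _))

theorem comulR_evZ (z : BraceA k H ⊗[k] H) (x : H) :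
    comulR (Hpar k H) (evZ z x) = incl₃ ((evalA x).rTensor _ (comul.lTensor _ z)) := by
  induction z with
  | zero => simp [evZ_zero]
  | add x y hx hy => simp only [map_add, evZ_add, ofConv_add, LinearMap.add_apply, hx, hy]
  | tmul f u =>
    rw [evZ_tmul, LinearMap.lTensor_tmul, comulR, AlgHom.comp_apply,
      Algebra.TensorProduct.map_tmul, comulOp_op]
    generalize comul (R := k) u = t
    induction t with
    | zero => simp
    | add x y hx hy => simp only [map_add, tmul_add, hx, hy]
    | tmul p q => rfl

variable [FiniteDimensional k H]

/-- With the injectivity of `evZ`, this turns statements about the coaction into identities for the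
conjugated function. -/
theorem evZ_rhoB (f : BraceA k H) : evZ (rhoB hS f) = coactH hS (evH f) := by
  rw [← inclT_coactC]
  ext1; ext1 x
  rw [evZ_apply, opEquiv_evalA_rhoB]
  rfl

/-- Applying the coaction twice conjugates in the inner Hᵒᵖ factor; the outer factor u is constant
and commutes with it. -/
theorem incl₃_rhoB (z : BraceA k H ⊗[k] H) (x : H) :
    incl₃ ((evalA x).rTensor _ (TensorProduct.assoc k _ H H ((rhoB hS).rTensor H z))) =
      (inL H (opR k H _) * Conv.push (coactR hS) (evZ z) * inL H (sInvR hS _) :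
        Conv k H ((Hpar k H ⊗[k] Hᵐᵒᵖ) ⊗[k] Hᵐᵒᵖ)).ofConv x := by
  induction z with
  | zero => simp [evZ_zero]
  | add x y hx hy =>
    simp only [map_add, evZ_add, ofConv_add, LinearMap.add_apply, hx, hy, mul_add, add_mul]
  | tmul f u =>
    have e1 : Conv.push (coactR hS) (evZ (f ⊗ₜ u)) =
        inL H (Conv.push (Hpar.coact hS) (evH f)) * Conv.const (1 ⊗ₜ op u) := by
      ext1; ext1 y
      rw [Conv.mul_const_apply, Conv.push_apply, evZ_tmul, inL_apply, coactR]
      simp [Conv.push_apply]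
    have e2 : Conv.const (((1 : Hpar k H ⊗[k] Hᵐᵒᵖ) ⊗ₜ[k] op u)) * inL H (sInvR hS (Hpar k H)) =
        inL H (sInvR hS (Hpar k H)) * Conv.const (1 ⊗ₜ op u) := by
      ext1; ext1 y
      rw [Conv.mul_const_apply, Conv.const_mul_apply, inL_apply]
      simp
    rw [e1, mul_assoc, mul_assoc, e2, ← mul_assoc, ← mul_assoc, ← map_mul, ← map_mul,
      Conv.mul_const_apply, LinearMap.rTensor_tmul, inL_apply]
    have e3 : (opR k H _ * Conv.push (Hpar.coact hS) (evH f) * sInvR hS _ : Conv k H _).ofConv x =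
        evZ (rhoB hS f) x := by rw [evZ_rhoB]; rfl
    rw [e3]
    generalize rhoB hS f = w
    induction w with
    | zero => simp [evZ_zero]
    | add x y hx hy =>
      simp only [map_add, evZ_add, ofConv_add, LinearMap.add_apply, hx, hy, add_tmul, add_mul]
    | tmul g v => simp [evZ_tmul, incl₃, opEquiv_tmul, inclT_tmul, evH_apply]

theorem rhoB_isBraceCoaction : IsBraceCoaction hS (rhoA hS) (rhoB hS) := fun f x => by
  apply (opEquiv k H _).injective
  rw [opEquiv_evalA_rhoB, coactC, mul_assoc, (ℛ k x).convMul_apply, map_sum]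
  refine Finset.sum_congr rfl fun i _ => ?_
  rw [(ℛ k ((ℛ k x).right i)).convMul_apply, map_sum, Finset.mul_sum]
  refine Finset.sum_congr rfl fun j _ => ?_
  have : (Conv.push (coactA hS) (evC f)).ofConv ((ℛ k ((ℛ k x).right i)).left j) =
    opEquiv k H _ (rhoA hS (evalA ((ℛ k ((ℛ k x).right i)).left j) f)) := (opEquiv_rhoA hS _).symm
  rw [this]
  generalize rhoA hS (evalA ((ℛ k ((ℛ k x).right i)).left j) f) = z
  induction z with
  | zero => simp
  | add x y hx hy => simp only [map_add, mul_add, add_mul, hx, hy]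
  | tmul a u => simp [opR_apply, sInvR_apply, opEquiv_tmul, mul_assoc]

/-- Coassociativity reduces to that on H_par together with Δ(x) being a coproduct for both
conjugating factors; the counit sends these factors to 1. -/
theorem rhoB_isComodule : IsComodule (rhoB hS) where
  coassoc f := evalA_rTensor_injective fun x => incl₃_injective (by
    rw [incl₃_rhoB, ← comulR_evZ, evZ_rhoB]
    have : (inL H (opR k H _) * Conv.push (coactR hS) (coactH hS (evH f)) * inL H (sInvR hS _) :
        Conv k H ((Hpar k H ⊗[k] Hᵐᵒᵖ) ⊗[k] Hᵐᵒᵖ)) =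
        Conv.push (R' := (Hpar k H ⊗[k] Hᵐᵒᵖ) ⊗[k] Hᵐᵒᵖ) (comulR (Hpar k H)) (coactH hS (evH f)) := by
      have e : Conv.push (coactR hS) (Conv.push (Hpar.coact hS) (evH f)) =
          Conv.push (R' := (Hpar k H ⊗[k] Hᵐᵒᵖ) ⊗[k] Hᵐᵒᵖ) (comulR (Hpar k H)) (Conv.push (Hpar.coact hS) (evH f)) := by
        ext1; ext1 y
        exact coact_coassoc hS _
      simp only [coactH, map_mul]
      rw [coactR_opR, coactR_sInvR, comulR_opR, comulR_sInvR, e]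
      simp only [mul_assoc]
    rw [this]
    rfl)
  counit f := evH_injective (by
    have e : Conv.push (counitR (Hpar k H)) (Conv.push (Hpar.coact hS) (evH f)) = evH f := by
      ext1; ext1 y
      exact coact_counit hS _
    rw [evH_counit, evZ_rhoB, coactH, map_mul, map_mul, counitR_opR, counitR_sInvR, one_mul,
      mul_one, e])

theorem rhoB_isYetterDrinfeldAlgebra : IsYetterDrinfeldAlgebra hS (actA k H) (rhoB hS) where
  toIsComodule := rhoB_isComodule hS
  toIsModuleAlgebra := Brace.isModuleAlgebra _
  compat l f := evZ_injective (by
    ext1; ext1 x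
    have e1 : coactH hS (evH (actA k H l f)) = Conv.at₂ (leg₁ (opR k H _) *
        pullMul (Conv.push (Hpar.coact hS) (evH f)) * leg₁ (sInvR hS _)) l := by
      rw [mul_leg₁_at₂, leg₁_mul_at₂, evH_act, coactH]
      rfl
    -- In Hᵒᵖ one has ι(xl) = ι(l)ι(x), so conjugation by ι at xl is conjugation at x followed by
    -- conjugation at l. Solving for the part at x produces the factors S⁻¹(l₍₁₎) and l₍₃₎ of the
    -- compatibility condition.
    have e2 : leg₁ (opR k H _) *
        pullMul (Conv.push (Hpar.coact hS) (evH f)) * leg₁ (sInvR hS _) =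
        leg₂ (sInvR hS _) * (pullMul (evZ (rhoB hS f)) * leg₂ (opR k H _)) := by
      have u1 : leg₂ (C := H) (sInvR hS (Hpar k H)) * leg₂ (opR k H (Hpar k H)) = 1 := by
        rw [← map_mul, sInvR_mul_opR, map_one]
      rw [evZ_rhoB, pullMul_coactH, mul_assoc _ (leg₂ (sInvR hS _)) (leg₂ (opR k H _)), u1,
        mul_one, ← mul_assoc, u1, one_mul]
    rw [evZ_rhoB, e1, e2, Conv.at₂_apply, ← Conv.at₁_apply, leg₂_mul_at₁,
      (ℛ k l).convMul_apply]
    rw [evZ_sum_apply]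
    refine Finset.sum_congr rfl fun i _ => ?_
    rw [evZ_lTensor_mulRight, evZ_diag]
    rfl)
  coact_one := evZ_injective (by rw [evZ_rhoB, evH_one, coactH_one, evZ_one])
  coact_mul a b := evZ_injective (by
    rw [evZ_rhoB, evH_mul, coactH_mul, evZ_mul, evZ_rhoB, evZ_rhoB])

/-- The map `a ⊗ u ↦ a f(u)`. -/
noncomputable def evMul (f : BraceA k H) : Hpar k H ⊗[k] Hᵐᵒᵖ →ₗ[k] Hpar k H :=
  LinearMap.mul' k (Hpar k H) ∘ₗ ((evH f).ofConv ∘ₗ (opLinearEquiv k).symm.toLinearMap).lTensor _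

theorem evMul_tmul (f : BraceA k H) (a : Hpar k H) (u : H) :
    evMul f (a ⊗ₜ op u) = a * evH f u := by simp [evMul]

theorem evMul_coact_bracket (f : BraceA k H) (w : Hpar k H ⊗[k] Hᵐᵒᵖ) (h : H) :
    evMul f (w * Hpar.coact hS (bracket k H h)) = evMul f w * bracket k H h := by
  -- Writing the argument as S(h) gives its coaction the form [S(h₍₁₎)] ⊗ h₍₂₎, which matches
  -- `brS_mul_evH`.
  obtain ⟨h, rfl⟩ := hS.surjective h
  have e : Hpar.coact hS (bracket k H (antipode k h)) =
      (inL H (brS k H) * opR k H _ : Conv k H _).ofConv h := by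
    rw [← coact_brS]; rfl
  rw [e]
  induction w with
  | zero => simp
  | add x y hx hy => simp only [add_mul, map_add, hx, hy]
  | tmul a u =>
    obtain ⟨u, rfl⟩ := op_surjective u
    have key := LinearMap.congr_fun (congrArg WithConv.ofConv (brS_mul_evH f)) (h ⊗ₜ u)
    rw [leg₂_mul_leg₁_apply, ← Conv.at₂_apply, leg₁_mul_at₂] at key
    rw [evMul_tmul, mul_assoc]
    change _ = a * (evH f u * brS k H h)
    rw [← key, LinearMap.convMul_apply, LinearMap.convMul_apply]
    generalize comul (R := k) h = t
    induction t with
    | zero => simp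
    | add x y hx hy => simp only [map_add, mul_add, hx, hy]
    | tmul p q =>
      simp only [map_tmul, LinearMap.mul'_apply, inL_apply, opR_apply,
        Algebra.TensorProduct.tmul_mul_tmul, one_mul, mul_one, ← op_mul, evMul_tmul, mul_assoc]
      rfl

/-- The property passes from brackets to products, and ε_h is a sum of products of two brackets. -/
theorem evMul_coact (f : BraceA k H) (w : Hpar k H ⊗[k] Hᵐᵒᵖ) (a : Apar k H) :
    evMul f (w * Hpar.coact hS (Apar.incl k H a)) = evMul f w * Apar.incl k H a := by
  induction a using Apar.induction generalizing w with
  | eps h =>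
    rw [incl_epsA, ← brC_mul_brS, LinearMap.convMul_apply]
    generalize comul (R := k) h = t
    induction t with
    | zero => simp
    | add x y hx hy => simp only [map_add, mul_add, hx, hy]
    | tmul p q =>
      rw [map_tmul, LinearMap.mul'_apply, map_mul (Hpar.coact hS), ← mul_assoc, brC_apply, brS_apply,
        evMul_coact_bracket, evMul_coact_bracket, mul_assoc]
  | algebraMap r => simp [Algebra.algebraMap_eq_smul_one]
  | add a b ha hb => simp only [map_add, mul_add, ha, hb]
  | mul a b ha hb => rw [map_mul (Apar.incl k H), map_mul (Hpar.coact hS), ← mul_assoc, hb, ha, mul_assoc]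

/-- Evaluated at x, the left side is a ⊗ u ↦ a b(u) applied to ι(x₍₁₎)ρ(a(x₍₂₎)), the final ι⁻¹ of
the conjugation having cancelled. By `evMul_coact` the result is b(x₍₁₎)a(x₍₂₎). -/
theorem rhoB_isBraidedCommutative : IsBraidedCommutative (actA k H) (rhoB hS) := fun a b =>
  evH_injective (by
    have e1 (z : BraceA k H ⊗[k] H) (x : H) :
        evH (LinearMap.mul' k _ (((actA k H).toLinearMap.flip b).lTensor _ z)) x =
          evMul b ((evZ z * opR k H _ : Conv k H _).ofConv x) := by
      induction z with
      | zero => simp [evZ_zero, evH]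
      | add y z hy hz =>
        simp only [evH_apply, map_add, evZ_add, add_mul, ofConv_add, LinearMap.add_apply] at hy hz ⊢
        rw [hy, hz]
      | tmul f u =>
        rw [LinearMap.lTensor_tmul, LinearMap.mul'_apply, evH_mul, LinearMap.convMul_apply,
          LinearMap.convMul_apply]
        generalize comul (R := k) x = t
        induction t with
        | zero => simp
        | add x y hx hy => simp only [map_add, hx, hy]
        | tmul p q =>
          simp only [map_tmul, LinearMap.mul'_apply, evZ_tmul, opR_apply,
            Algebra.TensorProduct.tmul_mul_tmul, mul_one, ← op_mul, evMul_tmul]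
          rfl
    ext1; ext1 x
    rw [e1, evZ_rhoB, coactH, mul_assoc, sInvR_mul_opR, mul_one, evH_mul]
    exact Conv.apply_congr (evMul b) LinearMap.id (fun x y => by
      change evMul b (_ * Hpar.coact hS (Apar.incl k H (evalA y a))) = _
      rw [evMul_coact, opR_apply, evMul_tmul, one_mul]
      rfl) x)

end BraceYetterDrinfeld

/-! ### Universal property, representation and comultiplication of a smash product -/

section SmashLift

variable {k : Type u} {H : Type v} [Field k] [Ring H] [HopfAlgebra k H]
variable {B : Type*} [Ring B] [Algebra k B]

/-- The function `h ↦ φ(h)` as an element of the convolution algebra. -/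
noncomputable abbrev Conv.ofAlgHom {C : Type*} [Ring C] [Algebra k C] (φ : H →ₐ[k] C) :
    Conv k H C := toConv φ.toLinearMap

/-- The function `h ↦ φ(S(h))`. -/
noncomputable def Conv.antipodeOf {C : Type*} [Ring C] [Algebra k C] (φ : H →ₐ[k] C) :
    Conv k H C := Conv.push φ (toConv (antipode k))

theorem Conv.antipodeOf_apply {C : Type*} [Ring C] [Algebra k C] (φ : H →ₐ[k] C) (h : H) :
    Conv.antipodeOf φ h = φ (antipode k h) := rfl

theorem Conv.ofAlgHom_mul_antipodeOf {C : Type*} [Ring C] [Algebra k C] (φ : H →ₐ[k] C) :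
    Conv.ofAlgHom φ * Conv.antipodeOf φ = 1 := by
  rw [← map_one (Conv.push φ), ← LinearMap.id_mul_antipode, map_mul]
  rfl

theorem Conv.antipodeOf_mul_ofAlgHom {C : Type*} [Ring C] [Algebra k C] (φ : H →ₐ[k] C) :
    Conv.antipodeOf φ * Conv.ofAlgHom φ = 1 := by
  rw [← map_one (Conv.push φ), ← LinearMap.antipode_mul_id, map_mul]
  rfl

/-- The function `h ↦ h • b`. -/
noncomputable def actConv (act : H →ₐ[k] Module.End k B) (b : B) : Conv k H B :=
  toConv (act.toLinearMap.flip b)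

theorem actConv_apply (act : H →ₐ[k] Module.End k B) (b : B) (h : H) :
    actConv act b h = act h b := rfl

variable {act : H →ₐ[k] Module.End k B} (hact : IsModuleAlgebra act)

theorem toSmash_mul (x y : B ⊗[k] H) :
    toSmash hact x * toSmash hact y = toSmash hact (smashMul act x y) := rfl

/-- The embedding `b ↦ b # 1`. -/
noncomputable def smashS : B →ₐ[k] Smash hact :=
  AlgHom.ofLinearMap ((toSmash hact).toLinearMap ∘ₗ (TensorProduct.mk k B H).flip 1) rfl
    fun a b => by
      simp only [LinearMap.comp_apply, LinearMap.flip_apply, mk_apply, LinearEquiv.coe_coe,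
        toSmash_mul, smashMul_tmul, diag, Bialgebra.comul_one, Algebra.TensorProduct.one_def]
      simp

/-- The embedding `h ↦ 1 # h`. -/
noncomputable def smashEta : H →ₐ[k] Smash hact :=
  AlgHom.ofLinearMap ((toSmash hact).toLinearMap ∘ₗ TensorProduct.mk k B H 1) rfl
    fun h l => by
      simp only [LinearMap.comp_apply, mk_apply, LinearEquiv.coe_coe, toSmash_mul, smashMul_tmul,
        diag]
      congr 1
      have e : h = TensorProduct.lid k H (counit.rTensor H (comul h)) := by simp
      conv_lhs => rw [e]
      generalize comul (R := k) h = t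
      induction t with
      | zero => simp
      | tmul x y => simp [hact.act_one, smul_tmul, Algebra.algebraMap_eq_smul_one]
      | add x y hx hy => simp only [map_add, add_mul, tmul_add, LinearMap.add_apply, hx, hy]

theorem smashS_apply (b : B) : smashS hact b = toSmash hact (b ⊗ₜ 1) := rfl

theorem smashEta_apply (h : H) : smashEta hact h = toSmash hact (1 ⊗ₜ h) := rfl

theorem toSmash_tmul (b : B) (h : H) :
    toSmash hact (b ⊗ₜ h) = smashS hact b * smashEta hact h := by
  rw [smashS_apply, smashEta_apply, toSmash_mul, smashMul_tmul, diag, LinearMap.comp_apply,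
    Bialgebra.comul_one, Algebra.TensorProduct.one_def]
  simp

theorem Smash.induction {P : Smash hact → Prop} (zero : P 0) (add : ∀ x y, P x → P y → P (x + y))
    (tmul : ∀ b h, P (smashS hact b * smashEta hact h)) (r : Smash hact) : P r := by
  obtain ⟨z, rfl⟩ := (toSmash hact).surjective r
  induction z with
  | zero => rwa [map_zero]
  | tmul b h => rw [toSmash_tmul]; exact tmul b h
  | add x y hx hy => rw [map_add]; exact add _ _ hx hy

theorem Smash.algHom_ext {C : Type*} [Ring C] [Algebra k C] {φ ψ : Smash hact →ₐ[k] C}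
    (hs : ∀ b, φ (smashS hact b) = ψ (smashS hact b))
    (hη : ∀ h, φ (smashEta hact h) = ψ (smashEta hact h)) : φ = ψ := by
  ext r
  induction r using Smash.induction with
  | zero => simp
  | add x y hx hy => simp only [map_add, hx, hy]
  | tmul b h => rw [map_mul, map_mul, hs, hη]

/-- `η(h) s(b) = s(h₍₁₎ • b) η(h₍₂₎)` -/
theorem smashEta_mul_smashS (b : B) :
    Conv.ofAlgHom (smashEta hact) * Conv.const (smashS hact b) =
      Conv.push (smashS hact) (actConv act b) * Conv.ofAlgHom (smashEta hact) := by
  ext1; ext1 h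
  rw [Conv.mul_const_apply, LinearMap.convMul_apply]
  change smashEta hact h * smashS hact b = _
  rw [smashS_apply, smashEta_apply, toSmash_mul, smashMul_tmul, diag, LinearMap.comp_apply]
  generalize comul (R := k) h = t
  induction t with
  | zero => simp
  | add x y hx hy => simp only [map_add, LinearMap.add_apply, hx, hy]
  | tmul x y =>
    simp only [map_tmul, LinearMap.mul'_apply, map₂_apply_tmul, LinearMap.mul_apply', mul_one,
      LinearMap.rTensor_tmul, one_mul, Conv.push_apply, actConv_apply,
      AlgHom.toLinearMap_apply, toSmash_tmul]

/-- `η(S(h₍₁₎)) s(h₍₂₎ • b) = s(b) η(S(h))` -/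
theorem antipodeOf_mul_smashS (b : B) :
    Conv.antipodeOf (smashEta hact) * Conv.push (smashS hact) (actConv act b) =
      Conv.const (smashS hact b) * Conv.antipodeOf (smashEta hact) := by
  have := congrArg (fun F => Conv.antipodeOf (smashEta hact) * F * Conv.antipodeOf (smashEta hact))
    (smashEta_mul_smashS hact b)
  rw [← mul_assoc, Conv.antipodeOf_mul_ofAlgHom, one_mul, mul_assoc, mul_assoc,
    Conv.ofAlgHom_mul_antipodeOf, mul_one] at this
  exact this.symm

variable {C : Type*} [Ring C] [Algebra k C]

/-- The linear map `b # h ↦ φ(b) ψ(h)`. -/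
noncomputable def Smash.liftLinear (φ : B →ₐ[k] C) (ψ : H →ₐ[k] C) : Smash hact →ₗ[k] C :=
  LinearMap.mul' k C ∘ₗ
    TensorProduct.map φ.toLinearMap ψ.toLinearMap ∘ₗ (toSmash hact).symm.toLinearMap

theorem Smash.liftLinear_apply (φ : B →ₐ[k] C) (ψ : H →ₐ[k] C) (b : B) (h : H) :
    Smash.liftLinear hact φ ψ (smashS hact b * smashEta hact h) = φ b * ψ h := by
  rw [← toSmash_tmul, liftLinear, LinearMap.comp_apply, LinearMap.comp_apply,
    LinearEquiv.coe_coe, LinearEquiv.symm_apply_apply]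
  rfl

theorem Smash.liftLinear_smashS_mul_mul (φ : B →ₐ[k] C) (ψ : H →ₐ[k] C) (a : B) (l : H)
    (z : Smash hact) : Smash.liftLinear hact φ ψ (smashS hact a * z * smashEta hact l) =
      φ a * Smash.liftLinear hact φ ψ z * ψ l := by
  induction z using Smash.induction with
  | zero => rw [mul_zero, zero_mul, map_zero, mul_zero, zero_mul]
  | add x y hx hy => simp only [map_add, mul_add, add_mul, hx, hy]
  | tmul c y =>
    have e : smashS hact a * (smashS hact c * smashEta hact y) * smashEta hact l =
        smashS hact (a * c) * smashEta hact (y * l) := by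
      rw [map_mul (smashS hact), map_mul (smashEta hact), mul_assoc, mul_assoc, mul_assoc]
    rw [e, liftLinear_apply, liftLinear_apply, map_mul φ, map_mul ψ, mul_assoc, mul_assoc,
      mul_assoc]

theorem Smash.liftLinear_smashEta_mul_smashS (φ : B →ₐ[k] C) (ψ : H →ₐ[k] C)
    (h : ∀ b, Conv.ofAlgHom ψ * Conv.const (φ b) =
      Conv.push φ (actConv act b) * Conv.ofAlgHom ψ) (b : B) (l : H) :
    Smash.liftLinear hact φ ψ (smashEta hact l * smashS hact b) = ψ l * φ b := by
  have e1 := LinearMap.congr_fun (congrArg WithConv.ofConv (smashEta_mul_smashS hact b)) l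
  have e2 := LinearMap.congr_fun (congrArg WithConv.ofConv (h b)) l
  rw [Conv.mul_const_apply] at e1 e2
  refine (congrArg (Smash.liftLinear hact φ ψ) e1).trans (Eq.trans ?_ e2.symm)
  exact Conv.apply_congr (F := Conv.push (smashS hact) (actConv act b))
    (G := Conv.ofAlgHom (smashEta hact)) (F' := Conv.push φ (actConv act b))
    (G' := Conv.ofAlgHom ψ) (Smash.liftLinear hact φ ψ) LinearMap.id
    (fun x y => Smash.liftLinear_apply hact φ ψ (act x b) y) l

theorem Smash.liftLinear_mul (φ : B →ₐ[k] C) (ψ : H →ₐ[k] C)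
    (h : ∀ b, Conv.ofAlgHom ψ * Conv.const (φ b) =
      Conv.push φ (actConv act b) * Conv.ofAlgHom ψ) (x y : Smash hact) :
    Smash.liftLinear hact φ ψ (x * y) =
      Smash.liftLinear hact φ ψ x * Smash.liftLinear hact φ ψ y := by
  induction x using Smash.induction with
  | zero => rw [zero_mul, map_zero, zero_mul]
  | add x y hx hy => simp only [map_add, add_mul, hx, hy]
  | tmul a p =>
    induction y using Smash.induction with
    | zero => rw [mul_zero, map_zero, mul_zero]
    | add x y hx hy => simp only [map_add, mul_add, hx, hy]
    | tmul b q =>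
      rw [liftLinear_apply, liftLinear_apply, mul_assoc, ← mul_assoc (smashEta hact p),
        ← mul_assoc, liftLinear_smashS_mul_mul, liftLinear_smashEta_mul_smashS hact φ ψ h,
        mul_assoc, mul_assoc, mul_assoc]

/-- The universal property of the smash product. -/
noncomputable def Smash.lift (φ : B →ₐ[k] C) (ψ : H →ₐ[k] C)
    (h : ∀ b, Conv.ofAlgHom ψ * Conv.const (φ b) =
      Conv.push φ (actConv act b) * Conv.ofAlgHom ψ) : Smash hact →ₐ[k] C :=
  AlgHom.ofLinearMap (Smash.liftLinear hact φ ψ) (by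
    have := Smash.liftLinear_apply hact φ ψ 1 1
    rwa [map_one, map_one, map_one, map_one, mul_one, mul_one] at this)
    (Smash.liftLinear_mul hact φ ψ h)

theorem Smash.lift_smashS (φ : B →ₐ[k] C) (ψ : H →ₐ[k] C) (h) (b : B) :
    Smash.lift hact φ ψ h (smashS hact b) = φ b := by
  have := Smash.liftLinear_apply hact φ ψ b 1
  rwa [map_one, map_one, mul_one, mul_one] at this

theorem Smash.lift_smashEta (φ : B →ₐ[k] C) (ψ : H →ₐ[k] C) (h) (x : H) :
    Smash.lift hact φ ψ h (smashEta hact x) = ψ x := by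
  have := Smash.liftLinear_apply hact φ ψ 1 x
  rwa [map_one, map_one, one_mul, one_mul] at this

theorem actConv_isModuleAlgebra (hact : IsModuleAlgebra act) (a : B) :
    Conv.ofAlgHom act * Conv.const (Algebra.lmul k B a) =
      Conv.push (Algebra.lmul k B) (actConv act a) * Conv.ofAlgHom act := by
  ext1; ext1 h
  refine LinearMap.ext fun b => ?_
  rw [Conv.mul_const_apply, LinearMap.convMul_apply]
  change act h (a * b) = _
  rw [hact.act_mul, diag, LinearMap.comp_apply]
  generalize comul (R := k) h = t
  induction t with
  | zero => simp
  | add x y hx hy => simp only [map_add, LinearMap.add_apply, hx, hy]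
  | tmul x y => simp [Conv.push_apply, actConv_apply]

/-- The action of `B # H` on `B` by `(b # h) c = b (h • c)`. -/
noncomputable def smashRep : Smash hact →ₐ[k] Module.End k B :=
  Smash.lift hact (Algebra.lmul k B) act (actConv_isModuleAlgebra hact)

theorem smashRep_smashS (a b : B) : smashRep hact (smashS hact a) b = a * b := by
  rw [smashRep, Smash.lift_smashS]; rfl

theorem smashRep_smashEta (h : H) (b : B) : smashRep hact (smashEta hact h) b = act h b := by
  rw [smashRep, Smash.lift_smashEta]

/-- The map `b # h ↦ ε(h) b`. -/
noncomputable def smashCounit : Smash hact →ₗ[k] B :=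
  LinearMap.applyₗ 1 ∘ₗ (smashRep hact).toLinearMap

theorem smashCounit_apply (r : Smash hact) : smashCounit hact r = smashRep hact r 1 := rfl

/-- The counit is the orbit map of 1 under the representation on B; this makes the counit axioms
statements about that representation. -/
theorem smashCounit_mul (r r' : Smash hact) :
    smashCounit hact (r * r') = smashRep hact r (smashCounit hact r') := by
  rw [smashCounit_apply, map_mul, Module.End.mul_apply, smashCounit_apply]

theorem smashCounit_smashS (b : B) : smashCounit hact (smashS hact b) = b := by
  rw [smashCounit_apply, smashRep_smashS, mul_one]

theorem smashCounit_smashEta (h : H) :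
    smashCounit hact (smashEta hact h) = algebraMap k B (counit h) := by
  rw [smashCounit_apply, smashRep_smashEta, hact.act_one]

/-- The function `h ↦ (1 # h) ⊗ 1`. -/
noncomputable def etaL : Conv k H (Smash hact ⊗[k] Smash hact) :=
  Conv.ofAlgHom ((Algebra.TensorProduct.includeLeft (R := k) (S := k)).comp (smashEta hact))

/-- The function `h ↦ 1 ⊗ (1 # h)`. -/
noncomputable def etaR : Conv k H (Smash hact ⊗[k] Smash hact) :=
  Conv.ofAlgHom ((Algebra.TensorProduct.includeRight (R := k)).comp (smashEta hact))

theorem etaL_apply (h : H) : etaL hact h = smashEta hact h ⊗ₜ 1 := rfl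

theorem etaR_apply (h : H) : etaR hact h = 1 ⊗ₜ smashEta hact h := rfl

/-- The homomorphism `h ↦ (1 # h₍₁₎) ⊗ (1 # h₍₂₎)`. -/
noncomputable def comulEta : H →ₐ[k] Smash hact ⊗[k] Smash hact :=
  (Algebra.TensorProduct.map (smashEta hact) (smashEta hact)).comp (Bialgebra.comulAlgHom k H)

theorem comulEta_apply (h : H) : comulEta hact h =
    TensorProduct.map (smashEta hact).toLinearMap (smashEta hact).toLinearMap (comul h) := rfl

theorem ofAlgHom_comulEta : Conv.ofAlgHom (comulEta hact) = etaL hact * etaR hact := by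
  ext1; ext1 h
  rw [LinearMap.convMul_apply]
  change comulEta hact h = _
  rw [comulEta_apply]
  generalize comul (R := k) h = t
  induction t with
  | zero => simp
  | add x y hx hy => simp only [map_add, hx, hy]
  | tmul x y => simp [etaL_apply, etaR_apply]

/-- Elements of B sit in the first factor and commute with the second leg of η(h₍₁₎) ⊗ η(h₍₂₎),
leaving the commutation rule in the first factor. This is what lets the comultiplication be lifted
to an algebra map over k. -/
theorem comulEta_mul_smashS (b : B) :
    Conv.ofAlgHom (comulEta hact) * Conv.const (smashS hact b ⊗ₜ[k] 1) =
      Conv.push ((Algebra.TensorProduct.includeLeft (R := k) (S := k) (B := Smash hact)).comp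
        (smashS hact)) (actConv act b) * Conv.ofAlgHom (comulEta hact) := by
  have e2 : etaR hact * Conv.const (smashS hact b ⊗ₜ[k] 1) =
      Conv.const (smashS hact b ⊗ₜ[k] 1) * etaR hact := by
    ext1; ext1 h
    rw [Conv.mul_const_apply, Conv.const_mul_apply, etaR_apply]
    simp
  have e3 := congrArg (Conv.push (Algebra.TensorProduct.includeLeft
    (R := k) (S := k) (A := Smash hact) (B := Smash hact))) (smashEta_mul_smashS hact b)
  rw [map_mul, map_mul, Conv.push_const] at e3
  rw [ofAlgHom_comulEta, mul_assoc, e2, ← mul_assoc]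
  refine Eq.trans (congrArg (· * _) e3) ?_
  rw [mul_assoc]
  rfl

/-- The lift `f # h ↦ (f # h₍₁₎) ⊗ (1 # h₍₂₎)` of the comultiplication. -/
noncomputable def smashComul : Smash hact →ₐ[k] Smash hact ⊗[k] Smash hact :=
  Smash.lift hact (Algebra.TensorProduct.includeLeft.comp (smashS hact)) (comulEta hact)
    (comulEta_mul_smashS hact)

theorem smashComul_smashS (b : B) : smashComul hact (smashS hact b) = smashS hact b ⊗ₜ 1 :=
  Smash.lift_smashS _ _ _ _ _

theorem smashComul_smashEta (h : H) : smashComul hact (smashEta hact h) = comulEta hact h :=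
  Smash.lift_smashEta _ _ _ _ _

end SmashLift

/-! ### Convolution acting on maps out of a comodule -/

section ComoduleConvolution

variable {k : Type u} {H : Type v} [Field k] [Ring H] [HopfAlgebra k H]
variable {V : Type*} [AddCommGroup V] [Module k V] {R R' : Type*} [Ring R] [Algebra k R]
  [Ring R'] [Algebra k R']

/-- The linear map `v ⊗ h ↦ K(v ⊗ h₍₁₎) P(h₍₂₎)`. -/
noncomputable def tensorConv (K : V ⊗[k] H →ₗ[k] R) (P : Conv k H R) : V ⊗[k] H →ₗ[k] R :=
  LinearMap.mul' k R ∘ₗ TensorProduct.map K P.ofConv ∘ₗ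
    (TensorProduct.assoc k V H H).symm.toLinearMap ∘ₗ comul.lTensor V

theorem tensorConv_tmul (K : V ⊗[k] H →ₗ[k] R) (P : Conv k H R) (v : V) (h : H) :
    tensorConv K P (v ⊗ₜ h) = (toConv (K ∘ₗ TensorProduct.mk k V H v) * P : Conv k H R) h := by
  rw [LinearMap.convMul_apply, tensorConv]
  simp only [LinearMap.comp_apply, LinearMap.lTensor_tmul]
  generalize comul (R := k) h = t
  induction t with
  | zero => simp
  | tmul x y => simp
  | add x y hx hy => simp only [map_add, tmul_add, hx, hy]

/-- The linear map `v ↦ G(v⁽⁰⁾) P(v⁽¹⁾)`. -/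
noncomputable def coconv (ρ : V →ₗ[k] V ⊗[k] H) (G : V →ₗ[k] R) (P : Conv k H R) : V →ₗ[k] R :=
  LinearMap.mul' k R ∘ₗ TensorProduct.map G P.ofConv ∘ₗ ρ

variable {ρ : V →ₗ[k] V ⊗[k] H}

/-- Coassociativity of the coaction: v⁽⁰⁾⁽⁰⁾ ⊗ v⁽⁰⁾⁽¹⁾ ⊗ v⁽¹⁾ is v⁽⁰⁾ ⊗ Δ(v⁽¹⁾). -/
theorem coconv_comp (hρ : IsComodule ρ) (K : V ⊗[k] H →ₗ[k] R) (P : Conv k H R) :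
    coconv ρ (K ∘ₗ ρ) P = tensorConv K P ∘ₗ ρ := by
  ext v
  simp only [coconv, tensorConv, LinearMap.comp_apply]
  rw [← hρ.coassoc, LinearEquiv.coe_coe, LinearEquiv.symm_apply_apply]
  congr 1
  generalize ρ v = z
  induction z with
  | zero => simp
  | tmul x y => simp
  | add x y hx hy => simp only [map_add, hx, hy]

/-- With `coconv_one`, linear maps out of a comodule form a right module over the convolution
algebra, so antipode cancellations can be performed on coacted expressions. -/
theorem coconv_mul (hρ : IsComodule ρ) (G : V →ₗ[k] R) (P Q : Conv k H R) :
    coconv ρ G (P * Q) = coconv ρ (coconv ρ G P) Q := by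
  have e : coconv ρ G P = (LinearMap.mul' k R ∘ₗ TensorProduct.map G P.ofConv) ∘ₗ ρ := rfl
  rw [e, coconv_comp hρ]
  rw [coconv, ← LinearMap.comp_assoc]
  congr 1
  refine TensorProduct.ext' fun v h => ?_
  rw [tensorConv_tmul]
  have e2 : toConv ((LinearMap.mul' k R ∘ₗ TensorProduct.map G P.ofConv) ∘ₗ
      TensorProduct.mk k V H v) = Conv.const (G v) * P := by
    ext1; ext1 x
    rw [Conv.const_mul_apply]
    simp
  rw [e2, mul_assoc, Conv.const_mul_apply]
  simp

theorem coconv_one (hρ : IsComodule ρ) (G : V →ₗ[k] R) : coconv ρ G 1 = G := by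
  ext v
  conv_rhs => rw [← hρ.counit v]
  simp only [coconv, LinearMap.comp_apply]
  generalize ρ v = z
  induction z with
  | zero => simp
  | tmul x y => simp [LinearMap.convOne_def, Algebra.algebraMap_eq_smul_one]
  | add x y hx hy => simp only [map_add, hx, hy]

theorem comp_coconv (χ : R →ₐ[k] R') (G : V →ₗ[k] R) (P : Conv k H R) :
    χ.toLinearMap ∘ₗ coconv ρ G P = coconv ρ (χ.toLinearMap ∘ₗ G) (Conv.push χ P) := by
  ext v
  simp only [coconv, LinearMap.comp_apply]
  generalize ρ v = z
  induction z with
  | zero => simp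
  | tmul x y => simp [Conv.push_apply]
  | add x y hx hy => simp only [map_add, hx, hy]

theorem mulLeft_coconv (r : R) (G : V →ₗ[k] R) (P : Conv k H R) :
    coconv ρ (LinearMap.mulLeft k r ∘ₗ G) P = LinearMap.mulLeft k r ∘ₗ coconv ρ G P := by
  ext v
  simp only [coconv, LinearMap.comp_apply]
  generalize ρ v = z
  induction z with
  | zero => simp
  | tmul x y => simp [mul_assoc]
  | add x y hx hy => simp only [map_add, hx, hy]

end ComoduleConvolution

/-! ### The target map and the inverse antipode -/

section SmashTarget

variable {k : Type u} {H : Type v} [Field k] [Ring H] [HopfAlgebra k H]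
variable {B : Type*} [Ring B] [Algebra k B]
variable {act : H →ₐ[k] Module.End k B} (hact : IsModuleAlgebra act) {ρ : B →ₗ[k] B ⊗[k] H}

open MulOpposite

/-- The linear map `b ↦ b⁽⁰⁾ # b⁽¹⁾`. -/
noncomputable def smashTLinear (ρ : B →ₗ[k] B ⊗[k] H) : B →ₗ[k] Smash hact :=
  (toSmash hact).toLinearMap ∘ₗ ρ

theorem toSmash_eq_mul' : (toSmash hact).toLinearMap =
    LinearMap.mul' k (Smash hact) ∘ₗ
      TensorProduct.map (smashS hact).toLinearMap (smashEta hact).toLinearMap :=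
  TensorProduct.ext' fun b h => toSmash_tmul hact b h

theorem smashTLinear_eq_coconv : smashTLinear hact ρ =
    coconv ρ (smashS hact).toLinearMap (Conv.ofAlgHom (smashEta hact)) := by
  rw [smashTLinear, toSmash_eq_mul']
  rfl

variable {hS : Function.Bijective (antipode k : H →ₗ[k] H)}

/-- Inverts the definition of t: convolving with h ↦ η(S(h)) gives t(b⁽⁰⁾)η(S(b⁽¹⁾)) = s(b). -/
theorem coconv_smashTLinear (hρ : IsComodule ρ) :
    coconv ρ (smashTLinear hact ρ) (Conv.antipodeOf (smashEta hact)) =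
      (smashS hact).toLinearMap := by
  rw [smashTLinear_eq_coconv, ← coconv_mul hρ, Conv.ofAlgHom_mul_antipodeOf, coconv_one hρ]

/-- t(b)s(a) = s(b⁽⁰⁾(b⁽¹⁾•a))η(b⁽²⁾), and braided commutativity turns the first factor into s(a
b⁽⁰⁾). -/
theorem smashTLinear_mul_smashS (hρ : IsComodule ρ) (hbc : IsBraidedCommutative act ρ) (a b : B) :
    smashTLinear hact ρ b * smashS hact a = smashS hact a * smashTLinear hact ρ b := by
  let K : B ⊗[k] H →ₗ[k] Smash hact :=
    (smashS hact).toLinearMap ∘ₗ LinearMap.mul' k B ∘ₗ (act.toLinearMap.flip a).lTensor B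
  have h1 : K ∘ₗ ρ = LinearMap.mulLeft k (smashS hact a) ∘ₗ (smashS hact).toLinearMap := by
    ext b
    change smashS hact (LinearMap.mul' k B ((act.toLinearMap.flip a).lTensor B (ρ b))) = _
    rw [hbc, map_mul]
    rfl
  have h2 : LinearMap.mulRight k (smashS hact a) ∘ₗ (toSmash hact).toLinearMap =
      tensorConv K (Conv.ofAlgHom (smashEta hact)) := by
    refine TensorProduct.ext' fun b h => ?_
    rw [tensorConv_tmul]
    have e : toConv (K ∘ₗ TensorProduct.mk k B H b) =
        Conv.const (smashS hact b) * Conv.push (smashS hact) (actConv act a) := by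
      ext1; ext1 x
      rw [Conv.const_mul_apply]
      change smashS hact (b * act x a) = _
      rw [map_mul]
      rfl
    rw [e, mul_assoc, ← smashEta_mul_smashS, Conv.const_mul_apply, Conv.mul_const_apply,
      ← mul_assoc]
    change toSmash hact (b ⊗ₜ h) * _ = _
    rw [toSmash_tmul]
    rfl
  have h3 := LinearMap.congr_fun (coconv_comp hρ K (Conv.ofAlgHom (smashEta hact))) b
  rw [h1, mulLeft_coconv, ← h2, ← smashTLinear_eq_coconv] at h3
  exact h3.symm

/-- t(ab) = s(a⁽⁰⁾)t(b)η(a⁽¹⁾) because H coacts with reversed product; t(b) then moves past s(a⁽⁰⁾).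
-/
theorem smashTLinear_mul (hYD : IsYetterDrinfeldAlgebra hS act ρ)
    (hbc : IsBraidedCommutative act ρ) (a b : B) :
    smashTLinear hact ρ (a * b) = smashTLinear hact ρ b * smashTLinear hact ρ a := by
  have key (z : B ⊗[k] H) : toSmash hact
      (TensorProduct.map₂ (LinearMap.mul k B) (LinearMap.mul k H).flip z (ρ b)) =
      smashTLinear hact ρ b * toSmash hact z := by
    induction z with
    | zero => simp
    | add x y hx hy => simp only [map_add, LinearMap.add_apply, mul_add, hx, hy]
    | tmul a u =>
      rw [toSmash_tmul, ← mul_assoc, smashTLinear_mul_smashS hact hYD.toIsComodule hbc,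
        map₂_apply_tmul]
      change _ = smashS hact a * toSmash hact (ρ b) * smashEta hact u
      generalize ρ b = w
      induction w with
      | zero => simp
      | add x y hx hy => simp only [map_add, mul_add, add_mul, hx, hy]
      | tmul c x =>
        rw [map_tmul, LinearMap.mul_apply', LinearMap.flip_apply, LinearMap.mul_apply',
          toSmash_tmul, toSmash_tmul, map_mul, map_mul]
        simp only [mul_assoc]
  change toSmash hact (ρ (a * b)) = _
  rw [hYD.coact_mul, key]
  rfl

theorem smashTLinear_one (hYD : IsYetterDrinfeldAlgebra hS act ρ) :
    smashTLinear hact ρ 1 = 1 := by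
  change toSmash hact (ρ 1) = _
  rw [hYD.coact_one]
  rfl

/-- The target map `b ↦ b⁽⁰⁾ # b⁽¹⁾`. -/
noncomputable def smashT (hYD : IsYetterDrinfeldAlgebra hS act ρ)
    (hbc : IsBraidedCommutative act ρ) : Bᵐᵒᵖ →ₐ[k] Smash hact :=
  AlgHom.ofLinearMap (smashTLinear hact ρ ∘ₗ (opLinearEquiv k).symm.toLinearMap)
    (smashTLinear_one hact hYD) fun x y => smashTLinear_mul hact hYD hbc (unop y) (unop x)

/-- The target map, as a homomorphism to the opposite of the smash product. -/
noncomputable def smashTOp (hYD : IsYetterDrinfeldAlgebra hS act ρ)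
    (hbc : IsBraidedCommutative act ρ) : B →ₐ[k] (Smash hact)ᵐᵒᵖ :=
  AlgHom.ofLinearMap ((opLinearEquiv k).toLinearMap ∘ₗ smashTLinear hact ρ)
    (congrArg op (smashTLinear_one hact hYD))
    fun x y => congrArg op (smashTLinear_mul hact hYD hbc x y)

/-- The function `h ↦ ρ(h • b)`. -/
noncomputable def coactActConv (act : H →ₐ[k] Module.End k B) (ρ : B →ₗ[k] B ⊗[k] H) (b : B) :
    Conv k H (B ⊗[k] Hᵐᵒᵖ) :=
  toConv ((opEquiv k H B).toLinearMap ∘ₗ ρ ∘ₗ act.toLinearMap.flip b)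

theorem coactActConv_apply (b : B) (h : H) :
    coactActConv act ρ b h = opEquiv k H B (ρ (act h b)) := rfl

/-- The function `h ↦ h • v ⊗ u` for `v ⊗ u` in `B ⊗ H`. -/
noncomputable def actFstConv (act : H →ₐ[k] Module.End k B) (z : B ⊗[k] H) :
    Conv k H (B ⊗[k] Hᵐᵒᵖ) :=
  toConv ((opEquiv k H B).toLinearMap ∘ₗ LinearMap.applyₗ z ∘ₗ LinearMap.rTensorHom H ∘ₗ
    act.toLinearMap)

theorem actFstConv_apply (z : B ⊗[k] H) (h : H) :
    actFstConv act z h = opEquiv k H B ((act h).rTensor H z) := rfl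

theorem actFstConv_zero : actFstConv act (0 : B ⊗[k] H) = 0 := by
  ext1; ext1 x; simp [actFstConv_apply]

theorem actFstConv_add (z w : B ⊗[k] H) :
    actFstConv act (z + w) = actFstConv act z + actFstConv act w := by
  ext1; ext1 x; simp [actFstConv_apply]

theorem coactActConv_eq (hYD : IsYetterDrinfeldAlgebra hS act ρ) (b : B) :
    coactActConv act ρ b = sInvR hS B * (actFstConv act (ρ b) * opR k H B) := by
  have e1 (l : H) (z : B ⊗[k] H) : opEquiv k H B (diag act.toLinearMap (LinearMap.mul k H) l z) =
      (actFstConv act z * opR k H B : Conv k H (B ⊗[k] Hᵐᵒᵖ)) l := by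
    rw [LinearMap.convMul_apply, diag, LinearMap.comp_apply]
    generalize comul (R := k) l = t
    induction t with
    | zero => simp
    | add x y hx hy => simp only [map_add, LinearMap.add_apply, hx, hy]
    | tmul p q =>
      rw [map₂_apply_tmul, map_tmul, LinearMap.mul'_apply, actFstConv_apply, opR_apply]
      induction z with
      | zero => simp
      | add x y hx hy => simp only [map_add, add_mul, hx, hy]
      | tmul c u => simp [opEquiv_tmul]
  have e2 (c : H) (z : B ⊗[k] H) : opEquiv k H B ((LinearMap.mulRight k c).lTensor B z) =
      (1 ⊗ₜ op c) * opEquiv k H B z := by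
    induction z with
    | zero => simp
    | add x y hx hy => simp only [map_add, mul_add, hx, hy]
    | tmul c u => simp [opEquiv_tmul]
  ext1; ext1 l
  rw [coactActConv_apply, hYD.compat, (ℛ k l).convMul_apply, map_sum]
  refine Finset.sum_congr rfl fun i _ => ?_
  rw [e2, e1]
  rfl

/-- The Yetter–Drinfeld condition without S⁻¹: (h₍₂₎•b)⁽⁰⁾ ⊗ (h₍₂₎•b)⁽¹⁾h₍₁₎ = h₍₁₎•b⁽⁰⁾ ⊗ h₍₂₎b⁽¹⁾.
-/
theorem opR_mul_coactActConv (hYD : IsYetterDrinfeldAlgebra hS act ρ) (b : B) :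
    opR k H B * coactActConv act ρ b = actFstConv act (ρ b) * opR k H B := by
  rw [coactActConv_eq hYD, ← mul_assoc, opR_mul_sInvR, one_mul]

/-- The function `h ↦ 1 # h`, with values in the opposite algebra. -/
noncomputable def etaOp : Conv k H (Smash hact)ᵐᵒᵖ :=
  Conv.push (AlgHom.op (smashEta hact)) (opConv k H)

/-- The function `h ↦ 1 # S⁻¹(h)`, with values in the opposite algebra. -/
noncomputable def etaOpInv (hS : Function.Bijective (antipode k : H →ₗ[k] H)) :
    Conv k H (Smash hact)ᵐᵒᵖ :=
  Conv.push (AlgHom.op (smashEta hact)) (sInvConv hS)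

theorem etaOpInv_apply (h : H) : etaOpInv hact hS h = op (smashEta hact (sInv hS h)) := rfl

theorem etaOp_mul_etaOpInv : etaOp hact * etaOpInv hact hS = 1 := by
  rw [etaOp, etaOpInv, ← map_mul, opConv_mul_sInvConv, map_one]

theorem etaOpInv_mul_etaOp : etaOpInv hact hS * etaOp hact = 1 := by
  rw [etaOp, etaOpInv, ← map_mul, sInvConv_mul_opConv, map_one]

/-- `t(h₍₂₎ • b) η(h₍₁₎) = η(h) t(b)` -/
theorem etaOp_mul_smashTOp (hYD : IsYetterDrinfeldAlgebra hS act ρ)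
    (hbc : IsBraidedCommutative act ρ) (b : B) :
    etaOp hact * Conv.push (smashTOp hact hYD hbc) (actConv act b) =
      Conv.const (smashTOp hact hYD hbc b) * etaOp hact := by
  let W : B ⊗[k] Hᵐᵒᵖ →ₗ[k] Smash hact :=
    (toSmash hact).toLinearMap ∘ₗ (opEquiv k H B).symm.toLinearMap
  have hW (b : B) (u : H) : W (b ⊗ₜ op u) = smashS hact b * smashEta hact u :=
    toSmash_tmul hact b u
  have h1 (x : H) (z : B ⊗[k] H) :
      W ((1 ⊗ₜ op x) * opEquiv k H B z) = toSmash hact z * smashEta hact x := by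
    induction z with
    | zero => simp
    | add x y hx hy => simp only [map_add, mul_add, add_mul, hx, hy]
    | tmul b u =>
      rw [opEquiv_tmul, Algebra.TensorProduct.tmul_mul_tmul, one_mul, ← op_mul, hW,
        toSmash_tmul, map_mul, mul_assoc]
  have h2 (z : B ⊗[k] H) (h : H) : W ((actFstConv act z * opR k H B : Conv k H _).ofConv h) =
      smashEta hact h * toSmash hact z := by
    induction z with
    | zero => simp [actFstConv_zero]
    | add x y hx hy =>
      simp only [actFstConv_add, map_add, mul_add, add_mul, ofConv_add, LinearMap.add_apply, hx, hy]
    | tmul b u =>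
      have e := LinearMap.congr_fun (congrArg WithConv.ofConv (smashEta_mul_smashS hact b)) h
      rw [Conv.mul_const_apply] at e
      change smashEta hact h * smashS hact b = _ at e
      rw [toSmash_tmul, ← mul_assoc, e]
      refine Conv.apply_congr (F := actFstConv act (b ⊗ₜ u)) (G := opR k H B)
        (F' := Conv.push (smashS hact) (actConv act b)) (G' := Conv.ofAlgHom (smashEta hact))
        W (LinearMap.mulRight k (smashEta hact u)) (fun x y => ?_) h
      rw [actFstConv_apply, opR_apply, LinearMap.rTensor_tmul, opEquiv_tmul,
        Algebra.TensorProduct.tmul_mul_tmul, mul_one, ← op_mul, hW, map_mul, ← mul_assoc]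
      rfl
  ext1; ext1 h
  apply unop_injective
  rw [Conv.const_mul_apply]
  change _ = smashEta hact h * toSmash hact (ρ b)
  -- Under b ⊗ u ↦ s(b)η(u) the two sides of the Yetter–Drinfeld condition become t(h₍₂₎•b)η(h₍₁₎)
  -- and η(h)t(b).
  rw [← h2, ← opR_mul_coactActConv hYD]
  exact Conv.apply_congr (F := etaOp hact)
    (G := Conv.push (smashTOp hact hYD hbc) (actConv act b)) (F' := opR k H B)
    (G' := coactActConv act ρ b) (opLinearEquiv k).symm.toLinearMap W
    (fun x y => (h1 x (ρ (act y b))).symm) h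

/-- The inverse of the antipode, as a homomorphism to the opposite algebra. -/
noncomputable def sInvHom (hS : Function.Bijective (antipode k : H →ₗ[k] H)) : H →ₐ[k] Hᵐᵒᵖ :=
  AlgHom.ofLinearMap ((opLinearEquiv k).toLinearMap ∘ₗ sInv hS) (congrArg op (sInv_one hS))
    fun x y => congrArg op (sInv_mul hS x y)

/-- The commutation rule of η with t, multiplied on both sides by the inverse of η in the opposite
algebra. It is the hypothesis needed to extend s(b) ↦ t(b), η(h) ↦ η(S⁻¹(h)) to an
anti-homomorphism. -/
theorem etaOpInv_mul_smashTOp (hYD : IsYetterDrinfeldAlgebra hS act ρ)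
    (hbc : IsBraidedCommutative act ρ) (b : B) :
    etaOpInv hact hS * Conv.const (smashTOp hact hYD hbc b) =
      Conv.push (smashTOp hact hYD hbc) (actConv act b) * etaOpInv hact hS := by
  have := congrArg (fun F => etaOpInv hact hS * F * etaOpInv hact hS)
    (etaOp_mul_smashTOp hact hYD hbc b)
  rw [← mul_assoc, etaOpInv_mul_etaOp, one_mul, mul_assoc, mul_assoc, etaOp_mul_etaOpInv,
    mul_one] at this
  exact this.symm

/-- The inverse of the antipode of the smash product: `b ↦ t(b)`, `h ↦ S⁻¹(h)`. -/
noncomputable def smashThetaOp (hYD : IsYetterDrinfeldAlgebra hS act ρ)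
    (hbc : IsBraidedCommutative act ρ) : Smash hact →ₐ[k] (Smash hact)ᵐᵒᵖ :=
  Smash.lift hact (smashTOp hact hYD hbc) ((AlgHom.op (smashEta hact)).comp (sInvHom hS))
    (etaOpInv_mul_smashTOp hact hYD hbc)

theorem smashThetaOp_smashS (hYD : IsYetterDrinfeldAlgebra hS act ρ)
    (hbc : IsBraidedCommutative act ρ) (b : B) :
    smashThetaOp hact hYD hbc (smashS hact b) = op (smashTLinear hact ρ b) :=
  Smash.lift_smashS _ _ _ _ _

theorem smashThetaOp_smashEta (hYD : IsYetterDrinfeldAlgebra hS act ρ)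
    (hbc : IsBraidedCommutative act ρ) (h : H) :
    smashThetaOp hact hYD hbc (smashEta hact h) = op (smashEta hact (sInv hS h)) :=
  Smash.lift_smashEta _ _ _ _ _

end SmashTarget

/-! ### The antipode of the smash product -/

section SmashAntipode

variable {k : Type u} {H : Type v} [Field k] [Ring H] [HopfAlgebra k H]
variable {B : Type*} [Ring B] [Algebra k B]
variable {act : H →ₐ[k] Module.End k B} (hact : IsModuleAlgebra act) {ρ : B →ₗ[k] B ⊗[k] H}
variable {hS : Function.Bijective (antipode k : H →ₗ[k] H)}

open MulOpposite

/-- The homomorphism `h ↦ 1 # S(h)` to the opposite algebra. -/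
noncomputable def etaAntipode : H →ₐ[k] (Smash hact)ᵐᵒᵖ :=
  AlgHom.ofLinearMap ((opLinearEquiv k).toLinearMap ∘ₗ (smashEta hact).toLinearMap ∘ₗ antipode k)
    (by simp) fun x y => by simp [antipode_mul_antidistrib]

/-- The map `b ⊗ h ↦ η(S²(h)) s(b)`. -/
noncomputable def smashTauPre : B ⊗[k] H →ₗ[k] Smash hact :=
  (opLinearEquiv k).symm.toLinearMap ∘ₗ LinearMap.mul' k (Smash hact)ᵐᵒᵖ ∘ₗ
    TensorProduct.map ((opLinearEquiv k).toLinearMap ∘ₗ (smashS hact).toLinearMap)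
      (Conv.antipodeOf (etaAntipode hact)).ofConv

theorem smashTauPre_tmul (b : B) (h : H) : smashTauPre hact (b ⊗ₜ h) =
    smashEta hact (antipode k (antipode k h)) * smashS hact b := rfl

/-- The map `b ↦ η(S²(b⁽¹⁾)) s(b⁽⁰⁾)`. -/
noncomputable def smashTauLinear (ρ : B →ₗ[k] B ⊗[k] H) : B →ₗ[k] Smash hact :=
  smashTauPre hact ∘ₗ ρ

theorem op_smashTauLinear : (opLinearEquiv k).toLinearMap ∘ₗ smashTauLinear hact ρ =
    coconv ρ ((opLinearEquiv k).toLinearMap ∘ₗ (smashS hact).toLinearMap)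
      (Conv.antipodeOf (etaAntipode hact)) := rfl

/-- The map `b ↦ S²(b⁽¹⁾) • b⁽⁰⁾`. -/
noncomputable def twistB (act : H →ₐ[k] Module.End k B) (ρ : B →ₗ[k] B ⊗[k] H) : B →ₗ[k] B :=
  TensorProduct.lift (act.toLinearMap ∘ₗ antipode k ∘ₗ antipode k).flip ∘ₗ ρ

/-- The rule of η with t, taken at S²(h), reads t(S²(h)•b) = η(S²(h₍₂₎)) t(b) η(S(h₍₁₎)).
Substituting b⁽⁰⁾, b⁽¹⁾ and using t(b⁽⁰⁾)η(S(b⁽¹⁾)) = s(b) leaves η(S²(b⁽¹⁾))s(b⁽⁰⁾). -/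
theorem smashTLinear_twistB (hYD : IsYetterDrinfeldAlgebra hS act ρ)
    (hbc : IsBraidedCommutative act ρ) (b : B) :
    smashTLinear hact ρ (twistB act ρ b) = smashTauLinear hact ρ b := by
  let K : B ⊗[k] H →ₗ[k] (Smash hact)ᵐᵒᵖ := (opLinearEquiv k).toLinearMap ∘ₗ
    LinearMap.mul' k (Smash hact) ∘ₗ
      TensorProduct.map (smashTLinear hact ρ) (Conv.antipodeOf (smashEta hact)).ofConv
  have h1 : K ∘ₗ ρ = (opLinearEquiv k).toLinearMap ∘ₗ (smashS hact).toLinearMap := by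
    rw [← coconv_smashTLinear hact hYD.toIsComodule]
    rfl
  have h2 : (smashTOp hact hYD hbc).toLinearMap ∘ₗ
      TensorProduct.lift (act.toLinearMap ∘ₗ antipode k ∘ₗ antipode k).flip =
      tensorConv K (Conv.antipodeOf (etaAntipode hact)) := by
    refine TensorProduct.ext' fun b h => ?_
    rw [tensorConv_tmul]
    have e1 : toConv (K ∘ₗ TensorProduct.mk k B H b) =
        Conv.pull (antipodeSq k H) (etaOpInv hact hS) *
          Conv.const (smashTOp hact hYD hbc b) := by
      ext1; ext1 x
      rw [Conv.mul_const_apply, Conv.pull_apply, etaOpInv_apply, antipodeSq_apply, sInv_antipode]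
      rfl
    have e2 : Conv.antipodeOf (etaAntipode hact) = Conv.pull (antipodeSq k H) (etaOp hact) := rfl
    have e3 := congrArg (Conv.pull (antipodeSq k H)) (etaOpInv_mul_smashTOp hact hYD hbc b)
    rw [map_mul, map_mul, Conv.pull_const] at e3
    rw [e1, e2, e3, mul_assoc, ← map_mul, etaOpInv_mul_etaOp, map_one, mul_one]
    rfl
  have h3 := LinearMap.congr_fun
    (coconv_comp hYD.toIsComodule K (Conv.antipodeOf (etaAntipode hact))) b
  rw [h1, ← h2, ← op_smashTauLinear] at h3
  exact op_injective h3.symm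

/-- τ(s(ab)) = η(S²(b⁽¹⁾)) τ(s(a)) s(b⁽⁰⁾), and τ(s(a)), being a value of t, commutes with s(b⁽⁰⁾).
-/
theorem smashTauLinear_mul (hYD : IsYetterDrinfeldAlgebra hS act ρ)
    (hbc : IsBraidedCommutative act ρ) (a b : B) :
    smashTauLinear hact ρ (a * b) = smashTauLinear hact ρ b * smashTauLinear hact ρ a := by
  have key (w : B ⊗[k] H) : smashTauPre hact
      (TensorProduct.map₂ (LinearMap.mul k B) (LinearMap.mul k H).flip (ρ a) w) =
      smashTauPre hact w * smashTauLinear hact ρ a := by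
    induction w with
    | zero => simp
    | add x y hx hy => simp only [map_add, add_mul, hx, hy]
    | tmul b u =>
      rw [smashTauPre_tmul, mul_assoc, ← smashTLinear_twistB hact hYD hbc,
        ← smashTLinear_mul_smashS hact hYD.toIsComodule hbc, smashTLinear_twistB hact hYD hbc]
      change _ = _ * (smashTauPre hact (ρ a) * smashS hact b)
      generalize ρ a = z
      induction z with
      | zero => simp
      | add x y hx hy => simp only [map_add, LinearMap.add_apply, mul_add, add_mul, hx, hy]
      | tmul c x =>
        rw [map₂_apply_tmul, map_tmul, LinearMap.mul_apply', LinearMap.flip_apply,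
          LinearMap.mul_apply', smashTauPre_tmul, smashTauPre_tmul, antipode_mul_antidistrib,
          antipode_mul_antidistrib, map_mul, map_mul]
        simp only [mul_assoc]
  change smashTauPre hact (ρ (a * b)) = _
  rw [hYD.coact_mul, key]
  rfl

theorem smashTauLinear_one (hYD : IsYetterDrinfeldAlgebra hS act ρ) :
    smashTauLinear hact ρ 1 = 1 := by
  change smashTauPre hact (ρ 1) = _
  rw [hYD.coact_one, smashTauPre_tmul]
  simp

/-- The map `b ↦ η(S²(b⁽¹⁾)) s(b⁽⁰⁾)`, as a homomorphism to the opposite algebra. -/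
noncomputable def smashTauB (hYD : IsYetterDrinfeldAlgebra hS act ρ)
    (hbc : IsBraidedCommutative act ρ) : B →ₐ[k] (Smash hact)ᵐᵒᵖ :=
  AlgHom.ofLinearMap ((opLinearEquiv k).toLinearMap ∘ₗ smashTauLinear hact ρ)
    (congrArg op (smashTauLinear_one hact hYD))
    fun x y => congrArg op (smashTauLinear_mul hact hYD hbc x y)

theorem etaAntipode_mul_smashTauB (hYD : IsYetterDrinfeldAlgebra hS act ρ)
    (hbc : IsBraidedCommutative act ρ) (b : B) :
    Conv.ofAlgHom (etaAntipode hact) * Conv.const (smashTauB hact hYD hbc b) =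
      Conv.push (smashTauB hact hYD hbc) (actConv act b) *
        Conv.ofAlgHom (etaAntipode hact) := by
  let χ : B ⊗[k] Hᵐᵒᵖ →ₐ[k] B ⊗[k] H :=
    Algebra.TensorProduct.map (AlgHom.id k B) (antipodeOp k H)
  let ι : H →ₐ[k] B ⊗[k] H := Algebra.TensorProduct.includeRight
  let W : B ⊗[k] H →ₗ[k] Smash hact := (opLinearEquiv k).symm.toLinearMap ∘ₗ
    LinearMap.mul' k (Smash hact)ᵐᵒᵖ ∘ₗ
      TensorProduct.map ((opLinearEquiv k).toLinearMap ∘ₗ (smashS hact).toLinearMap)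
        (etaAntipode hact).toLinearMap
  have hW (b : B) (u : H) : W (b ⊗ₜ u) = smashEta hact (antipode k u) * smashS hact b := rfl
  have c1 : Conv.push χ (sInvR hS B) = Conv.ofAlgHom ι := by
    ext1; ext1 x
    rw [Conv.push_apply, sInvR_apply]
    change (1 : B) ⊗ₜ[k] antipode k (sInv hS x) = _
    rw [antipode_sInv]
    rfl
  have c2 : Conv.push χ (opR k H B) = Conv.antipodeOf ι := rfl
  -- Applying S to the H-component of the Yetter–Drinfeld condition turns S⁻¹(h₍₁₎) into h₍₁₎ and
  -- the last factor into S(h₍₃₎), which one more leg of h cancels on the right.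
  have h0 : Conv.push χ (coactActConv act ρ b) * Conv.ofAlgHom ι =
      Conv.ofAlgHom ι * Conv.push χ (actFstConv act (ρ b)) := by
    rw [coactActConv_eq hYD, map_mul, map_mul, c1, c2, mul_assoc, mul_assoc,
      Conv.antipodeOf_mul_ofAlgHom, mul_one]
  have h1 (x : H) (w : B ⊗[k] H) : W (w * 1 ⊗ₜ x) = smashEta hact (antipode k x) * W w := by
    induction w with
    | zero => simp
    | add x y hx hy => simp only [map_add, mul_add, add_mul, hx, hy]
    | tmul c u =>
      rw [Algebra.TensorProduct.tmul_mul_tmul, mul_one, hW, hW, antipode_mul_antidistrib,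
        map_mul, mul_assoc]
  have h2 (z : B ⊗[k] H) : W (χ (opEquiv k H B z)) = smashTauPre hact z := by
    induction z with
    | zero => simp
    | add x y hx hy => simp only [map_add, hx, hy]
    | tmul c u => rfl
  have h3 (z : B ⊗[k] H) (h : H) :
      W ((Conv.ofAlgHom ι * Conv.push χ (actFstConv act z) : Conv k H _).ofConv h) =
        smashTauPre hact z * smashEta hact (antipode k h) := by
    induction z with
    | zero => simp [actFstConv_zero]
    | add x y hx hy =>
      simp only [actFstConv_add, map_add, mul_add, add_mul, ofConv_add, LinearMap.add_apply, hx, hy]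
    | tmul c u =>
      have e := LinearMap.congr_fun (congrArg WithConv.ofConv (antipodeOf_mul_smashS hact c)) h
      rw [Conv.const_mul_apply, Conv.antipodeOf_apply] at e
      rw [smashTauPre_tmul, mul_assoc, ← e]
      refine Conv.apply_congr (F := Conv.ofAlgHom ι)
        (G := Conv.push χ (actFstConv act (c ⊗ₜ u))) (F' := Conv.antipodeOf (smashEta hact))
        (G' := Conv.push (smashS hact) (actConv act c))
        W (LinearMap.mulLeft k (smashEta hact (antipode k (antipode k u)))) (fun x y => ?_) h
      change W ((1 : B) ⊗ₜ[k] x * act y c ⊗ₜ[k] antipode k u) = _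
      rw [Algebra.TensorProduct.tmul_mul_tmul, one_mul, hW, antipode_mul_antidistrib, map_mul,
        mul_assoc]
      rfl
  ext1; ext1 h
  apply unop_injective
  rw [Conv.mul_const_apply]
  change smashTauPre hact (ρ b) * smashEta hact (antipode k h) = _
  rw [← h3, ← h0]
  refine (Conv.apply_congr (F := Conv.push (smashTauB hact hYD hbc) (actConv act b))
    (G := Conv.ofAlgHom (etaAntipode hact)) (F' := Conv.push χ (coactActConv act ρ b))
    (G' := Conv.ofAlgHom ι) (opLinearEquiv k).symm.toLinearMap W (fun x y => ?_) h).symm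
  change _ = W (χ (opEquiv k H B (ρ (act x b))) * 1 ⊗ₜ y)
  rw [h1, h2]
  rfl

/-- The antipode of the smash product, as a homomorphism to the opposite algebra. -/
noncomputable def smashTauOp (hYD : IsYetterDrinfeldAlgebra hS act ρ)
    (hbc : IsBraidedCommutative act ρ) : Smash hact →ₐ[k] (Smash hact)ᵐᵒᵖ :=
  Smash.lift hact (smashTauB hact hYD hbc) (etaAntipode hact)
    (etaAntipode_mul_smashTauB hact hYD hbc)

variable (hYD : IsYetterDrinfeldAlgebra hS act ρ) (hbc : IsBraidedCommutative act ρ)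

theorem smashTauOp_smashS (b : B) :
    smashTauOp hact hYD hbc (smashS hact b) = op (smashTauLinear hact ρ b) :=
  Smash.lift_smashS _ _ _ _ _

theorem smashTauOp_smashEta (h : H) :
    smashTauOp hact hYD hbc (smashEta hact h) = op (smashEta hact (antipode k h)) :=
  Smash.lift_smashEta _ _ _ _ _

/-- τ(t(b)) = η(S(b⁽²⁾))η(S²(b⁽¹⁾))s(b⁽⁰⁾), and the first two factors are η(S(S(b⁽¹⁾)b⁽²⁾)), which
cancels. -/
theorem smashTauOp_smashTLinear (b : B) :
    smashTauOp hact hYD hbc (smashTLinear hact ρ b) = op (smashS hact b) := by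
  have e : (smashTauOp hact hYD hbc).toLinearMap ∘ₗ smashTLinear hact ρ =
      (opLinearEquiv k).toLinearMap ∘ₗ (smashS hact).toLinearMap := by
    have e1 : (smashTauOp hact hYD hbc).toLinearMap ∘ₗ (smashS hact).toLinearMap =
        (opLinearEquiv k).toLinearMap ∘ₗ smashTauLinear hact ρ :=
      LinearMap.ext fun b => smashTauOp_smashS hact hYD hbc b
    have e2 : Conv.push (smashTauOp hact hYD hbc) (Conv.ofAlgHom (smashEta hact)) =
        Conv.ofAlgHom (etaAntipode hact) := by
      ext1; ext1 h
      exact smashTauOp_smashEta hact hYD hbc h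
    rw [smashTLinear_eq_coconv, comp_coconv, e1, e2, op_smashTauLinear,
      ← coconv_mul hYD.toIsComodule, Conv.antipodeOf_mul_ofAlgHom, coconv_one hYD.toIsComodule]
  exact LinearMap.congr_fun e b

/-- The inverse sends η(S²(b⁽¹⁾))s(b⁽⁰⁾) to t(b⁽⁰⁾)η(S(b⁽¹⁾)), which is s(b). -/
theorem smashThetaOp_smashTauLinear (b : B) :
    smashThetaOp hact hYD hbc (smashTauLinear hact ρ b) = op (smashS hact b) := by
  let χ : (Smash hact)ᵐᵒᵖ →ₐ[k] Smash hact :=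
    AlgHom.ofLinearMap ((opLinearEquiv k).symm.toLinearMap ∘ₗ
        (smashThetaOp hact hYD hbc).toLinearMap ∘ₗ (opLinearEquiv k).symm.toLinearMap)
      (by simp) fun x y => by simp
  have e : χ.toLinearMap ∘ₗ (opLinearEquiv k).toLinearMap ∘ₗ smashTauLinear hact ρ =
      (smashS hact).toLinearMap := by
    have e1 : χ.toLinearMap ∘ₗ (opLinearEquiv k).toLinearMap ∘ₗ (smashS hact).toLinearMap =
        smashTLinear hact ρ :=
      LinearMap.ext fun b => congrArg unop (smashThetaOp_smashS hact hYD hbc b)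
    have e2 : Conv.push χ (Conv.antipodeOf (etaAntipode hact)) =
        Conv.antipodeOf (smashEta hact) := by
      ext1; ext1 h
      have := congrArg unop
        (smashThetaOp_smashEta hact hYD hbc (antipode k (antipode k h)))
      rw [sInv_antipode] at this
      exact this
    rw [op_smashTauLinear, comp_coconv, e1, e2, coconv_smashTLinear hact hYD.toIsComodule]
  exact unop_injective (LinearMap.congr_fun e b)

theorem smashThetaOp_smashTauOp (r : Smash hact) :
    unop (smashThetaOp hact hYD hbc (unop (smashTauOp hact hYD hbc r))) = r := by
  induction r using Smash.induction with
  | zero => simp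
  | add x y hx hy => simp only [map_add, unop_add, hx, hy]
  | tmul b h =>
    rw [map_mul, unop_mul, map_mul, unop_mul, smashTauOp_smashS, smashTauOp_smashEta, unop_op,
      unop_op, smashThetaOp_smashTauLinear, smashThetaOp_smashEta, sInv_antipode, unop_op, unop_op]

theorem smashTauOp_smashThetaOp (r : Smash hact) :
    unop (smashTauOp hact hYD hbc (unop (smashThetaOp hact hYD hbc r))) = r := by
  induction r using Smash.induction with
  | zero => simp
  | add x y hx hy => simp only [map_add, unop_add, hx, hy]
  | tmul b h =>
    rw [map_mul, unop_mul, map_mul, unop_mul, smashThetaOp_smashS, smashThetaOp_smashEta, unop_op,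
      unop_op, smashTauOp_smashTLinear, smashTauOp_smashEta, antipode_sInv, unop_op, unop_op]

/-- The antipode of the smash product: `b ↦ η(S²(b⁽¹⁾)) s(b⁽⁰⁾)`, `h ↦ S(h)`. -/
noncomputable def smashTau : Smash hact ≃ₗ[k] Smash hact where
  toLinearMap := (opLinearEquiv k).symm.toLinearMap ∘ₗ (smashTauOp hact hYD hbc).toLinearMap
  invFun r := unop (smashThetaOp hact hYD hbc r)
  left_inv r := smashThetaOp_smashTauOp hact hYD hbc r
  right_inv r := smashTauOp_smashThetaOp hact hYD hbc r

theorem smashTau_apply (r : Smash hact) :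
    smashTau hact hYD hbc r = unop (smashTauOp hact hYD hbc r) := rfl

theorem smashTau_symm_apply (r : Smash hact) :
    (smashTau hact hYD hbc).symm r = unop (smashThetaOp hact hYD hbc r) := rfl

theorem smashTau_mul (r r' : Smash hact) : smashTau hact hYD hbc (r * r') =
    smashTau hact hYD hbc r' * smashTau hact hYD hbc r := by
  rw [smashTau_apply, map_mul, unop_mul]
  rfl

theorem smashTau_symm_mul (r r' : Smash hact) : (smashTau hact hYD hbc).symm (r * r') =
    (smashTau hact hYD hbc).symm r' * (smashTau hact hYD hbc).symm r := by
  rw [smashTau_symm_apply, map_mul, unop_mul]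
  rfl

theorem smashTau_smashTLinear (b : B) :
    smashTau hact hYD hbc (smashTLinear hact ρ b) = smashS hact b :=
  congrArg unop (smashTauOp_smashTLinear hact hYD hbc b)

theorem smashTau_smashS (b : B) :
    smashTau hact hYD hbc (smashS hact b) = smashTauLinear hact ρ b :=
  congrArg unop (smashTauOp_smashS hact hYD hbc b)

theorem smashTau_smashEta (h : H) :
    smashTau hact hYD hbc (smashEta hact h) = smashEta hact (antipode k h) :=
  congrArg unop (smashTauOp_smashEta hact hYD hbc h)

theorem smashTau_symm_smashS (b : B) :
    (smashTau hact hYD hbc).symm (smashS hact b) = smashTLinear hact ρ b :=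
  congrArg unop (smashThetaOp_smashS hact hYD hbc b)

theorem smashTau_symm_smashEta (h : H) :
    (smashTau hact hYD hbc).symm (smashEta hact h) = smashEta hact (sInv hS h) :=
  congrArg unop (smashThetaOp_smashEta hact hYD hbc h)

end SmashAntipode

/-! ### Relations of the balanced tensor product -/

section BalancedTensor

variable {k : Type u} [Field k] {A R : Type*} [Ring A] [Algebra k A] [Ring R] [Algebra k R]

open MulOpposite

variable {s : A →ₐ[k] R} {t : Aᵐᵒᵖ →ₐ[k] R}

theorem balMk_eq_iff {x y : R ⊗[k] R} : balMk s t x = balMk s t y ↔ x - y ∈ balRel s t :=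
  Submodule.Quotient.eq _

theorem sub_mem_balRel (a : A) (x y : R) :
    (t (op a) * x) ⊗ₜ[k] y - x ⊗ₜ[k] (s a * y) ∈ balRel s t :=
  Submodule.subset_span ⟨a, x, y, rfl⟩

theorem map_mem_of_mem_balRel {X : Type*} [AddCommGroup X] [Module k X] {N : Submodule k X}
    (F : R ⊗[k] R →ₗ[k] X)
    (h : ∀ a x y, F ((t (op a) * x) ⊗ₜ[k] y) - F (x ⊗ₜ[k] (s a * y)) ∈ N)
    {z : R ⊗[k] R} (hz : z ∈ balRel s t) : F z ∈ N := by
  induction hz using Submodule.span_induction with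
  | mem z hz =>
    obtain ⟨a, x, y, rfl⟩ := hz
    rw [map_sub]
    exact h a x y
  | zero => rw [map_zero]; exact zero_mem _
  | add x y _ _ hx hy => rw [map_add]; exact add_mem hx hy
  | smul r x _ hx => rw [map_smul]; exact N.smul_mem r hx

/-- Linear maps compatible with the relations of `R ⊗_A R` depend only on classes. -/
theorem map_eq_of_balMk_eq {X : Type*} [AddCommGroup X] [Module k X] (F : R ⊗[k] R →ₗ[k] X)
    (h : ∀ a x y, F ((t (op a) * x) ⊗ₜ[k] y) = F (x ⊗ₜ[k] (s a * y)))
    {z w : R ⊗[k] R} (hz : balMk s t z = balMk s t w) : F z = F w := by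
  have := map_mem_of_mem_balRel (N := ⊥) F (fun a x y => by rw [h, sub_self]; exact zero_mem _)
    (balMk_eq_iff.1 hz)
  rwa [Submodule.mem_bot, map_sub, sub_eq_zero] at this

/-- The relations involve left multiplication only, so right multiplication preserves them. -/
theorem balRel_mul_mem {z : R ⊗[k] R} (hz : z ∈ balRel s t) (w : R ⊗[k] R) :
    z * w ∈ balRel s t := by
  induction w with
  | zero => rw [mul_zero]; exact zero_mem _
  | add x y hx hy => rw [mul_add]; exact add_mem hx hy
  | tmul c d =>
    refine map_mem_of_mem_balRel (LinearMap.mulRight k (c ⊗ₜ[k] d)) (fun a x y => ?_) hz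
    rw [LinearMap.mulRight_apply, LinearMap.mulRight_apply, Algebra.TensorProduct.tmul_mul_tmul,
      Algebra.TensorProduct.tmul_mul_tmul, mul_assoc, mul_assoc]
    exact sub_mem_balRel _ _ _

/-- Left multiplication by s(a) ⊗ t(b) respects the relations because s and t commute. -/
theorem tmul_mul_balRel_mem (hst : ∀ a b, s a * t b = t b * s a) (a : A) (b : Aᵐᵒᵖ)
    {z : R ⊗[k] R} (hz : z ∈ balRel s t) : (s a ⊗ₜ[k] t b) * z ∈ balRel s t := by
  refine map_mem_of_mem_balRel (LinearMap.mulLeft k (s a ⊗ₜ[k] t b)) (fun c x y => ?_) hz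
  rw [LinearMap.mulLeft_apply, LinearMap.mulLeft_apply, Algebra.TensorProduct.tmul_mul_tmul,
    Algebra.TensorProduct.tmul_mul_tmul, ← mul_assoc, ← mul_assoc, hst, ← hst c, mul_assoc,
    mul_assoc]
  exact sub_mem_balRel _ _ _

/-- The elements `t(a) ⊗ 1 - 1 ⊗ s(a)` generate the relations as a right ideal. -/
theorem mul_balRel_mem {d : R ⊗[k] R}
    (hd : ∀ a, d * (t (op a) ⊗ₜ[k] 1 - 1 ⊗ₜ[k] s a) ∈ balRel s t)
    {z : R ⊗[k] R} (hz : z ∈ balRel s t) : d * z ∈ balRel s t := by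
  refine map_mem_of_mem_balRel (LinearMap.mulLeft k d) (fun a x y => ?_) hz
  have := balRel_mul_mem (hd a) (x ⊗ₜ[k] y)
  rw [mul_assoc, sub_mul, Algebra.TensorProduct.tmul_mul_tmul,
    Algebra.TensorProduct.tmul_mul_tmul, one_mul, one_mul, mul_sub] at this
  exact this

theorem assoc_tmul_mem_balRel₃ {z : R ⊗[k] R} (hz : z ∈ balRel s t) (w : R) :
    TensorProduct.assoc k R R R (z ⊗ₜ w) ∈ balRel₃ s t :=
  map_mem_of_mem_balRel ((TensorProduct.assoc k R R R).toLinearMap ∘ₗ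
    (TensorProduct.mk k (R ⊗[k] R) R).flip w) (fun a x y =>
      Submodule.subset_span (Or.inl ⟨a, x, y, w, rfl⟩)) hz

theorem tmul_mem_balRel₃ {z : R ⊗[k] R} (hz : z ∈ balRel s t) (x : R) :
    x ⊗ₜ z ∈ balRel₃ s t :=
  map_mem_of_mem_balRel (TensorProduct.mk k R (R ⊗[k] R) x) (fun a y w =>
      Submodule.subset_span (Or.inr ⟨a, x, y, w, rfl⟩)) hz

end BalancedTensor

/-! ### The lifted comultiplication modulo the balancing relations -/

section SmashBalanced

variable {k : Type u} {H : Type v} [Field k] [Ring H] [HopfAlgebra k H]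
variable {B : Type*} [Ring B] [Algebra k B]
variable {act : H →ₐ[k] Module.End k B} (hact : IsModuleAlgebra act) {ρ : B →ₗ[k] B ⊗[k] H}
variable {hS : Function.Bijective (antipode k : H →ₗ[k] H)}
variable (hYD : IsYetterDrinfeldAlgebra hS act ρ) (hbc : IsBraidedCommutative act ρ)

open MulOpposite

theorem smashT_op (b : B) : smashT hact hYD hbc (op b) = smashTLinear hact ρ b := rfl

theorem smashS_mul_smashT (a : B) (b : Bᵐᵒᵖ) :
    smashS hact a * smashT hact hYD hbc b = smashT hact hYD hbc b * smashS hact a :=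
  (smashTLinear_mul_smashS hact hYD.toIsComodule hbc a (unop b)).symm

theorem smashS_tmul_one_mul_mem (b : B) {z : Smash hact ⊗[k] Smash hact}
    (hz : z ∈ balRel (smashS hact) (smashT hact hYD hbc)) :
    (smashS hact b ⊗ₜ[k] 1) * z ∈ balRel (smashS hact) (smashT hact hYD hbc) := by
  have := tmul_mul_balRel_mem (smashS_mul_smashT hact hYD hbc) b 1 hz
  rwa [map_one] at this

/-- `η(h) t(b) = t(h₍₂₎ • b) η(h₍₁₎)` -/
theorem smashEta_mul_smashTLinear (hYD : IsYetterDrinfeldAlgebra hS act ρ)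
    (hbc : IsBraidedCommutative act ρ) (h : H) (b : B) :
    smashEta hact h * smashTLinear hact ρ b = LinearMap.mul' k (Smash hact)
      (TensorProduct.map (smashTLinear hact ρ ∘ₗ act.toLinearMap.flip b)
        (smashEta hact).toLinearMap (TensorProduct.comm k H H (comul h))) := by
  have e := LinearMap.congr_fun (congrArg WithConv.ofConv (etaOp_mul_smashTOp hact hYD hbc b)) h
  rw [Conv.const_mul_apply] at e
  have e' := congrArg unop e
  refine Eq.trans (Eq.symm e') ?_
  rw [LinearMap.convMul_apply]
  generalize comul (R := k) h = z
  induction z with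
  | zero => simp
  | tmul x y => rfl
  | add x y hx hy => simp only [map_add, unop_add, hx, hy]

theorem smashEta_mul_smashS_apply (h : H) (b : B) :
    smashEta hact h * smashS hact b = LinearMap.mul' k (Smash hact)
      (TensorProduct.map ((smashS hact).toLinearMap ∘ₗ act.toLinearMap.flip b)
        (smashEta hact).toLinearMap (comul h)) := by
  have e := LinearMap.congr_fun (congrArg WithConv.ofConv (smashEta_mul_smashS hact b)) h
  rw [Conv.mul_const_apply] at e
  exact e

/-- η(h₍₁₎)t(a) ⊗ η(h₍₂₎) = t(h₍₂₎•a)η(h₍₁₎) ⊗ η(h₍₃₎), and balancing moves h₍₂₎•a to the second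
factor as s(h₍₂₎•a)η(h₍₃₎), where it recombines to η(h₍₂₎)s(a). -/
theorem comulEta_mul_sub_mem (h : H) (a : B) :
    comulEta hact h * (smashTLinear hact ρ a ⊗ₜ[k] 1 - 1 ⊗ₜ[k] smashS hact a) ∈
      balRel (smashS hact) (smashT hact hYD hbc) := by
  let η := (smashEta hact).toLinearMap
  let U : H ⊗[k] (H ⊗[k] H) →ₗ[k] Smash hact ⊗[k] Smash hact :=
    TensorProduct.map (LinearMap.mul' k (Smash hact) ∘ₗ
      TensorProduct.map (smashTLinear hact ρ ∘ₗ act.toLinearMap.flip a) η ∘ₗ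
        (TensorProduct.comm k H H).toLinearMap) η ∘ₗ (TensorProduct.assoc k H H H).symm.toLinearMap
  let U' : H ⊗[k] (H ⊗[k] H) →ₗ[k] Smash hact ⊗[k] Smash hact :=
    TensorProduct.map η (LinearMap.mul' k (Smash hact) ∘ₗ
      TensorProduct.map ((smashS hact).toLinearMap ∘ₗ act.toLinearMap.flip a) η)
  have h1 (p : H ⊗[k] (H ⊗[k] H)) :
      U p - U' p ∈ balRel (smashS hact) (smashT hact hYD hbc) := by
    induction p with
    | zero => rw [map_zero, map_zero, sub_zero]; exact zero_mem _
    | add x y hx hy => rw [map_add, map_add, add_sub_add_comm]; exact add_mem hx hy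
    | tmul x q =>
      induction q with
      | zero => rw [tmul_zero, map_zero, map_zero, sub_zero]; exact zero_mem _
      | add y z hy hz =>
        rw [tmul_add, map_add, map_add, add_sub_add_comm]; exact add_mem hy hz
      | tmul y z => exact sub_mem_balRel (t := smashT hact hYD hbc) (act y a) _ _
  have h2 : comulEta hact h * smashTLinear hact ρ a ⊗ₜ[k] 1 =
      U (TensorProduct.assoc k H H H (comul.rTensor H (comul h))) := by
    rw [comulEta_apply]
    generalize comul (R := k) h = z
    induction z with
    | zero => simp
    | add x y hx hy => simp only [map_add, add_mul, hx, hy]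
    | tmul x y =>
      rw [map_tmul, Algebra.TensorProduct.tmul_mul_tmul, mul_one, AlgHom.toLinearMap_apply,
        smashEta_mul_smashTLinear hact hYD hbc]
      simp only [U, LinearMap.comp_apply, LinearEquiv.coe_coe, LinearEquiv.symm_apply_apply]
      rfl
  have h3 : comulEta hact h * 1 ⊗ₜ[k] smashS hact a = U' (comul.lTensor H (comul h)) := by
    rw [comulEta_apply]
    generalize comul (R := k) h = z
    induction z with
    | zero => simp
    | add x y hx hy => simp only [map_add, add_mul, hx, hy]
    | tmul x y =>
      rw [map_tmul, Algebra.TensorProduct.tmul_mul_tmul, mul_one, AlgHom.toLinearMap_apply,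
        AlgHom.toLinearMap_apply, smashEta_mul_smashS_apply]
      rfl
  rw [mul_sub, h2, h3, Coalgebra.coassoc_apply]
  exact h1 _

/-- The image of the comultiplication lies in the Takeuchi product. -/
theorem smashComul_mul_sub_mem (r : Smash hact) (a : B) :
    smashComul hact r * (smashTLinear hact ρ a ⊗ₜ[k] 1 - 1 ⊗ₜ[k] smashS hact a) ∈
      balRel (smashS hact) (smashT hact hYD hbc) := by
  induction r using Smash.induction with
  | zero => rw [map_zero, zero_mul]; exact zero_mem _
  | add x y hx hy => rw [map_add, add_mul]; exact add_mem hx hy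
  | tmul b h =>
    rw [map_mul, smashComul_smashS, smashComul_smashEta, mul_assoc]
    exact smashS_tmul_one_mul_mem hact hYD hbc b (comulEta_mul_sub_mem hact hYD hbc h a)

/-- The Takeuchi condition for the generators t(a) ⊗ 1 - 1 ⊗ s(a) of this right ideal extends to the
whole ideal. This is why products in R ⊗_k R may be reduced factor by factor. -/
theorem smashComul_mul_balRel_mem (r : Smash hact) {z : Smash hact ⊗[k] Smash hact}
    (hz : z ∈ balRel (smashS hact) (smashT hact hYD hbc)) :
    smashComul hact r * z ∈ balRel (smashS hact) (smashT hact hYD hbc) :=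
  mul_balRel_mem (fun a => smashComul_mul_sub_mem hact hYD hbc r a) hz

/-- `Δ(t(b)) = 1 ⊗ t(b)` -/
theorem smashComul_smashTLinear (b : B) :
    smashComul hact (smashTLinear hact ρ b) - 1 ⊗ₜ smashTLinear hact ρ b ∈
      balRel (smashS hact) (smashT hact hYD hbc) := by
  let iL : Smash hact →ₐ[k] Smash hact ⊗[k] Smash hact := Algebra.TensorProduct.includeLeft
  -- The lift sends t(b) to t(b⁽⁰⁾) ⊗ η(b⁽¹⁾); balancing then moves t(b⁽⁰⁾) across as s(b⁽⁰⁾).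
  have e : (smashComul hact).toLinearMap ∘ₗ smashTLinear hact ρ =
      coconv ρ (iL.toLinearMap ∘ₗ smashTLinear hact ρ) (etaR hact) := by
    have e1 : (smashComul hact).toLinearMap ∘ₗ (smashS hact).toLinearMap =
        iL.toLinearMap ∘ₗ (smashS hact).toLinearMap :=
      LinearMap.ext fun b => smashComul_smashS hact b
    have e2 : Conv.push (smashComul hact) (Conv.ofAlgHom (smashEta hact)) =
        Conv.push iL (Conv.ofAlgHom (smashEta hact)) * etaR hact := by
      refine Eq.trans ?_ (ofAlgHom_comulEta hact)
      ext1; ext1 h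
      exact smashComul_smashEta hact h
    rw [smashTLinear_eq_coconv, comp_coconv, e1, e2, coconv_mul hYD.toIsComodule, comp_coconv]
  have key (z : B ⊗[k] H) : LinearMap.mul' k (Smash hact ⊗[k] Smash hact)
      (TensorProduct.map (iL.toLinearMap ∘ₗ smashTLinear hact ρ) (etaR hact).ofConv z) -
        1 ⊗ₜ toSmash hact z ∈ balRel (smashS hact) (smashT hact hYD hbc) := by
    induction z with
    | zero => rw [map_zero, map_zero, map_zero, tmul_zero, sub_zero]; exact zero_mem _
    | add x y hx hy =>
      rw [map_add, map_add, map_add, tmul_add, add_sub_add_comm]; exact add_mem hx hy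
    | tmul c u =>
      have := sub_mem_balRel (s := smashS hact) (t := smashT hact hYD hbc) c 1 (smashEta hact u)
      rw [mul_one, ← toSmash_tmul, smashT_op] at this
      rw [map_tmul, LinearMap.mul'_apply, etaR_apply]
      change smashTLinear hact ρ c ⊗ₜ[k] 1 * 1 ⊗ₜ smashEta hact u - _ ∈ _
      rw [Algebra.TensorProduct.tmul_mul_tmul, mul_one, one_mul]
      exact this
  have h := key (ρ b)
  have e' := LinearMap.congr_fun e b
  rw [LinearMap.comp_apply, AlgHom.toLinearMap_apply] at e'
  rw [e']
  exact h

/-- The function `h ↦ (1 # h) ⊗ 1`, with values in the opposite algebra. -/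
noncomputable def etaOpL : Conv k H (Smash hact ⊗[k] Smash hact)ᵐᵒᵖ :=
  Conv.push (AlgHom.op (Algebra.TensorProduct.includeLeft
    (R := k) (S := k) (A := Smash hact) (B := Smash hact))) (etaOp hact)

/-- The function `h ↦ 1 ⊗ (1 # h)`, with values in the opposite algebra. -/
noncomputable def etaOpR : Conv k H (Smash hact ⊗[k] Smash hact)ᵐᵒᵖ :=
  Conv.push (AlgHom.op (Algebra.TensorProduct.includeRight
    (R := k) (A := Smash hact) (B := Smash hact))) (etaOp hact)

theorem etaOpL_apply (h : H) : etaOpL hact h = op (smashEta hact h ⊗ₜ 1) := rfl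

theorem etaOpR_apply (h : H) : etaOpR hact h = op (1 ⊗ₜ smashEta hact h) := rfl

theorem push_smashComul_etaOp :
    Conv.push (AlgHom.op (smashComul hact)) (etaOp hact) = etaOpL hact * etaOpR hact := by
  ext1; ext1 h
  rw [LinearMap.convMul_apply]
  change op (smashComul hact (smashEta hact h)) = _
  rw [smashComul_smashEta, comulEta_apply]
  generalize comul (R := k) h = z
  induction z with
  | zero => simp
  | add x y hx hy => simp only [map_add, op_add, hx, hy]
  | tmul x y => simp [etaOpL_apply, etaOpR_apply, ← op_mul]

/-- Moves η to the right of s: S² is a coalgebra map, so η(S²(h))s(b) = s(S²(h₍₁₎)•b)η(S²(h₍₂₎)).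
This is the form of τ(s(b)) that arises after balancing. -/
theorem smashTauLinear_eq_coconv (hρ : IsComodule ρ) :
    smashTauLinear hact ρ = coconv ρ ((smashS hact).toLinearMap ∘ₗ twistB act ρ)
      (Conv.pull (antipodeSq k H) (Conv.ofAlgHom (smashEta hact))) := by
  have e : (smashS hact).toLinearMap ∘ₗ twistB act ρ = ((smashS hact).toLinearMap ∘ₗ
      TensorProduct.lift (act.toLinearMap ∘ₗ antipode k ∘ₗ antipode k).flip) ∘ₗ ρ := rfl
  rw [e, coconv_comp hρ, smashTauLinear]
  congr 1
  refine TensorProduct.ext' fun b h => ?_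
  rw [tensorConv_tmul]
  have e3 := congrArg (Conv.pull (antipodeSq k H)) (smashEta_mul_smashS hact b)
  rw [map_mul, map_mul, Conv.pull_const] at e3
  have e4 := LinearMap.congr_fun (congrArg WithConv.ofConv e3) h
  rw [Conv.mul_const_apply] at e4
  exact e4

/-- `Δ(τ(s(b))) = 1 ⊗ τ(s(b))` -/
theorem smashComul_smashTauLinear (b : B) :
    smashComul hact (smashTauLinear hact ρ b) - 1 ⊗ₜ smashTauLinear hact ρ b ∈
      balRel (smashS hact) (smashT hact hYD hbc) := by
  let iL : Smash hact →ₐ[k] Smash hact ⊗[k] Smash hact := Algebra.TensorProduct.includeLeft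
  let E := Conv.pull (antipodeSq k H) (Conv.ofAlgHom (smashEta hact))
  -- The lift gives τ(s(b⁽⁰⁾)) ⊗ η(S²(b⁽¹⁾)). Its first factor is t(S²(b⁽¹⁾)•b⁽⁰⁾) formed from b⁽⁰⁾,
  -- so it can be balanced across.
  have e : (opLinearEquiv k).toLinearMap ∘ₗ (smashComul hact).toLinearMap ∘ₗ
      smashTauLinear hact ρ =
      coconv ρ ((AlgHom.op iL).toLinearMap ∘ₗ (opLinearEquiv k).toLinearMap ∘ₗ
        smashTauLinear hact ρ) (Conv.pull (antipodeSq k H) (etaOpR hact)) := by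
    have e1 : (AlgHom.op (smashComul hact)).toLinearMap ∘ₗ (opLinearEquiv k).toLinearMap ∘ₗ
        (smashS hact).toLinearMap = (AlgHom.op iL).toLinearMap ∘ₗ
          (opLinearEquiv k).toLinearMap ∘ₗ (smashS hact).toLinearMap :=
      LinearMap.ext fun b => congrArg op (smashComul_smashS hact b)
    have e0 : Conv.antipodeOf (etaAntipode hact) = Conv.pull (antipodeSq k H) (etaOp hact) := rfl
    have e2 : Conv.push (AlgHom.op (smashComul hact)) (Conv.antipodeOf (etaAntipode hact)) =
        Conv.push (AlgHom.op iL) (Conv.antipodeOf (etaAntipode hact)) *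
          Conv.pull (antipodeSq k H) (etaOpR hact) := by
      rw [e0, Conv.push_pull, push_smashComul_etaOp, map_mul]
      rfl
    change (AlgHom.op (smashComul hact)).toLinearMap ∘ₗ (opLinearEquiv k).toLinearMap ∘ₗ
      smashTauLinear hact ρ = _
    rw [op_smashTauLinear, comp_coconv, e1, e2, coconv_mul hYD.toIsComodule, comp_coconv]
  have key (z : B ⊗[k] H) : unop (LinearMap.mul' k (Smash hact ⊗[k] Smash hact)ᵐᵒᵖ
      (TensorProduct.map ((AlgHom.op iL).toLinearMap ∘ₗ (opLinearEquiv k).toLinearMap ∘ₗ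
        smashTauLinear hact ρ) (Conv.pull (antipodeSq k H) (etaOpR hact)).ofConv z)) -
      1 ⊗ₜ LinearMap.mul' k (Smash hact) (TensorProduct.map
        ((smashS hact).toLinearMap ∘ₗ twistB act ρ) E.ofConv z) ∈
        balRel (smashS hact) (smashT hact hYD hbc) := by
    induction z with
    | zero => simp
    | add x y hx hy =>
      simp only [map_add, tmul_add, unop_add]
      rw [add_sub_add_comm]; exact add_mem hx hy
    | tmul c u =>
      have := sub_mem_balRel (s := smashS hact) (t := smashT hact hYD hbc) (twistB act ρ c) 1
        (smashEta hact (antipodeSq k H u))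
      rw [mul_one, smashT_op, smashTLinear_twistB hact hYD hbc] at this
      rw [map_tmul, LinearMap.mul'_apply, map_tmul, LinearMap.mul'_apply]
      change (1 : Smash hact) ⊗ₜ[k] smashEta hact (antipodeSq k H u) *
        smashTauLinear hact ρ c ⊗ₜ[k] 1 - _ ∈ _
      rw [Algebra.TensorProduct.tmul_mul_tmul, mul_one, one_mul]
      exact this
  have h := key (ρ b)
  have e' := congrArg unop (LinearMap.congr_fun e b)
  have e'' := LinearMap.congr_fun (smashTauLinear_eq_coconv hact hYD.toIsComodule) b
  change smashComul hact (smashTauLinear hact ρ b) = _ at e'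
  rw [e']
  conv in 1 ⊗ₜ[k] _ => rw [e'']
  exact h

end SmashBalanced

/-! ### The left bialgebroid structure -/

section SmashBialgebroid

variable {k : Type u} {H : Type v} [Field k] [Ring H] [HopfAlgebra k H]
variable {B : Type*} [Ring B] [Algebra k B]
variable {act : H →ₐ[k] Module.End k B} (hact : IsModuleAlgebra act) {ρ : B →ₗ[k] B ⊗[k] H}
variable {hS : Function.Bijective (antipode k : H →ₗ[k] H)}
variable (hYD : IsYetterDrinfeldAlgebra hS act ρ) (hbc : IsBraidedCommutative act ρ)

open MulOpposite

/-- In the representation on B, braided commutativity says that t(b) acts by right multiplication by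
b. -/
theorem smashRep_smashTLinear (hbc : IsBraidedCommutative act ρ) (b c : B) :
    smashRep hact (smashTLinear hact ρ b) c = c * b := by
  rw [← hbc]
  change smashRep hact (toSmash hact (ρ b)) c = _
  generalize ρ b = z
  induction z with
  | zero => simp
  | add x y hx hy => simp only [map_add, LinearMap.add_apply, hx, hy]
  | tmul x h =>
    rw [toSmash_tmul, map_mul, Module.End.mul_apply, smashRep_smashS, smashRep_smashEta]
    rfl

theorem smashCounit_smashS_mul (a : B) (r : Smash hact) :
    smashCounit hact (smashS hact a * r) = a * smashCounit hact r := by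
  rw [smashCounit_mul, smashRep_smashS]

theorem smashCounit_smashTLinear_mul (hbc : IsBraidedCommutative act ρ) (a : B)
    (r : Smash hact) :
    smashCounit hact (smashTLinear hact ρ a * r) = smashCounit hact r * a := by
  rw [smashCounit_mul, smashRep_smashTLinear hact hbc]

/-- The two iterated lifts are algebra maps over k, so it suffices to compare them on s(b) and η(h).
-/
theorem smashComul_coassoc (r : Smash hact) :
    TensorProduct.assoc k _ _ _ ((smashComul hact).toLinearMap.rTensor (Smash hact)
        (smashComul hact r)) =
      (smashComul hact).toLinearMap.lTensor (Smash hact) (smashComul hact r) := by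
  obtain ⟨φ, hφ⟩ : ∃ φ : Smash hact →ₐ[k] Smash hact ⊗[k] (Smash hact ⊗[k] Smash hact),
      ∀ r, φ r = TensorProduct.assoc k _ _ _
        ((smashComul hact).toLinearMap.rTensor (Smash hact) (smashComul hact r)) :=
    ⟨(Algebra.TensorProduct.assoc k k k (Smash hact) (Smash hact) (Smash hact)).toAlgHom.comp
      ((Algebra.TensorProduct.map (smashComul hact) (AlgHom.id k (Smash hact))).comp (smashComul hact)),
      fun _ => rfl⟩
  obtain ⟨ψ, hψ⟩ : ∃ ψ : Smash hact →ₐ[k] Smash hact ⊗[k] (Smash hact ⊗[k] Smash hact),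
      ∀ r, ψ r = (smashComul hact).toLinearMap.lTensor (Smash hact) (smashComul hact r) :=
    ⟨(Algebra.TensorProduct.map (AlgHom.id k (Smash hact)) (smashComul hact)).comp (smashComul hact),
      fun _ => rfl⟩
  have e : φ = ψ := by
    refine Smash.algHom_ext (C := Smash hact ⊗[k] (Smash hact ⊗[k] Smash hact)) hact (fun b => ?_) (fun h => ?_)
    · rw [hφ, hψ, smashComul_smashS, LinearMap.rTensor_tmul, AlgHom.toLinearMap_apply,
        smashComul_smashS, assoc_tmul, LinearMap.lTensor_tmul, AlgHom.toLinearMap_apply, map_one]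
      rfl
    · rw [hφ, hψ, smashComul_smashEta, comulEta_apply]
      let η := (smashEta hact).toLinearMap
      have h1 (z : H ⊗[k] H) : TensorProduct.assoc k _ _ _
          ((smashComul hact).toLinearMap.rTensor (Smash hact) (TensorProduct.map η η z)) =
          TensorProduct.map η (TensorProduct.map η η)
            (TensorProduct.assoc k H H H (comul.rTensor H z)) := by
        induction z with
        | zero => simp
        | add x y hx hy => simp only [map_add, hx, hy]
        | tmul x y =>
          rw [map_tmul, LinearMap.rTensor_tmul, LinearMap.rTensor_tmul]
          change TensorProduct.assoc k _ _ _ (smashComul hact (smashEta hact x) ⊗ₜ[k] η y) = _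
          rw [smashComul_smashEta, comulEta_apply]
          generalize comul (R := k) x = w
          induction w with
          | zero => simp
          | add x y hx hy => simp only [map_add, add_tmul, hx, hy]
          | tmul p q => rfl
      have h2 (z : H ⊗[k] H) :
          (smashComul hact).toLinearMap.lTensor (Smash hact) (TensorProduct.map η η z) =
          TensorProduct.map η (TensorProduct.map η η) (comul.lTensor H z) := by
        induction z with
        | zero => simp
        | add x y hx hy => simp only [map_add, hx, hy]
        | tmul x y =>
          rw [map_tmul, LinearMap.lTensor_tmul, LinearMap.lTensor_tmul, map_tmul]
          change η x ⊗ₜ[k] smashComul hact (smashEta hact y) = _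
          rw [smashComul_smashEta, comulEta_apply]
      rw [h1, h2, Coalgebra.coassoc_apply]
  rw [← hφ, ← hψ, e]

/-- The comultiplication `Δ(f # h) = (f # h₍₁₎) ⊗_B (1 # h₍₂₎)`. -/
noncomputable def smashDelta :
    Smash hact →ₗ[k] BalTensor (smashS hact) (smashT hact hYD hbc) :=
  balMk _ _ ∘ₗ (smashComul hact).toLinearMap

theorem smashDelta_apply (r : Smash hact) :
    smashDelta hact hYD hbc r = balMk _ _ (smashComul hact r) := rfl

theorem smashDelta_bimodule (a b : B) (r : Smash hact) (x : Smash hact ⊗[k] Smash hact)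
    (hx : balMk (smashS hact) (smashT hact hYD hbc) x = smashDelta hact hYD hbc r) :
    smashDelta hact hYD hbc (smashS hact a * smashT hact hYD hbc (op b) * r) =
      balMk _ _ ((smashS hact a ⊗ₜ[k] smashT hact hYD hbc (op b)) * x) := by
  rw [smashDelta_apply, balMk_eq_iff] at hx ⊢
  have h1 := tmul_mul_balRel_mem (smashS_mul_smashT hact hYD hbc) a (op b) hx
  have h2 := smashS_tmul_one_mul_mem hact hYD hbc a
    (balRel_mul_mem (smashComul_smashTLinear hact hYD hbc b) (smashComul hact r))
  have e : smashS hact a ⊗ₜ[k] smashT hact hYD hbc (op b) =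
      (smashS hact a ⊗ₜ[k] 1) * (1 ⊗ₜ[k] smashT hact hYD hbc (op b)) := by
    rw [Algebra.TensorProduct.tmul_mul_tmul, one_mul, mul_one]
  have := sub_mem h2 h1
  rw [map_mul, map_mul, smashComul_smashS]
  rw [e] at this ⊢
  rw [smashT_op] at this ⊢
  convert this using 1
  noncomm_ring

/-- An arbitrary lift D differs from the strictly coassociative lift D₀ by elements of the balancing
relations; the point is that every such difference, inner or outer, lands in the relations of the
triple tensor product. -/
theorem smashDelta_coassoc (D : Smash hact →ₗ[k] Smash hact ⊗[k] Smash hact)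
    (hD : ∀ r, balMk (smashS hact) (smashT hact hYD hbc) (D r) = smashDelta hact hYD hbc r)
    (r : Smash hact) :
    balMk₃ (smashS hact) (smashT hact hYD hbc)
        (TensorProduct.assoc k _ _ _ (D.rTensor (Smash hact) (D r))) =
      balMk₃ (smashS hact) (smashT hact hYD hbc) (D.lTensor (Smash hact) (D r)) := by
  let N := balRel₃ (smashS hact) (smashT hact hYD hbc)
  let D₀ := (smashComul hact).toLinearMap
  have hD' (r) : D r - D₀ r ∈ balRel (smashS hact) (smashT hact hYD hbc) :=
    balMk_eq_iff.1 (hD r)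
  have h1 (z : Smash hact ⊗[k] Smash hact) :
      TensorProduct.assoc k _ _ _ (D.rTensor (Smash hact) z) -
        TensorProduct.assoc k _ _ _ (D₀.rTensor (Smash hact) z) ∈ N := by
    induction z with
    | zero => simp
    | add x y hx hy => simp only [map_add]; rw [add_sub_add_comm]; exact add_mem hx hy
    | tmul x y =>
      rw [← map_sub, LinearMap.rTensor_tmul, LinearMap.rTensor_tmul, ← sub_tmul]
      exact assoc_tmul_mem_balRel₃ (hD' x) y
  have h2 (z : Smash hact ⊗[k] Smash hact) :
      D.lTensor (Smash hact) z - D₀.lTensor (Smash hact) z ∈ N := by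
    induction z with
    | zero => simp
    | add x y hx hy => simp only [map_add]; rw [add_sub_add_comm]; exact add_mem hx hy
    | tmul x y =>
      rw [LinearMap.lTensor_tmul, LinearMap.lTensor_tmul, ← tmul_sub]
      exact tmul_mem_balRel₃ (hD' y) x
  -- Well-definedness of Δ ⊗ id on balanced tensors: Δ(t(a)x) agrees with (1 ⊗ t(a))Δ(x), after
  -- which the second type of triple relation applies.
  have h3 : TensorProduct.assoc k _ _ _ (D₀.rTensor (Smash hact) (D r - D₀ r)) ∈ N := by
    refine map_mem_of_mem_balRel ((TensorProduct.assoc k _ _ _).toLinearMap ∘ₗ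
      D₀.rTensor (Smash hact)) (fun a x y => ?_) (hD' r)
    have m1 := assoc_tmul_mem_balRel₃ (balRel_mul_mem
      (smashComul_smashTLinear hact hYD hbc a) (smashComul hact x)) y
    have m2 (w : Smash hact ⊗[k] Smash hact) : TensorProduct.assoc k _ _ _
        ((1 ⊗ₜ smashTLinear hact ρ a * w) ⊗ₜ[k] y) -
          TensorProduct.assoc k _ _ _ (w ⊗ₜ[k] (smashS hact a * y)) ∈ N := by
      induction w with
      | zero => simp
      | add x y hx hy =>
        simp only [mul_add, add_tmul, map_add]; rw [add_sub_add_comm]; exact add_mem hx hy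
      | tmul p q =>
        rw [Algebra.TensorProduct.tmul_mul_tmul, one_mul]
        have := tmul_mem_balRel₃ (sub_mem_balRel (s := smashS hact) (t := smashT hact hYD hbc) a q y) p
        rw [tmul_sub] at this
        exact this
    have m3 := add_mem m1 (m2 (smashComul hact x))
    rw [sub_mul, sub_tmul, map_sub, sub_add_sub_cancel, ← map_mul] at m3
    exact m3
  -- Well-definedness of id ⊗ Δ: Δ(s(a)y) = (s(a) ⊗ 1)Δ(y) exactly, followed by the first type of
  -- triple relation.
  have h4 : D₀.lTensor (Smash hact) (D r - D₀ r) ∈ N := by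
    refine map_mem_of_mem_balRel (D₀.lTensor (Smash hact)) (fun a x y => ?_) (hD' r)
    rw [LinearMap.lTensor_tmul, LinearMap.lTensor_tmul]
    have e : D₀ (smashS hact a * y) = (smashS hact a ⊗ₜ 1) * D₀ y := by
      change smashComul hact _ = _
      rw [map_mul, smashComul_smashS]
      rfl
    rw [e]
    generalize D₀ y = w
    induction w with
    | zero => simp
    | add x y hx hy =>
      simp only [mul_add, tmul_add]; rw [add_sub_add_comm]; exact add_mem hx hy
    | tmul p q =>
      rw [Algebra.TensorProduct.tmul_mul_tmul, one_mul]
      exact Submodule.subset_span (Or.inl ⟨a, x, p, q, rfl⟩)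
  have h5 : TensorProduct.assoc k _ _ _ (D₀.rTensor (Smash hact) (D₀ r)) =
      D₀.lTensor (Smash hact) (D₀ r) := smashComul_coassoc hact r
  refine (Submodule.Quotient.eq _).2 ?_
  have := sub_mem (add_mem (h1 (D r)) h3) (add_mem (h2 (D r)) h4)
  rw [map_sub, map_sub, map_sub, sub_add_sub_cancel, sub_add_sub_cancel, h5,
    sub_sub_sub_cancel_right] at this
  exact this

theorem smashComul_mul (b : B) (h : H) : smashComul hact (smashS hact b * smashEta hact h) =
    TensorProduct.map (LinearMap.mulLeft k (smashS hact b) ∘ₗ (smashEta hact).toLinearMap)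
      (smashEta hact).toLinearMap (comul h) := by
  rw [map_mul, smashComul_smashS, smashComul_smashEta, comulEta_apply]
  generalize comul (R := k) h = z
  induction z with
  | zero => simp
  | add x y hx hy => simp only [map_add, mul_add, hx, hy]
  | tmul x y => rw [map_tmul, map_tmul, Algebra.TensorProduct.tmul_mul_tmul, one_mul]; rfl

theorem smash_counit_left (r : Smash hact) (x : Smash hact ⊗[k] Smash hact)
    (hx : balMk (smashS hact) (smashT hact hYD hbc) x = smashDelta hact hYD hbc r) :
    LinearMap.mul' k (Smash hact)
      (((smashS hact).toLinearMap ∘ₗ smashCounit hact).rTensor (Smash hact) x) = r := by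
  obtain ⟨F, hF⟩ : ∃ F : Smash hact ⊗[k] Smash hact →ₗ[k] Smash hact, F = LinearMap.mul' k _ ∘ₗ
    ((smashS hact).toLinearMap ∘ₗ smashCounit hact).rTensor (Smash hact) := ⟨_, rfl⟩
  have hF' (x y) : F (x ⊗ₜ y) = smashS hact (smashCounit hact x) * y := by rw [hF]; rfl
  have h1 : F x = F (smashComul hact r) := map_eq_of_balMk_eq F (fun a x y => by
    rw [hF', hF', smashT_op, smashCounit_smashTLinear_mul hact hbc, map_mul, mul_assoc]) hx
  rw [← LinearMap.comp_apply, ← hF, h1]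
  clear h1 hx
  induction r using Smash.induction with
  | zero => simp
  | add x y hx hy => rw [map_add, map_add, hx, hy]
  | tmul b h =>
    have e (z : H ⊗[k] H) : F (TensorProduct.map
        (LinearMap.mulLeft k (smashS hact b) ∘ₗ (smashEta hact).toLinearMap)
          (smashEta hact).toLinearMap z) =
        smashS hact b * smashEta hact (TensorProduct.lid k H (counit.rTensor H z)) := by
      induction z with
      | zero => simp
      | add x y hx hy => simp only [map_add, mul_add, hx, hy]
      | tmul x y =>
        rw [map_tmul, hF']
        simp only [LinearMap.comp_apply, LinearMap.mulLeft_apply, AlgHom.toLinearMap_apply,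
          smashCounit_smashS_mul, smashCounit_smashEta, LinearMap.rTensor_tmul, lid_tmul, map_smul,
          map_mul, mul_assoc, AlgHom.commutes, ← Algebra.smul_def, mul_smul_comm]
    rw [smashComul_mul, e]
    simp

theorem smash_counit_right (r : Smash hact) (x : Smash hact ⊗[k] Smash hact)
    (hx : balMk (smashS hact) (smashT hact hYD hbc) x = smashDelta hact hYD hbc r) :
    LinearMap.mul' k (Smash hact)
      (((smashT hact hYD hbc).toLinearMap ∘ₗ (opLinearEquiv k).toLinearMap ∘ₗ
        smashCounit hact).rTensor (Smash hact) (TensorProduct.comm k _ _ x)) = r := by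
  obtain ⟨F, hF⟩ : ∃ F : Smash hact ⊗[k] Smash hact →ₗ[k] Smash hact, F = LinearMap.mul' k _ ∘ₗ
    ((smashT hact hYD hbc).toLinearMap ∘ₗ (opLinearEquiv k).toLinearMap ∘ₗ
        smashCounit hact).rTensor (Smash hact) ∘ₗ (TensorProduct.comm k _ _).toLinearMap :=
    ⟨_, rfl⟩
  have hF' (x y) : F (x ⊗ₜ y) = smashT hact hYD hbc (op (smashCounit hact y)) * x := by
    rw [hF]; rfl
  have h1 : F x = F (smashComul hact r) := map_eq_of_balMk_eq F (fun a x y => by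
    rw [hF', hF', smashCounit_smashS_mul, op_mul, map_mul, mul_assoc]) hx
  have h0 : F x = r := by
    rw [h1]
    clear h1 hx
    induction r using Smash.induction with
    | zero => simp
    | add x y hx hy => rw [map_add, map_add, hx, hy]
    | tmul b h =>
      have e (z : H ⊗[k] H) : F (TensorProduct.map
          (LinearMap.mulLeft k (smashS hact b) ∘ₗ (smashEta hact).toLinearMap)
            (smashEta hact).toLinearMap z) =
          smashS hact b * smashEta hact (TensorProduct.rid k H (counit.lTensor H z)) := by
        induction z with
        | zero => simp
        | add x y hx hy => simp only [map_add, mul_add, hx, hy]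
        | tmul x y =>
          rw [map_tmul, hF', AlgHom.toLinearMap_apply, smashCounit_smashEta,
            ← MulOpposite.algebraMap_apply, AlgHom.commutes, ← Algebra.smul_def]
          simp
      rw [smashComul_mul, e]
      simp
  rw [hF] at h0
  exact h0

/-- The smash product of a Hopf algebra with a braided commutative Yetter–Drinfeld algebra is
a left bialgebroid. -/
noncomputable def smashBialgebroid : LeftBialgebroid k B (Smash hact) where
  s := smashS hact
  t := smashT hact hYD hbc
  s_mul_t := smashS_mul_smashT hact hYD hbc
  Δ := smashDelta hact hYD hbc
  ε := smashCounit hact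
  comul_bimodule := smashDelta_bimodule hact hYD hbc
  counit_bimodule a b r := by
    rw [mul_assoc, smashCounit_smashS_mul, smashT_op, smashCounit_smashTLinear_mul hact hbc,
      mul_assoc]
  coassoc := smashDelta_coassoc hact hYD hbc
  counit_left := smash_counit_left hact hYD hbc
  counit_right := smash_counit_right hact hYD hbc
  comul_takeuchi a r x hx := by
    rw [balMk_eq_iff, ← mul_sub]
    have := add_mem (balRel_mul_mem (balMk_eq_iff.1 hx)
      (smashTLinear hact ρ a ⊗ₜ[k] 1 - 1 ⊗ₜ[k] smashS hact a))
      (smashComul_mul_sub_mem hact hYD hbc r a)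
    rw [sub_mul] at this
    erw [sub_add_cancel] at this
    exact this
  comul_one := by
    rw [smashDelta_apply, map_one, Algebra.TensorProduct.one_def]
  comul_mul r r' x x' hx hx' := by
    rw [smashDelta_apply, balMk_eq_iff] at hx hx' ⊢
    have := neg_mem (add_mem (balRel_mul_mem hx x') (smashComul_mul_balRel_mem hact hYD hbc r hx'))
    rw [sub_mul, mul_sub, sub_add_sub_cancel, neg_sub, ← map_mul] at this
    exact this
  counit_one := by rw [smashCounit_apply, map_one (smashRep hact), Module.End.one_apply]
  counit_mul_s r r' := by rw [smashCounit_mul, smashCounit_mul, smashCounit_smashS]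
  counit_mul_t r r' := by
    rw [smashCounit_mul, smashCounit_mul, smashCounit_apply (r := smashT _ _ _ _), smashT_op,
      smashRep_smashTLinear hact hbc, one_mul]

end SmashBialgebroid

/-! ### The antipode axioms of Böhm–Szlachányi and of Lu -/

section SmashHopfAlgebroid

variable {k : Type u} {H : Type v} [Field k] [Ring H] [HopfAlgebra k H]
variable {B : Type*} [Ring B] [Algebra k B]
variable {act : H →ₐ[k] Module.End k B} (hact : IsModuleAlgebra act) {ρ : B →ₗ[k] B ⊗[k] H}
variable {hS : Function.Bijective (antipode k : H →ₗ[k] H)}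
variable (hYD : IsYetterDrinfeldAlgebra hS act ρ) (hbc : IsBraidedCommutative act ρ)

open MulOpposite

/-- The inclusion of the first factor. -/
noncomputable abbrev smashIncl₁ : Smash hact →ₐ[k] Smash hact ⊗[k] Smash hact :=
  Algebra.TensorProduct.includeLeft

/-- The inclusion of the second factor. -/
noncomputable abbrev smashIncl₂ : Smash hact →ₐ[k] Smash hact ⊗[k] Smash hact :=
  Algebra.TensorProduct.includeRight

/-- Both sides invert h ↦ η(h₍₁₎) ⊗ η(h₍₂₎) in the convolution algebra. -/
theorem antipodeOf_comulEta : Conv.antipodeOf (comulEta hact) =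
    Conv.antipodeOf ((smashIncl₂ hact).comp (smashEta hact)) *
      Conv.antipodeOf ((smashIncl₁ hact).comp (smashEta hact)) := by
  refine left_inv_eq_right_inv (Conv.antipodeOf_mul_ofAlgHom _) ?_
  rw [ofAlgHom_comulEta, mul_assoc, ← mul_assoc (etaR hact)]
  change Conv.ofAlgHom ((smashIncl₁ hact).comp (smashEta hact)) *
    ((Conv.ofAlgHom ((smashIncl₂ hact).comp (smashEta hact)) * _) * _) = 1
  rw [Conv.ofAlgHom_mul_antipodeOf, one_mul, Conv.ofAlgHom_mul_antipodeOf]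

/-- In Δ(η(S(h₍₁₎)))(1 ⊗ c)(η(h₍₂₎) ⊗ 1) the first-factor antipode meets η directly and cancels,
since 1 ⊗ c commutes with it. -/
theorem antipodeOf_comulEta_mul (c : Smash hact) (h : H) :
    (Conv.antipodeOf (comulEta hact) * Conv.const (1 ⊗ₜ c) * etaL hact : Conv k H _).ofConv h =
      1 ⊗ₜ (smashEta hact (antipode k h) * c) := by
  have e1 : Conv.const (1 ⊗ₜ c) * etaL hact = etaL hact * Conv.const (1 ⊗ₜ c) := by
    ext1; ext1 x
    rw [Conv.const_mul_apply, Conv.mul_const_apply, etaL_apply]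
    simp
  have e2 : Conv.antipodeOf ((smashIncl₁ hact).comp (smashEta hact)) * etaL hact = 1 :=
    Conv.antipodeOf_mul_ofAlgHom _
  rw [mul_assoc, e1, antipodeOf_comulEta, ← mul_assoc, mul_assoc _ _ (etaL hact), e2, mul_one,
    Conv.mul_const_apply, Conv.antipodeOf_apply]
  change (1 : Smash hact) ⊗ₜ[k] smashEta hact (antipode k h) * 1 ⊗ₜ c = _
  rw [Algebra.TensorProduct.tmul_mul_tmul, one_mul]

/-- On s(b)η(h), Δ(τ(s(b))) may be replaced by 1 ⊗ τ(s(b)), and the remaining Hopf algebra factors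
cancel by `antipodeOf_comulEta_mul`. The map F is this expression with the chosen lift; it depends
only on balanced classes because τ(t(a)) = s(a). -/
theorem smash_antipode_left (D : Smash hact →ₗ[k] Smash hact ⊗[k] Smash hact)
    (hD : ∀ r, balMk (smashS hact) (smashT hact hYD hbc) (D r) = smashDelta hact hYD hbc r)
    (r : Smash hact) (x : Smash hact ⊗[k] Smash hact)
    (hx : balMk (smashS hact) (smashT hact hYD hbc) x = smashDelta hact hYD hbc r) :
    balMk (smashS hact) (smashT hact hYD hbc)
      (LinearMap.mul' k (Smash hact ⊗[k] Smash hact)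
        (TensorProduct.map (D ∘ₗ (smashTau hact hYD hbc).toLinearMap)
          (smashIncl₁ hact).toLinearMap x)) =
      balMk _ _ (1 ⊗ₜ[k] smashTau hact hYD hbc r) := by
  obtain ⟨F, hF⟩ : ∃ F : Smash hact ⊗[k] Smash hact →ₗ[k] Smash hact ⊗[k] Smash hact,
      ∀ x y, F (x ⊗ₜ y) = smashComul hact (smashTau hact hYD hbc x) * (y ⊗ₜ 1) :=
    ⟨LinearMap.mul' k (Smash hact ⊗[k] Smash hact) ∘ₗ TensorProduct.map
      ((smashComul hact).toLinearMap ∘ₗ (smashTau hact hYD hbc).toLinearMap)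
      (smashIncl₁ hact).toLinearMap, fun _ _ => rfl⟩
  have h1 (z : Smash hact ⊗[k] Smash hact) : LinearMap.mul' k (Smash hact ⊗[k] Smash hact)
        (TensorProduct.map (D ∘ₗ (smashTau hact hYD hbc).toLinearMap)
          (smashIncl₁ hact).toLinearMap z) - F z ∈ balRel (smashS hact) (smashT hact hYD hbc) := by
    induction z with
    | zero => simp
    | add x y hx hy => simp only [map_add]; rw [add_sub_add_comm]; exact add_mem hx hy
    | tmul x y =>
      have := balRel_mul_mem (balMk_eq_iff.1 (hD (smashTau hact hYD hbc x))) (y ⊗ₜ 1)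
      rw [hF, map_tmul, LinearMap.mul'_apply]
      rw [sub_mul] at this
      exact this
  have h2 : F x = F (smashComul hact r) := map_eq_of_balMk_eq F (fun a x y => by
    rw [hF, hF, smashT_op, smashTau_mul, smashTau_smashTLinear, map_mul, smashComul_smashS,
      mul_assoc, Algebra.TensorProduct.tmul_mul_tmul, one_mul]) hx
  have h3 : F (smashComul hact r) - 1 ⊗ₜ smashTau hact hYD hbc r ∈
      balRel (smashS hact) (smashT hact hYD hbc) := by
    clear hx h2
    induction r using Smash.induction with
    | zero => simp
    | add x y hx hy =>
      simp only [map_add, tmul_add]; rw [add_sub_add_comm]; exact add_mem hx hy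
    | tmul b h =>
      have e (z : H ⊗[k] H) : F (TensorProduct.map
          (LinearMap.mulLeft k (smashS hact b) ∘ₗ (smashEta hact).toLinearMap)
            (smashEta hact).toLinearMap z) - LinearMap.mul' k _ (TensorProduct.map
          (Conv.antipodeOf (comulEta hact) * Conv.const (1 ⊗ₜ smashTauLinear hact ρ b)).ofConv
            (etaL hact).ofConv z) ∈ balRel (smashS hact) (smashT hact hYD hbc) := by
        induction z with
        | zero => simp
        | add x y hx hy => simp only [map_add]; rw [add_sub_add_comm]; exact add_mem hx hy
        | tmul x y =>
          have := smashComul_mul_balRel_mem hact hYD hbc (smashEta hact (antipode k x))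
            (balRel_mul_mem (smashComul_smashTauLinear hact hYD hbc b) (smashEta hact y ⊗ₜ 1))
          rw [map_tmul, hF, map_tmul, LinearMap.mul'_apply, Conv.mul_const_apply,
            Conv.antipodeOf_apply, etaL_apply, LinearMap.comp_apply, LinearMap.mulLeft_apply,
            AlgHom.toLinearMap_apply, AlgHom.toLinearMap_apply, smashTau_mul, smashTau_smashS,
            smashTau_smashEta, map_mul, ← smashComul_smashEta, mul_assoc, mul_assoc, ← mul_sub,
            ← sub_mul]
          exact this
      have := e (comul h)
      rw [← LinearMap.convMul_apply, antipodeOf_comulEta_mul] at this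
      rw [smashComul_mul, smashTau_mul, smashTau_smashS, smashTau_smashEta]
      exact this
  rw [balMk_eq_iff]
  have := add_mem (h1 x) h3
  rw [h2, sub_add_sub_cancel] at this
  exact this

theorem push_smashComul_etaOpInv :
    Conv.push (AlgHom.op (smashComul hact)) (etaOpInv hact hS) =
      Conv.push (AlgHom.op (smashIncl₂ hact)) (etaOpInv hact hS) *
        Conv.push (AlgHom.op (smashIncl₁ hact)) (etaOpInv hact hS) := by
  refine left_inv_eq_right_inv (a := Conv.push (AlgHom.op (smashComul hact)) (etaOp hact)) ?_ ?_
  · rw [← map_mul, etaOpInv_mul_etaOp, map_one]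
  · have e1 : etaOpR hact * Conv.push (AlgHom.op (smashIncl₂ hact)) (etaOpInv hact hS) = 1 := by
      rw [etaOpR, ← map_mul, etaOp_mul_etaOpInv, map_one]
    have e2 : etaOpL hact * Conv.push (AlgHom.op (smashIncl₁ hact)) (etaOpInv hact hS) = 1 := by
      rw [etaOpL, ← map_mul, etaOp_mul_etaOpInv, map_one]
    rw [push_smashComul_etaOp, mul_assoc, ← mul_assoc (etaOpR hact), e1, one_mul, e2]

/-- Mirror image of `antipodeOf_comulEta_mul`, with S⁻¹ and the second factor: S⁻¹(h₍₂₎)h₍₁₎ cancels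
there. -/
theorem etaOpR_mul_push (hS : Function.Bijective (antipode k : H →ₗ[k] H)) (c : Smash hact)
    (h : H) :
    (etaOpR hact * (Conv.const (op (c ⊗ₜ[k] 1)) *
      Conv.push (AlgHom.op (smashComul hact)) (etaOpInv hact hS)) : Conv k H _).ofConv h =
      op ((smashEta hact (sInv hS h) * c) ⊗ₜ 1) := by
  have e1 : etaOpR hact * Conv.const (op (c ⊗ₜ[k] 1)) =
      Conv.const (op (c ⊗ₜ[k] 1)) * etaOpR hact := by
    ext1; ext1 x
    rw [Conv.const_mul_apply, Conv.mul_const_apply, etaOpR_apply, ← op_mul, ← op_mul]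
    simp
  have e2 : etaOpR hact * Conv.push (AlgHom.op (smashIncl₂ hact)) (etaOpInv hact hS) = 1 := by
    rw [etaOpR, ← map_mul, etaOp_mul_etaOpInv, map_one]
  rw [← mul_assoc, e1, mul_assoc, push_smashComul_etaOpInv, ← mul_assoc (etaOpR hact), e2, one_mul,
    Conv.const_mul_apply]
  change op (c ⊗ₜ[k] 1) * op (smashEta hact (sInv hS h) ⊗ₜ 1) = _
  rw [← op_mul, Algebra.TensorProduct.tmul_mul_tmul, one_mul]

theorem smash_antipode_right (D : Smash hact →ₗ[k] Smash hact ⊗[k] Smash hact)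
    (hD : ∀ r, balMk (smashS hact) (smashT hact hYD hbc) (D r) = smashDelta hact hYD hbc r)
    (r : Smash hact) (x : Smash hact ⊗[k] Smash hact)
    (hx : balMk (smashS hact) (smashT hact hYD hbc) x = smashDelta hact hYD hbc r) :
    balMk (smashS hact) (smashT hact hYD hbc)
      (LinearMap.mul' k (Smash hact ⊗[k] Smash hact)
        (TensorProduct.map (D ∘ₗ (smashTau hact hYD hbc).symm.toLinearMap)
          (smashIncl₂ hact).toLinearMap (TensorProduct.comm k _ _ x))) =
      balMk _ _ ((smashTau hact hYD hbc).symm r ⊗ₜ[k] 1) := by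
  obtain ⟨F, hF⟩ : ∃ F : Smash hact ⊗[k] Smash hact →ₗ[k] Smash hact ⊗[k] Smash hact,
      ∀ x y, F (x ⊗ₜ y) = smashComul hact ((smashTau hact hYD hbc).symm y) * (1 ⊗ₜ x) :=
    ⟨LinearMap.mul' k (Smash hact ⊗[k] Smash hact) ∘ₗ TensorProduct.map
      ((smashComul hact).toLinearMap ∘ₗ (smashTau hact hYD hbc).symm.toLinearMap)
      (smashIncl₂ hact).toLinearMap ∘ₗ (TensorProduct.comm k _ _).toLinearMap, fun _ _ => rfl⟩
  have h1 (z : Smash hact ⊗[k] Smash hact) : LinearMap.mul' k (Smash hact ⊗[k] Smash hact)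
        (TensorProduct.map (D ∘ₗ (smashTau hact hYD hbc).symm.toLinearMap)
          (smashIncl₂ hact).toLinearMap (TensorProduct.comm k _ _ z)) - F z ∈
        balRel (smashS hact) (smashT hact hYD hbc) := by
    induction z with
    | zero => simp
    | add x y hx hy => simp only [map_add]; rw [add_sub_add_comm]; exact add_mem hx hy
    | tmul x y =>
      have := balRel_mul_mem (balMk_eq_iff.1 (hD ((smashTau hact hYD hbc).symm y))) (1 ⊗ₜ x)
      rw [hF, comm_tmul, map_tmul, LinearMap.mul'_apply]
      rw [sub_mul] at this
      exact this
  -- Unlike for the first axiom, F is balanced only modulo the relations: Δ(t(a)) agrees with 1 ⊗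
  -- t(a) only there, and left multiplication by Δ(τ⁻¹(y)) preserves them.
  have h2 : F (x - smashComul hact r) ∈ balRel (smashS hact) (smashT hact hYD hbc) := by
    refine map_mem_of_mem_balRel F (fun a x y => ?_) (balMk_eq_iff.1 hx)
    have := neg_mem (smashComul_mul_balRel_mem hact hYD hbc ((smashTau hact hYD hbc).symm y)
      (balRel_mul_mem (smashComul_smashTLinear hact hYD hbc a) (1 ⊗ₜ x)))
    rw [sub_mul, mul_sub, neg_sub, Algebra.TensorProduct.tmul_mul_tmul, one_mul, ← mul_assoc,
      ← map_mul] at this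
    rw [hF, hF, smashTau_symm_mul, smashTau_symm_smashS]
    exact this
  have h3 : F (smashComul hact r) - (smashTau hact hYD hbc).symm r ⊗ₜ 1 ∈
      balRel (smashS hact) (smashT hact hYD hbc) := by
    clear hx h2
    induction r using Smash.induction with
    | zero => simp
    | add x y hx hy =>
      simp only [map_add, add_tmul]; rw [add_sub_add_comm]; exact add_mem hx hy
    | tmul b h =>
      -- The Takeuchi condition replaces 1 ⊗ s(b) by t(b) ⊗ 1 next to Δ(η(S⁻¹(y))), freeing the
      -- second factor for the cancellation.
      have e (z : H ⊗[k] H) : F (TensorProduct.map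
          (LinearMap.mulLeft k (smashS hact b) ∘ₗ (smashEta hact).toLinearMap)
            (smashEta hact).toLinearMap z) - unop (LinearMap.mul' k _ (TensorProduct.map
          (etaOpR hact).ofConv (Conv.const (op (smashTLinear hact ρ b ⊗ₜ[k] 1)) *
            Conv.push (AlgHom.op (smashComul hact)) (etaOpInv hact hS)).ofConv z)) ∈
            balRel (smashS hact) (smashT hact hYD hbc) := by
        induction z with
        | zero => simp
        | add x y hx hy =>
          simp only [map_add, unop_add]; rw [add_sub_add_comm]; exact add_mem hx hy
        | tmul x y =>
          have := neg_mem (balRel_mul_mem (smashComul_mul_sub_mem hact hYD hbc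
            (smashEta hact (sInv hS y)) b) (1 ⊗ₜ smashEta hact x))
          rw [mul_sub, sub_mul, neg_sub, mul_assoc, Algebra.TensorProduct.tmul_mul_tmul,
            one_mul] at this
          rw [map_tmul, hF, map_tmul, LinearMap.mul'_apply, Conv.const_mul_apply, unop_mul,
            unop_mul, AlgHom.toLinearMap_apply, smashTau_symm_smashEta]
          exact this
      have := e (comul h)
      rw [← LinearMap.convMul_apply, etaOpR_mul_push] at this
      rw [smashComul_mul, smashTau_symm_mul, smashTau_symm_smashS, smashTau_symm_smashEta]
      exact this
  rw [balMk_eq_iff]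
  rw [map_sub] at h2
  have := add_mem (add_mem (h1 x) h2) h3
  rw [sub_add_sub_cancel, sub_add_sub_cancel] at this
  exact this

/-- The smash product of a Hopf algebra with a braided commutative Yetter–Drinfeld algebra is
a Hopf algebroid. -/
noncomputable def smashHopfAlgebroid : HopfAlgebroid k B (Smash hact) where
  toLeftBialgebroid := smashBialgebroid hact hYD hbc
  S := smashTau hact hYD hbc
  antipode_mul := smashTau_mul hact hYD hbc
  antipode_t := smashTau_smashTLinear hact hYD hbc
  antipode_left := smash_antipode_left hact hYD hbc
  antipode_right := smash_antipode_right hact hYD hbc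

/-- The rule η(h)t(c) = t(h₍₂₎•c)η(h₍₁₎) solved for t and evaluated at S(h), whose coproduct is
reversed. -/
theorem smashTLinear_act_antipode (hYD : IsYetterDrinfeldAlgebra hS act ρ)
    (hbc : IsBraidedCommutative act ρ) (c : B) (h : H) :
    (Conv.antipodeOf (smashEta hact) * Conv.const (smashTLinear hact ρ c) *
      Conv.ofAlgHom (smashEta hact) : Conv k H _).ofConv h =
      smashTLinear hact ρ (act (antipode k h) c) := by
  have e : Conv.push (smashTOp hact hYD hbc) (actConv act c) =
      etaOpInv hact hS * Conv.const (smashTOp hact hYD hbc c) * etaOp hact := by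
    rw [etaOpInv_mul_smashTOp, mul_assoc, etaOpInv_mul_etaOp, mul_one]
  have e' := congrArg unop (LinearMap.congr_fun (congrArg WithConv.ofConv e) (antipode k h))
  refine Eq.trans ?_ e'.symm
  rw [LinearMap.convMul_apply, LinearMap.convMul_apply _ _ (antipode k h), comul_antipode]
  generalize comul (R := k) h = z
  induction z with
  | zero => simp
  | add x y hx hy => simp only [map_add, unop_add, hx, hy]
  | tmul x y =>
    rw [comm_tmul, map_tmul, map_tmul, map_tmul, LinearMap.mul'_apply, LinearMap.mul'_apply,
      Conv.mul_const_apply, Conv.mul_const_apply, etaOpInv_apply, sInv_antipode, unop_mul, unop_mul,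
      mul_assoc]
    rfl

/-- On b # h both sides equal t(S(h)•c) with c = S²(b⁽¹⁾)•b⁽⁰⁾, since τ(s(b)) = t(c) and ε(t(c)) =
c. -/
theorem smash_mul_antipode_left (r : Smash hact) (x : Smash hact ⊗[k] Smash hact)
    (hx : balMk (smashS hact) (smashT hact hYD hbc) x = smashDelta hact hYD hbc r) :
    LinearMap.mul' k (Smash hact)
      ((smashTau hact hYD hbc).toLinearMap.rTensor (Smash hact) x) =
      smashT hact hYD hbc (op (smashCounit hact (smashTau hact hYD hbc r))) := by
  obtain ⟨F, hF⟩ : ∃ F : Smash hact ⊗[k] Smash hact →ₗ[k] Smash hact, F = LinearMap.mul' k _ ∘ₗ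
    (smashTau hact hYD hbc).toLinearMap.rTensor (Smash hact) := ⟨_, rfl⟩
  have hF' (x y) : F (x ⊗ₜ y) = smashTau hact hYD hbc x * y := by rw [hF]; rfl
  have h1 : F x = F (smashComul hact r) := map_eq_of_balMk_eq F (fun a x y => by
    rw [hF', hF', smashT_op, smashTau_mul, smashTau_smashTLinear, mul_assoc]) hx
  rw [← LinearMap.comp_apply, ← hF, h1]
  clear h1 hx
  induction r using Smash.induction with
  | zero => simp
  | add x y hx hy => simp only [map_add, op_add, hx, hy]
  | tmul b h =>
    have e (z : H ⊗[k] H) : F (TensorProduct.map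
        (LinearMap.mulLeft k (smashS hact b) ∘ₗ (smashEta hact).toLinearMap)
          (smashEta hact).toLinearMap z) = LinearMap.mul' k _ (TensorProduct.map
        (Conv.antipodeOf (smashEta hact) *
          Conv.const (smashTLinear hact ρ (twistB act ρ b))).ofConv
          (Conv.ofAlgHom (smashEta hact)).ofConv z) := by
      induction z with
      | zero => simp
      | add x y hx hy => simp only [map_add, hx, hy]
      | tmul x y =>
        rw [map_tmul, hF', map_tmul, LinearMap.mul'_apply, Conv.mul_const_apply,
          Conv.antipodeOf_apply, LinearMap.comp_apply, LinearMap.mulLeft_apply,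
          AlgHom.toLinearMap_apply, smashTau_mul, smashTau_smashS, smashTau_smashEta,
          smashTLinear_twistB hact hYD hbc]
    rw [smashComul_mul, e, ← LinearMap.convMul_apply, smashTLinear_act_antipode hact hYD hbc,
      smashTau_mul, smashTau_smashS, smashTau_smashEta, smashCounit_mul, smashRep_smashEta,
      ← smashTLinear_twistB hact hYD hbc, smashCounit_apply, smashRep_smashTLinear hact hbc,
      one_mul]
    rfl

/-- The map `x ⊗ (b # h) ↦ t(b) x ⊗ (1 # h)`. -/
noncomputable def smashSectionPre (ρ : B →ₗ[k] B ⊗[k] H) :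
    Smash hact ⊗[k] Smash hact →ₗ[k] Smash hact ⊗[k] Smash hact :=
  TensorProduct.map (LinearMap.mul' k (Smash hact) ∘ₗ
      (smashTLinear hact ρ).rTensor (Smash hact) ∘ₗ
      (TensorProduct.comm k (Smash hact) B).toLinearMap) (smashEta hact).toLinearMap ∘ₗ
    (TensorProduct.assoc k (Smash hact) B H).symm.toLinearMap ∘ₗ
    (toSmash hact).symm.toLinearMap.lTensor (Smash hact)

theorem smashSectionPre_tmul (x : Smash hact) (b : B) (h : H) :
    smashSectionPre hact ρ (x ⊗ₜ (smashS hact b * smashEta hact h)) =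
      (smashTLinear hact ρ b * x) ⊗ₜ smashEta hact h := by
  rw [← toSmash_tmul, smashSectionPre, LinearMap.comp_apply, LinearMap.comp_apply,
    LinearMap.lTensor_tmul, LinearEquiv.coe_coe, LinearEquiv.coe_coe,
    LinearEquiv.symm_apply_apply]
  rfl

/-- As R is free over s(B) on the left with basis coming from H, every balanced tensor has a normal
form with second factor in η(H); this normal form is the section. It fixes the representatives
η-valued in the second factor given by Δ, for which the formula reduces to h₍₁₎S(h₍₂₎) = ε(h). -/
theorem smash_exists_section :
    ∃ γ : BalTensor (smashS hact) (smashT hact hYD hbc) →ₗ[k] Smash hact ⊗[k] Smash hact,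
    (∀ z, balMk _ _ (γ z) = z) ∧
    ∀ r, LinearMap.mul' k (Smash hact) ((smashTau hact hYD hbc).toLinearMap.lTensor (Smash hact)
      (γ (smashDelta hact hYD hbc r))) = smashS hact (smashCounit hact r) := by
  have h1 : balRel (smashS hact) (smashT hact hYD hbc) ≤ LinearMap.ker (smashSectionPre hact ρ) := by
    refine fun z hz => map_mem_of_mem_balRel (N := ⊥) (smashSectionPre hact ρ) (fun a x y => ?_) hz
    rw [Submodule.mem_bot, sub_eq_zero]
    induction y using Smash.induction with
    | zero => simp
    | add x y hx hy => simp only [mul_add, tmul_add, map_add, hx, hy]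
    | tmul b h =>
      rw [smashSectionPre_tmul, ← mul_assoc (smashS hact a), ← map_mul, smashSectionPre_tmul,
        smashTLinear_mul hact hYD hbc, smashT_op, mul_assoc]
  have h2 (z : Smash hact ⊗[k] Smash hact) : smashSectionPre hact ρ z - z ∈
      balRel (smashS hact) (smashT hact hYD hbc) := by
    induction z with
    | zero => simp
    | add x y hx hy => rw [map_add, add_sub_add_comm]; exact add_mem hx hy
    | tmul x y =>
      induction y using Smash.induction with
      | zero => simp
      | add y z hy hz => rw [tmul_add, map_add, add_sub_add_comm]; exact add_mem hy hz
      | tmul b h =>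
        rw [smashSectionPre_tmul]
        exact sub_mem_balRel (t := smashT hact hYD hbc) b x (smashEta hact h)
  refine ⟨(balRel (smashS hact) (smashT hact hYD hbc)).liftQ (smashSectionPre hact ρ) h1,
    fun z => ?_, fun r => ?_⟩
  · obtain ⟨z, rfl⟩ := Submodule.mkQ_surjective _ z
    exact balMk_eq_iff.2 (h2 z)
  · change LinearMap.mul' k (Smash hact) ((smashTau hact hYD hbc).toLinearMap.lTensor (Smash hact)
      (smashSectionPre hact ρ (smashComul hact r))) = _
    induction r using Smash.induction with
    | zero => simp
    | add x y hx hy => simp only [map_add, hx, hy]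
    | tmul b h =>
      have e (z : H ⊗[k] H) : LinearMap.mul' k (Smash hact)
          ((smashTau hact hYD hbc).toLinearMap.lTensor (Smash hact)
          (smashSectionPre hact ρ (TensorProduct.map
          (LinearMap.mulLeft k (smashS hact b) ∘ₗ (smashEta hact).toLinearMap)
            (smashEta hact).toLinearMap z))) = smashS hact b * smashEta hact
            (LinearMap.mul' k H ((antipode k).lTensor H z)) := by
        induction z with
        | zero => simp
        | add x y hx hy => simp only [map_add, mul_add, hx, hy]
        | tmul x y =>
          have e1 := smashSectionPre_tmul hact (ρ := ρ) (smashS hact b * smashEta hact x) 1 y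
          rw [map_one, one_mul, smashTLinear_one hact hYD, one_mul] at e1
          rw [map_tmul]
          change LinearMap.mul' k (Smash hact)
            ((smashTau hact hYD hbc).toLinearMap.lTensor (Smash hact)
              (smashSectionPre hact ρ ((smashS hact b * smashEta hact x) ⊗ₜ smashEta hact y))) = _
          rw [e1, LinearMap.lTensor_tmul, LinearMap.mul'_apply, LinearEquiv.coe_coe,
            smashTau_smashEta, LinearMap.lTensor_tmul, LinearMap.mul'_apply, map_mul, mul_assoc]
      rw [smashComul_mul, e, mul_antipode_lTensor_comul_apply, AlgHom.commutes,
        smashCounit_smashS_mul, smashCounit_smashEta, map_mul, AlgHom.commutes]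

theorem smashHopfAlgebroid_isLu : (smashHopfAlgebroid hact hYD hbc).IsLu where
  antipode_t := smashTau_smashTLinear hact hYD hbc
  mul_antipode_left := smash_mul_antipode_left hact hYD hbc
  exists_section := smash_exists_section hact hYD hbc

theorem smashDelta_toSmash (b : B) (h : H) : smashDelta hact hYD hbc (toSmash hact (b ⊗ₜ h)) =
    balMk _ _ (TensorProduct.map ((toSmash hact).toLinearMap ∘ₗ TensorProduct.mk k _ H b)
      ((toSmash hact).toLinearMap ∘ₗ TensorProduct.mk k _ H 1) (comul h)) := by
  rw [smashDelta_apply, toSmash_tmul, smashComul_mul]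
  congr 2
  congr 1
  refine LinearMap.ext fun x => ?_
  exact (toSmash_tmul hact b x).symm

theorem smashCounit_toSmash (b : B) (h : H) :
    smashCounit hact (toSmash hact (b ⊗ₜ h)) = counit (R := k) h • b := by
  rw [toSmash_tmul, smashCounit_smashS_mul, smashCounit_smashEta, Algebra.smul_def,
    Algebra.commutes]

end SmashHopfAlgebroid

end PartialHopf

/-! ### The theorem: the general construction applied to the hom-object -/

theorem mainTheorem7 {k : Type*} {H : Type*} [Field k] [Ring H] [HopfAlgebra k H]
    [FiniteDimensional k H]
    (hS : Function.Bijective (HopfAlgebra.antipode k : H →ₗ[k] H)) :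
    ∃ (ρA : PartialHopf.Apar k H →ₗ[k] PartialHopf.Apar k H ⊗[k] H)
      (ρ : PartialHopf.BraceA k H →ₗ[k] PartialHopf.BraceA k H ⊗[k] H),
      PartialHopf.IsAparCoaction hS ρA ∧
      PartialHopf.IsBraceCoaction hS ρA ρ ∧
      PartialHopf.IsYetterDrinfeldAlgebra hS (PartialHopf.actA k H) ρ ∧
      PartialHopf.IsBraidedCommutative (PartialHopf.actA k H) ρ ∧
      ∃ 𝓗 : PartialHopf.HopfAlgebroid k (PartialHopf.BraceA k H) (PartialHopf.Hglob k H),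
        (∀ f, 𝓗.s f = PartialHopf.toHglob k H (f ⊗ₜ 1)) ∧
        (∀ f, 𝓗.t (MulOpposite.op f) = PartialHopf.toHglob k H (ρ f)) ∧
        (∀ f h, 𝓗.Δ (PartialHopf.toHglob k H (f ⊗ₜ h)) =
          PartialHopf.balMk 𝓗.s 𝓗.t
            (TensorProduct.map
              ((PartialHopf.toHglob k H).toLinearMap ∘ₗ TensorProduct.mk k _ H f)
              ((PartialHopf.toHglob k H).toLinearMap ∘ₗ TensorProduct.mk k _ H 1)
              (Coalgebra.comul h))) ∧
        (∀ f h, 𝓗.ε (PartialHopf.toHglob k H (f ⊗ₜ h)) = Coalgebra.counit (R := k) h • f) ∧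
        𝓗.IsLu :=
  have hYD := PartialHopf.rhoB_isYetterDrinfeldAlgebra hS
  have hbc := PartialHopf.rhoB_isBraidedCommutative hS
  ⟨PartialHopf.rhoA hS, PartialHopf.rhoB hS, PartialHopf.rhoA_isAparCoaction hS,
    PartialHopf.rhoB_isBraceCoaction hS, hYD, hbc,
    PartialHopf.smashHopfAlgebroid (PartialHopf.Brace.isModuleAlgebra _) hYD hbc,
    fun _ => rfl, fun _ => rfl, PartialHopf.smashDelta_toSmash _ hYD hbc,
    PartialHopf.smashCounit_toSmash _, PartialHopf.smashHopfAlgebroid_isLu _ hYD hbc⟩
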